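/- \textbf{Setting.} Let $N\ge 0$, and consider the plant $x_{k+1}=Ax_k+Bu_k+w_k$, $x_k\in\mathbb R^n$, $u_k\in\mathbb R^m$, $k=0,\dots,N$. At each time $k$ a controller sends a signal $v_k$ over a channel; it has a random delay $d_k\in\{0,1,2,\dots\}\cup\{\infty\}$ ($\infty$ means that it is lost) with $\Pr(d_k=d)=p(d)$, where $p$ is arbitrary (unbounded delays are allowed, and $\sum_d p(d)\le 1$). The actuator uses hold-input: $u_k=v_{\tau_k}$, where $\tau_k$ is the largest $j\le k$ with $j+d_j\le k$, and $\tau_k=-1$ if there is none, $v_{-1}$ being a given, initially held input. The initial state $x_0$ and the noises $w_k$ are square integrable, $E[w_k]=0$, and $x_0,w_0,w_1,\dots,d_0,d_1,\dots$ are independent (for instance, $w$ is white Gaussian noise). When $v_k$ is chosen, the controller knows $x_0,\dots,x_k$ and all (instantaneous, lossless) acknowledgements up to time $k-1$, i.e. for all $j\le i<k$ whether $v_j$ has arrived by time $i$; $v_k$ is called causal if it is a measurable function of this information. Let $R$ be symmetric positive definite, let $Q,S_{N+1}$ be symmetric positive semidefinite, and $$J_N=E\Big[\sum_{i=0}^N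 u_i^TRu_i+\sum_{i=0}^N x_i^TQx_i+x_{N+1}^TS_{N+1}x_{N+1}\Big]\in[0,\infty].$$ Let $\zeta_{k}=(v_{k},\dots,v_{\tau_{k}},x_{k+1})$. \textbf{Probabilities.} $P(i)=\sum_{d=0}^ip(d)$, $\bar P=1-P$, $p_d(i)=P(i)\prod_{j=0}^{i-1}\bar P(j)$, $P_d(i)=\sum_{j=0}^ip_d(j)$, $\bar P_d=1-P_d$. Empty sums are $0$, empty products are $1$, $P$ and $P_d$ are $0$ at negative arguments, and quotients $0/0$ are read as $0$ (likewise the inverse of a singular $A_{11}$; by the conclusion below this concerns only signals that cannot arrive within the horizon). For a function $f$ write $\mu_{k,\tau,b}[f]=\sum_{j=\tau+1}^{N-k-b}p(N-k-j)f(j)+\bar P(N-k-1-\tau)f(\tau)$. \textbf{Recursion.} For $k=0,1,\dots,N$ compute the following, where all quantities of the step $-1$ are zero except $T_c(-1,b)=P_d(b-2)R$. Write $A_{11}'=A_{11}(N-k+1)$, and $\eta',\theta',\dots$ for the quantities $K_\eta,K_\theta,\dots$ of the step $k-1$. \begin{align*} M(N-k)&=\sum_{i=N-k}^Np_d(i-(N-k))B^TS_{i+1}A^{i-(N-k)+1},\qquad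 T_c(k,b)=T_c(k-1,b+1)+p_d(b-1)B^TS_{N-k+1}B,\\ K_e(k)&=\sum_{i=N-k+1}^N\sum_{j=N-k+1}^i\bar P_d(i-(N-k+1))P(k+j-N-1)B^TS_{i+1}A^{i-j+1}B,\\ Z_{ij}&=\bar P_d(i-(N-k+1))\,(P(i-N+k)-P(k+j-N-1))\,B^TS_{i+1}A^{i-j+1}B,\\ \alpha_j(t)&=\tfrac{P(k+j-N-1+t)-P(t-1)}{\bar P(t-1)}\prod_{h=2}^t\tfrac{\bar P(k+j-N+h-2)}{\bar P(h-2)},\qquad \beta_j(s)=\prod_{h=1}^s\tfrac{\bar P(k+j-N+h-1)}{\bar P(h-1)},\\ K_\zeta(k,\tau,b)&=\sum_{i=N-k+1}^N\sum_{j=N-k+1}^iZ_{ij}\Big(\sum_{t=b}^{N-k-1-\tau}\alpha_j(t)v_{N-k-t}+\beta_j(N-k-1-\tau)v_\tau\Big),\\ K_{\zeta C}(k,b)&=\sum_{i,j}\alpha_j(b)Z_{ij},\qquad K_{\zeta RL}(k,b)=\sum_{i,j}\beta_j(b-1)Z_{ij}\quad\text{(same ranges of } i,j). \end{align*} Next,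 for $b,h\ge1$, \begin{align*} K_{\alpha Cs}(k,b)&=p(b)\eta_{RL}'(b+1)^TA_{11}'^{-1}\eta_{RL}'(b+1)+\bar P(b)\eta_C'(b+1)^TA_{11}'^{-1}\eta_C'(b+1),\\ K_{\alpha RL}(k,b)&=\bar P(b-1)\eta_{RL}'(b+1)^TA_{11}'^{-1}\eta_{RL}'(b+1),\\ K_{\alpha Cd}(k,\tau,b,h)&=\mu_{k,\tau,b}\big[j\mapsto\eta_C'(h+1)^TA_{11}'^{-1}\eta'(j,b+1)\big],\\ K_{\alpha CdC}(k,b,h)&=\eta_C'(h+1)^TA_{11}'^{-1}\big(\bar P(b)\eta_C'(b+1)+p(b)\eta_{RL}'(b+1)\big),\\ K_{\alpha CdRL}(k,b,h)&=\bar P(b-1)\eta_C'(h+1)^TA_{11}'^{-1}\eta_{RL}'(b+1),\\ K_\beta(k,\tau,b)&=\eta_C'(1)^TA_{11}'^{-1}\mu_{k,\tau,b}[j\mapsto\eta'(j,b+1)],\\ K_{\beta C}(k,b)&=\eta_C'(1)^TA_{11}'^{-1}\big(p(b)\eta_{RL}'(b+1)+\bar P(b)\eta_C'(b+1)\big),\quad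 K_{\beta RL}(k,b)=\bar P(b-1)\eta_C'(1)^TA_{11}'^{-1}\eta_{RL}'(b+1),\\ K_{rCs}(k,b)&=\bar P(b)r_{Cs}'(b+1)+p(b)r_{RL}'(b+1)+K_{\alpha Cs}(k,b),\quad K_{rRL}(k,b)=\bar P(b-1)r'_{RL}(b+1)+K_{\alpha RL}(k,b),\\ K_{rCd}(k,\tau,b,h)&=\mu_{k,\tau,b}[j\mapsto r_{Cd}'(j,b+1,h+1)]+K_{\alpha Cd}(k,\tau,b,h),\\ K_{rCdC}(k,b,h)&=\bar P(b)r_{CdC}'(b+1,h+1)+K_{\alpha CdC}(k,b,h)+p(b)r'_{CdRL}(b+1,h+1),\\ K_{rCdRL}(k,b,h)&=\bar P(b-1)r'_{CdRL}(b+1,h+1)+K_{\alpha CdRL}(k,b,h),\\ K_{uxC}(k,b)&=\bar P(b)\theta'_C(b+1)A+p(b)\theta'_{RL}(b+1)A,\quad K_{uxRL}(k,b)=\bar P(b-1)\theta'_{RL}(b+1)A,\\ K_{gx}(k,b)&=\bar P(0)\theta_C'(b)A+p(0)\theta_{RL}'(b)A,\\ K_{uuCs}(k,b)&=p(b)\theta'_{RL}(b+1)B+p(b)uu'_{RL}(b+1)+\bar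 P(b)uu'_{Cs}(b+1),\\ K_{uuRL}(k,b)&=\bar P(b-1)\big(\theta'_{RL}(b+1)B+uu'_{RL}(b+1)\big),\\ K_{uuCd}(k,\tau,b,h)&=\mu_{k,\tau,b}\big[j\mapsto\theta_C'(h)Bv_j+uu'_{Cd}(j,b+1,h+1)\big],\\ K_{uuCdC}(k,b,h)&=p(b)\theta_C'(h)B+\bar P(b)uu'_{CdC}(b+1,h+1)+p(b)uu'_{CdRL}(b+1,h+1),\\ K_{uuCdRL}(k,b,h)&=\bar P(b-1)\big(\theta_C'(h)B+uu'_{CdRL}(b+1,h+1)\big),\\ K_{gu}(k,\tau,b,h)&=\mu_{k,\tau,b}\big[j\mapsto\theta_C'(h)Bv_j+uu'_{Cd}(j,b+1,h+1)+r'_{Cd}(j,b+1,h)\big]+K_\beta(k,\tau,b),\\ K_{guC}(k,b,h)&=p(b)\theta_C'(h)B+K_{\beta C}(k,b)+\bar P(b)\big(uu'_{CdC}(b+1,h+1)+r'_{CdC}(b+1,h)\big)\\&\quad+p(b)\big(uu'_{CdRL}(b+1,h+1)+r'_{CdRL}(b+1,h)\big),\\ K_{guRL}(k,b,h)&=\bar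 P(b-1)\big(\theta'_C(h)B+uu'_{CdRL}(b+1,h+1)+r'_{CdRL}(b+1,h)\big)+K_{\beta RL}(k,b),\\ K_{gg}(k)&=p(0)\eta_{RL}'(1)^TA_{11}'^{-1}\eta'_{RL}(1)+\bar P(0)\eta_C'(1)^TA_{11}'^{-1}\eta_C'(1)\\&\quad+\bar P(0)\big(2uu'_{Cs}(1)+r'_{Cs}(1)\big)+p(0)\big(2uu'_{RL}(1)+r'_{RL}(1)\big). \end{align*} Finally $A_{11}(N-k)=\tfrac12(G+G^T)$ with $G=-K_{gg}(k)-2p(0)\theta_{RL}'(1)B+T_c(k,1)+2K_e(k)$, and, with $L_k=M(N-k)-K_{gx}(k,1)$, \begin{align*} &K_\eta(k,\tau,b)=K_\zeta(k,\tau,b)-K_{gu}(k,\tau,b,1),\quad K_{\eta C}(k,b)=K_{\zeta C}(k,b)-K_{guC}(k,b,1),\\ &K_{\eta RL}(k,b)=K_{\zeta RL}(k,b)-K_{guRL}(k,b,1),\\ &K_{\theta C}(k,b)=K_{\eta C}(k,b)^TA_{11}^{-1}(N-k)L_k+K_{uxC}(k,b),\quad K_{\theta RL}(k,b)=K_{\eta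 RL}(k,b)^TA_{11}^{-1}(N-k)L_k+K_{uxRL}(k,b),\\ &S_{N-k}=A^TS_{N-k+1}A-L_k^TA_{11}^{-1}(N-k)L_k+Q,\\ &A_{12}(N-k,\tau)\zeta=K_\zeta(k,\tau,1)-K_{gx}(k,1)x-K_{gu}(k,\tau,1,1)+M(N-k)x\quad\text{for }\zeta=(v_{N-k-1},\dots,v_\tau,x). \end{align*} \textbf{Conclusion.} (a) $A_{12}(N-k,\tau)$ is a matrix acting on $\zeta$: for $0\le k\le N$ and $-1\le\tau\le N-k-1$, $$A_{12}(N-k,\tau)\zeta=\sum_{t=\tau+1}^{N-k-1}K_{\eta C}(k,N-k-t)v_t+K_{\eta RL}(k,N-k-\tau)v_\tau+L_kx.$$ (b) $A_{11}(N-k)$ is positive definite whenever $P(k)>0$. (If $P(k)=0$, then $v_{N-k}$ almost surely does not reach the actuator within the horizon.) (c) The feedback law $$v_{N-k}=-A_{11}^{-1}(N-k)\,A_{12}(N-k,\tau_{N-k-1})\,\zeta_{N-k-1},\qquad k=0,\dots,N,$$ defines a causal control with $J_N<\infty$. (d) A causal control minimizes $J_N$ among all causal controls if and only if it satisfies this feedback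 law almost surely for every $k\in\{0,\dots,N\}$ with $P(k)>0$. -/

import Mathlib

open MeasureTheory ProbabilityTheory Matrix
open scoped ENNReal

/-- The data of the control problem: horizon `N`, plant matrices `A`, `B`, cost weights `Q`, `R` and
terminal weight `Sfin` (the matrix `S_{N+1}`), and the delay probabilities `p d`, `d = 0, 1, 2, …`.
If `∑ p d < 1`, the missing mass is the probability that a packet is lost. -/
structure HoldLQ (n m : ℕ) where
  N : ℕ
  A : Matrix (Fin n) (Fin n) ℝ
  B : Matrix (Fin n) (Fin m) ℝ
  Q : Matrix (Fin n) (Fin n) ℝ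
  R : Matrix (Fin m) (Fin m) ℝ
  Sfin : Matrix (Fin n) (Fin n) ℝ
  p : ℕ → ℝ

/-- Everything that is computed in the step `k` of the backward recursion, i.e. for time `N - k`.
`b`, `h` are natural-number counters, times are integers, a sequence `v : ℤ → ℝᵐ` is a record of
transmitted controls. Names: `etaC k b` is the sub-function `K_{η C}(k, b)`, and so on. -/
structure GainData (n m : ℕ) where
  /-- The matrices `S_t`, for the times `t = N - k, …, N + 1` that have been reached. -/
  S : ℤ → Matrix (Fin n) (Fin n) ℝ
  /-- `T_c(k, b)` -/
  Tc : ℕ → Matrix (Fin m) (Fin m) ℝ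
  /-- `A₁₁(N - k)` -/
  A11 : Matrix (Fin m) (Fin m) ℝ
  /-- `K_η(k, τ, b)`, for the record `v` of controls -/
  eta : (ℤ → Fin m → ℝ) → ℤ → ℕ → (Fin m → ℝ)
  etaC : ℕ → Matrix (Fin m) (Fin m) ℝ
  etaRL : ℕ → Matrix (Fin m) (Fin m) ℝ
  thetaC : ℕ → Matrix (Fin m) (Fin n) ℝ
  thetaRL : ℕ → Matrix (Fin m) (Fin n) ℝ
  uuCs : ℕ → Matrix (Fin m) (Fin m) ℝ
  uuRL : ℕ → Matrix (Fin m) (Fin m) ℝ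
  /-- `K_{uu Cd}(k, τ, b, h)` -/
  uuCd : (ℤ → Fin m → ℝ) → ℤ → ℕ → ℕ → (Fin m → ℝ)
  uuCdC : ℕ → ℕ → Matrix (Fin m) (Fin m) ℝ
  uuCdRL : ℕ → ℕ → Matrix (Fin m) (Fin m) ℝ
  rCs : ℕ → Matrix (Fin m) (Fin m) ℝ
  rRL : ℕ → Matrix (Fin m) (Fin m) ℝ
  /-- `K_{r Cd}(k, τ, b, h)` -/
  rCd : (ℤ → Fin m → ℝ) → ℤ → ℕ → ℕ → (Fin m → ℝ)
  rCdC : ℕ → ℕ → Matrix (Fin m) (Fin m) ℝ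
  rCdRL : ℕ → ℕ → Matrix (Fin m) (Fin m) ℝ

noncomputable section

namespace HoldLQ

variable {n m : ℕ} (c : HoldLQ n m)

/-! ## Delay probabilities -/

/-- `P(i) = p(0) + … + p(i)`, zero for negative `i`. -/
def P (i : ℤ) : ℝ := ∑ d ∈ Finset.range (i + 1).toNat, c.p d

/-- `P̄(i) = 1 - P(i)`; in particular `P̄(0) = p̄(0)`. -/
def Pbar (i : ℤ) : ℝ := 1 - c.P i

/-- `p_d(i) = P(i) P̄(0) ⋯ P̄(i-1)`: the probability that the newest signal that has arrived is the
one sent `i` time units ago. -/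
def pd (i : ℤ) : ℝ := c.P i * ∏ j ∈ Finset.range i.toNat, c.Pbar j

/-- `P_d(i) = p_d(0) + … + p_d(i)`. -/
def Pd (i : ℤ) : ℝ := ∑ j ∈ Finset.range (i + 1).toNat, c.pd j

/-- `P̄_d(i) = 1 - P_d(i)`. -/
def Pdbar (i : ℤ) : ℝ := 1 - c.Pd i

/-- The average `∑_{j=τ+1}^{N-k-b} p(N-k-j) f(j) + P̄(N-k-1-τ) f(τ)`. -/
def mean (k : ℕ) (τ : ℤ) (b : ℕ) (f : ℤ → Fin m → ℝ) : Fin m → ℝ :=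
  ∑ j ∈ Finset.Icc (τ + 1) (c.N - k - b), c.p (c.N - k - j).toNat • f j +
    c.Pbar (c.N - k - 1 - τ) • f τ

/-! ## The gain recursions

In what follows `g` is the data of the step `k - 1` when the quantities of the step `k` are
computed. -/

/-- `M(N-k) = ∑_{i=N-k}^N p_d(i-(N-k)) Bᵀ S_{i+1} A^{i-(N-k)+1}` -/
def M (k : ℕ) (g : GainData n m) : Matrix (Fin m) (Fin n) ℝ :=
  ∑ i ∈ Finset.Icc ((c.N : ℤ) - k) c.N,
    c.pd (i - (c.N - k)) • (c.Bᵀ * g.S (i + 1) * c.A ^ (i - (c.N - k) + 1).toNat)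

/-- `T_c(k,b) = T_c(k-1,b+1) + p_d(b-1) Bᵀ S_{N-k+1} B` -/
def Tc (k : ℕ) (g : GainData n m) (b : ℕ) : Matrix (Fin m) (Fin m) ℝ :=
  g.Tc (b + 1) + c.pd (b - 1) • (c.Bᵀ * g.S (c.N - k + 1) * c.B)

/-- `K_e(k)` -/
def Ke (k : ℕ) (g : GainData n m) : Matrix (Fin m) (Fin m) ℝ :=
  ∑ i ∈ Finset.Icc ((c.N : ℤ) - k + 1) c.N, ∑ j ∈ Finset.Icc ((c.N : ℤ) - k + 1) i,
    (c.Pdbar (i - (c.N - k + 1)) * c.P (k + j - c.N - 1)) •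
      (c.Bᵀ * g.S (i + 1) * c.A ^ (i - j + 1).toNat * c.B)

/-- The matrix `P̄_d(i-(N-k+1)) (P(i-N+k) - P(k+j-N-1)) Bᵀ S_{i+1} A^{i-j+1} B` that is common to
`K_ζ(k, ·, ·)`, `K_{ζ C}(k, ·)` and `K_{ζ RL}(k, ·)`. -/
def zetaMat (k : ℕ) (g : GainData n m) (i j : ℤ) : Matrix (Fin m) (Fin m) ℝ :=
  (c.Pdbar (i - (c.N - k + 1)) * (c.P (i - c.N + k) - c.P (k + j - c.N - 1))) •
    (c.Bᵀ * g.S (i + 1) * c.A ^ (i - j + 1).toNat * c.B)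

/-- `(P(k+j-N-1+t) - P(t-1)) / P̄(t-1) · ∏_{h=2}^t P̄(k+j-N+h-2) / P̄(h-2)` -/
def zetaWeight (k : ℕ) (j t : ℤ) : ℝ :=
  (c.P (k + j - c.N - 1 + t) - c.P (t - 1)) / c.Pbar (t - 1) *
    ∏ h ∈ Finset.Icc 2 t, c.Pbar (k + j - c.N + h - 2) / c.Pbar (h - 2)

/-- `∏_{h=1}^s P̄(k+j-N+h-1) / P̄(h-1)` -/
def zetaLast (k : ℕ) (j s : ℤ) : ℝ :=
  ∏ h ∈ Finset.Icc 1 s, c.Pbar (k + j - c.N + h - 1) / c.Pbar (h - 1)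

/-- `K_ζ(k, τ, b)` -/
def Kzeta (k : ℕ) (g : GainData n m) (v : ℤ → Fin m → ℝ) (τ : ℤ) (b : ℕ) : Fin m → ℝ :=
  ∑ i ∈ Finset.Icc ((c.N : ℤ) - k + 1) c.N, ∑ j ∈ Finset.Icc ((c.N : ℤ) - k + 1) i,
    c.zetaMat k g i j *ᵥ
      (∑ t ∈ Finset.Icc (b : ℤ) (c.N - k - 1 - τ), c.zetaWeight k j t • v (c.N - k - t) +
        c.zetaLast k j (c.N - k - 1 - τ) • v τ)

def KzetaC (k : ℕ) (g : GainData n m) (b : ℕ) : Matrix (Fin m) (Fin m) ℝ :=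
  ∑ i ∈ Finset.Icc ((c.N : ℤ) - k + 1) c.N, ∑ j ∈ Finset.Icc ((c.N : ℤ) - k + 1) i,
    c.zetaWeight k j b • c.zetaMat k g i j

def KzetaRL (k : ℕ) (g : GainData n m) (b : ℕ) : Matrix (Fin m) (Fin m) ℝ :=
  ∑ i ∈ Finset.Icc ((c.N : ℤ) - k + 1) c.N, ∑ j ∈ Finset.Icc ((c.N : ℤ) - k + 1) i,
    c.zetaLast k j (b - 1) • c.zetaMat k g i j

/-! `K_α`: sub-functions -/

def KalphaCs (g : GainData n m) (b : ℕ) : Matrix (Fin m) (Fin m) ℝ :=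
  c.p b • ((g.etaRL (b + 1))ᵀ * g.A11⁻¹ * g.etaRL (b + 1)) +
    c.Pbar b • ((g.etaC (b + 1))ᵀ * g.A11⁻¹ * g.etaC (b + 1))

def KalphaRL (g : GainData n m) (b : ℕ) : Matrix (Fin m) (Fin m) ℝ :=
  c.Pbar (b - 1) • ((g.etaRL (b + 1))ᵀ * g.A11⁻¹ * g.etaRL (b + 1))

def KalphaCd (k : ℕ) (g : GainData n m) (v : ℤ → Fin m → ℝ) (τ : ℤ) (b h : ℕ) : Fin m → ℝ :=
  c.mean k τ b fun j => ((g.etaC (h + 1))ᵀ * g.A11⁻¹) *ᵥ g.eta v j (b + 1)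

def KalphaCdC (g : GainData n m) (b h : ℕ) : Matrix (Fin m) (Fin m) ℝ :=
  c.Pbar b • ((g.etaC (h + 1))ᵀ * g.A11⁻¹ * g.etaC (b + 1)) +
    c.p b • ((g.etaC (h + 1))ᵀ * g.A11⁻¹ * g.etaRL (b + 1))

def KalphaCdRL (g : GainData n m) (b h : ℕ) : Matrix (Fin m) (Fin m) ℝ :=
  c.Pbar (b - 1) • ((g.etaC (h + 1))ᵀ * g.A11⁻¹ * g.etaRL (b + 1))

/-! `K_β` (written as a column vector) and its sub-functions -/

def Kbeta (k : ℕ) (g : GainData n m) (v : ℤ → Fin m → ℝ) (τ : ℤ) (b : ℕ) : Fin m → ℝ :=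
  ((g.etaC 1)ᵀ * g.A11⁻¹) *ᵥ c.mean k τ b fun j => g.eta v j (b + 1)

def KbetaC (g : GainData n m) (b : ℕ) : Matrix (Fin m) (Fin m) ℝ :=
  (g.etaC 1)ᵀ * g.A11⁻¹ * (c.p b • g.etaRL (b + 1) + c.Pbar b • g.etaC (b + 1))

def KbetaRL (g : GainData n m) (b : ℕ) : Matrix (Fin m) (Fin m) ℝ :=
  c.Pbar (b - 1) • ((g.etaC 1)ᵀ * g.A11⁻¹ * g.etaRL (b + 1))

/-! `K_r`: sub-functions -/

def KrCs (g : GainData n m) (b : ℕ) : Matrix (Fin m) (Fin m) ℝ :=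
  c.Pbar b • g.rCs (b + 1) + c.p b • g.rRL (b + 1) + c.KalphaCs g b

def KrRL (g : GainData n m) (b : ℕ) : Matrix (Fin m) (Fin m) ℝ :=
  c.Pbar (b - 1) • g.rRL (b + 1) + c.KalphaRL g b

def KrCd (k : ℕ) (g : GainData n m) (v : ℤ → Fin m → ℝ) (τ : ℤ) (b h : ℕ) : Fin m → ℝ :=
  (c.mean k τ b fun j => g.rCd v j (b + 1) (h + 1)) + c.KalphaCd k g v τ b h

def KrCdC (g : GainData n m) (b h : ℕ) : Matrix (Fin m) (Fin m) ℝ :=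
  c.Pbar b • g.rCdC (b + 1) (h + 1) + c.KalphaCdC g b h + c.p b • g.rCdRL (b + 1) (h + 1)

def KrCdRL (g : GainData n m) (b h : ℕ) : Matrix (Fin m) (Fin m) ℝ :=
  c.Pbar (b - 1) • g.rCdRL (b + 1) (h + 1) + c.KalphaCdRL g b h

/-! `K_{ux}`, `K_{gx}` -/

def KuxC (g : GainData n m) (b : ℕ) : Matrix (Fin m) (Fin n) ℝ :=
  c.Pbar b • (g.thetaC (b + 1) * c.A) + c.p b • (g.thetaRL (b + 1) * c.A)

def KuxRL (g : GainData n m) (b : ℕ) : Matrix (Fin m) (Fin n) ℝ :=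
  c.Pbar (b - 1) • (g.thetaRL (b + 1) * c.A)

def Kgx (g : GainData n m) (b : ℕ) : Matrix (Fin m) (Fin n) ℝ :=
  c.Pbar 0 • (g.thetaC b * c.A) + c.p 0 • (g.thetaRL b * c.A)

/-! `K_{uu}`: sub-functions -/

def KuuCs (g : GainData n m) (b : ℕ) : Matrix (Fin m) (Fin m) ℝ :=
  c.p b • (g.thetaRL (b + 1) * c.B) + c.p b • g.uuRL (b + 1) + c.Pbar b • g.uuCs (b + 1)

def KuuRL (g : GainData n m) (b : ℕ) : Matrix (Fin m) (Fin m) ℝ :=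
  c.Pbar (b - 1) • (g.thetaRL (b + 1) * c.B) + c.Pbar (b - 1) • g.uuRL (b + 1)

def KuuCd (k : ℕ) (g : GainData n m) (v : ℤ → Fin m → ℝ) (τ : ℤ) (b h : ℕ) : Fin m → ℝ :=
  (c.mean k τ b fun j => (g.thetaC h * c.B) *ᵥ v j) +
    c.mean k τ b fun j => g.uuCd v j (b + 1) (h + 1)

def KuuCdC (g : GainData n m) (b h : ℕ) : Matrix (Fin m) (Fin m) ℝ :=
  c.p b • (g.thetaC h * c.B) + c.Pbar b • g.uuCdC (b + 1) (h + 1) +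
    c.p b • g.uuCdRL (b + 1) (h + 1)

def KuuCdRL (g : GainData n m) (b h : ℕ) : Matrix (Fin m) (Fin m) ℝ :=
  c.Pbar (b - 1) • (g.thetaC h * c.B) + c.Pbar (b - 1) • g.uuCdRL (b + 1) (h + 1)

/-! `K_{gu}` and its sub-functions -/

def Kgu (k : ℕ) (g : GainData n m) (v : ℤ → Fin m → ℝ) (τ : ℤ) (b h : ℕ) : Fin m → ℝ :=
  (c.mean k τ b fun j => (g.thetaC h * c.B) *ᵥ v j) + c.Kbeta k g v τ b +
    (c.mean k τ b fun j => g.uuCd v j (b + 1) (h + 1)) +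
    c.mean k τ b fun j => g.rCd v j (b + 1) h

def KguC (g : GainData n m) (b h : ℕ) : Matrix (Fin m) (Fin m) ℝ :=
  c.p b • (g.thetaC h * c.B) + c.KbetaC g b +
    c.Pbar b • g.uuCdC (b + 1) (h + 1) + c.Pbar b • g.rCdC (b + 1) h +
    c.p b • g.uuCdRL (b + 1) (h + 1) + c.p b • g.rCdRL (b + 1) h

def KguRL (g : GainData n m) (b h : ℕ) : Matrix (Fin m) (Fin m) ℝ :=
  c.Pbar (b - 1) • (g.thetaC h * c.B) + c.KbetaRL g b +
    c.Pbar (b - 1) • g.uuCdRL (b + 1) (h + 1) + c.Pbar (b - 1) • g.rCdRL (b + 1) h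

/-! `K_{gg}` and `A₁₁` -/

def Kgg (g : GainData n m) : Matrix (Fin m) (Fin m) ℝ :=
  c.p 0 • ((g.etaRL 1)ᵀ * g.A11⁻¹ * g.etaRL 1) +
    c.Pbar 0 • ((g.etaC 1)ᵀ * g.A11⁻¹ * g.etaC 1) +
    (2 * c.Pbar 0) • g.uuCs 1 + c.Pbar 0 • g.rCs 1 +
    c.p 0 • ((2 : ℝ) • g.uuRL 1 + g.rRL 1)

/-- `-K_{gg}(k) - 2 p(0) K_{θ RL}(k-1, 1) B + T_c(k, 1) + 2 K_e(k)`: a matrix of the quadratic form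
in `v_{N-k}`, not symmetric in general. -/
def A11form (k : ℕ) (g : GainData n m) : Matrix (Fin m) (Fin m) ℝ :=
  -c.Kgg g - (2 * c.p 0) • (g.thetaRL 1 * c.B) + c.Tc k g 1 + (2 : ℝ) • c.Ke k g

/-- `A₁₁(N-k)`: the symmetric matrix of the quadratic form in `v_{N-k}`. -/
def A11step (k : ℕ) (g : GainData n m) : Matrix (Fin m) (Fin m) ℝ :=
  (1 / 2 : ℝ) • (c.A11form k g + (c.A11form k g)ᵀ)

/-! `K_η`, `K_θ` and `S` -/

def Keta (k : ℕ) (g : GainData n m) (v : ℤ → Fin m → ℝ) (τ : ℤ) (b : ℕ) : Fin m → ℝ :=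
  c.Kzeta k g v τ b - c.Kgu k g v τ b 1

def KetaC (k : ℕ) (g : GainData n m) (b : ℕ) : Matrix (Fin m) (Fin m) ℝ :=
  c.KzetaC k g b - c.KguC g b 1

def KetaRL (k : ℕ) (g : GainData n m) (b : ℕ) : Matrix (Fin m) (Fin m) ℝ :=
  c.KzetaRL k g b - c.KguRL g b 1

def KthetaC (k : ℕ) (g : GainData n m) (b : ℕ) : Matrix (Fin m) (Fin n) ℝ :=
  (c.KetaC k g b)ᵀ * (c.A11step k g)⁻¹ * (-c.Kgx g 1 + c.M k g) + c.KuxC g b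

def KthetaRL (k : ℕ) (g : GainData n m) (b : ℕ) : Matrix (Fin m) (Fin n) ℝ :=
  (c.KetaRL k g b)ᵀ * (c.A11step k g)⁻¹ * (-c.Kgx g 1 + c.M k g) + c.KuxRL g b

/-- `S_{N-k}`, with `T_X(k) = Aᵀ S_{N-k+1} A` -/
def Sstep (k : ℕ) (g : GainData n m) : Matrix (Fin n) (Fin n) ℝ :=
  -((c.M k g - c.Kgx g 1)ᵀ * (c.A11step k g)⁻¹ * (c.M k g - c.Kgx g 1)) +
    c.Aᵀ * g.S (c.N - k + 1) * c.A + c.Q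

/-- The step `k` of the backward recursion, from the data `g` of the step `k - 1`. -/
def step (k : ℕ) (g : GainData n m) : GainData n m where
  S := Function.update g.S (c.N - k) (c.Sstep k g)
  Tc := c.Tc k g
  A11 := c.A11step k g
  eta := c.Keta k g
  etaC := c.KetaC k g
  etaRL := c.KetaRL k g
  thetaC := c.KthetaC k g
  thetaRL := c.KthetaRL k g
  uuCs := c.KuuCs g
  uuRL := c.KuuRL g
  uuCd := c.KuuCd k g
  uuCdC := c.KuuCdC g
  uuCdRL := c.KuuCdRL g
  rCs := c.KrCs g
  rRL := c.KrRL g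
  rCd := c.KrCd k g
  rCdC := c.KrCdC g
  rCdRL := c.KrCdRL g

/-- The data in front of the step `0`: the terminal weight, the control weights
`R_i = P_d(N-i) R` with `i = N + 2 - b`, so that `T_c(0,b) = R_{N+1-b} + p_d(b-1) Bᵀ S_{N+1} B`,
and zero for all gains. With these zeros the general recursion gives the special formulas of the
first steps: `K_{gg}`, `K_{gx}`, `K_{gu}`, `K_{ux}`, `K_{uu}`, `K_r` vanish for `k ≤ 1`,
`K_η(1,·,·) = K_ζ(1,·,·)`, `K_r(2,·,·) = K_α(2,·,·)`, `A₁₁(N) = T_c(0,1)` and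
`A₁₂(N) ζ_{N-1} = M(N) x_N = p_d(0) Bᵀ S_{N+1} A x_N`. -/
def start : GainData n m where
  S := fun _ => c.Sfin
  Tc := fun b => c.Pd (b - 2) • c.R
  A11 := 0
  eta := 0
  etaC := 0
  etaRL := 0
  thetaC := 0
  thetaRL := 0
  uuCs := 0
  uuRL := 0
  uuCd := 0
  uuCdC := 0
  uuCdRL := 0
  rCs := 0
  rRL := 0
  rCd := 0
  rCdC := 0
  rCdRL := 0

/-- `prev k` is the data of the step `k - 1`. -/
def prev : ℕ → GainData n m
  | 0 => c.start
  | k + 1 => c.step k (prev k)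

/-- `A₁₁(N-k)` -/
def A11 (k : ℕ) : Matrix (Fin m) (Fin m) ℝ := c.A11step k (c.prev k)

/-- `A₁₂(N-k, τ) ζ = K_ζ(k,τ,1) - K_{gx}(k,1) x - K_{gu}(k,τ,1,1) + M(N-k) x`, where
`ζ = (v_{N-k-1}, …, v_τ, x)` with `x = x_{N-k}`. -/
def A12zeta (k : ℕ) (v : ℤ → Fin m → ℝ) (τ : ℤ) (x : Fin n → ℝ) : Fin m → ℝ :=
  c.Kzeta k (c.prev k) v τ 1 - c.Kgx (c.prev k) 1 *ᵥ x - c.Kgu k (c.prev k) v τ 1 1 +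
    c.M k (c.prev k) *ᵥ x

/-- The block of the matrix `A₁₂(N-k, τ)` that acts on the component `v_t` of `ζ`,
`τ ≤ t ≤ N - k - 1`: it is `K_{ηRL}(k, N-k-τ)` for `t = τ` and `K_{ηC}(k, N-k-t)` for `t > τ`. -/
def A12v (k : ℕ) (τ t : ℤ) : Matrix (Fin m) (Fin m) ℝ :=
  if t = τ then c.KetaRL k (c.prev k) (c.N - k - τ).toNat
  else c.KetaC k (c.prev k) (c.N - k - t).toNat

/-- The block of `A₁₂(N-k, τ)` that acts on the component `x_{N-k}` of `ζ`. -/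
def A12x (k : ℕ) : Matrix (Fin m) (Fin n) ℝ := c.M k (c.prev k) - c.Kgx (c.prev k) 1

/-! ## The closed loop -/

variable {Ω : Type*}

/-- The newest `j < i` with `d j + j < k`, and `-1` if there is none. -/
def newest (d : ℕ → ℕ∞) (k : ℕ) : ℕ → ℤ
  | 0 => -1
  | j + 1 => if d j + j < k then (j : ℤ) else newest d k j

/-- `τ_{k-1}`: the sending time of the newest control signal that has reached the actuator before
time `k`, where the signal sent at time `j` has the delay `d j` (`⊤` if it is lost). As long as
nothing has arrived it is `-1`, the index of the initially held input. -/
def tauPrev (d : ℕ → ℕ∞) (k : ℕ) : ℤ := newest d k k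

/-- The transmitted controls `v_0, v_1, …`, preceded by the initially held input `v_{-1}`. -/
def record (u₀ : Fin m → ℝ) (v : ℕ → Fin m → ℝ) (t : ℤ) : Fin m → ℝ :=
  if t < 0 then u₀ else v t.toNat

/-- The input applied at time `k` (hold-input): `u_k = v_{τ_k}`. -/
def input (d : ℕ → ℕ∞) (u₀ : Fin m → ℝ) (v : ℕ → Fin m → ℝ) (k : ℕ) : Fin m → ℝ :=
  record u₀ v (tauPrev d (k + 1))

/-- The plant: `x_{k+1} = A x_k + B u_k + w_k`. -/
def state (x₀ : Fin n → ℝ) (w : ℕ → Fin n → ℝ) (d : ℕ → ℕ∞) (u₀ : Fin m → ℝ)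
    (v : ℕ → Fin m → ℝ) : ℕ → Fin n → ℝ
  | 0 => x₀
  | k + 1 => c.A *ᵥ state x₀ w d u₀ v k + c.B *ᵥ input d u₀ v k + w k

/-- The cost of one realization. -/
def pathCost (x₀ : Fin n → ℝ) (w : ℕ → Fin n → ℝ) (d : ℕ → ℕ∞) (u₀ : Fin m → ℝ)
    (v : ℕ → Fin m → ℝ) : ℝ :=
  ∑ i ∈ Finset.range (c.N + 1), input d u₀ v i ⬝ᵥ (c.R *ᵥ input d u₀ v i) +
    ∑ i ∈ Finset.range (c.N + 1),
      c.state x₀ w d u₀ v i ⬝ᵥ (c.Q *ᵥ c.state x₀ w d u₀ v i) +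
    c.state x₀ w d u₀ v (c.N + 1) ⬝ᵥ (c.Sfin *ᵥ c.state x₀ w d u₀ v (c.N + 1))

/-- The criterion `J_N`, the expected cost; it is a number in `[0, ∞]`, as the cost of each
realization is nonnegative for positive semidefinite weights. -/
def J [MeasurableSpace Ω] (μ : Measure Ω) (x₀ : Ω → Fin n → ℝ) (w : ℕ → Ω → Fin n → ℝ)
    (d : ℕ → Ω → ℕ∞) (u₀ : Fin m → ℝ) (v : ℕ → Ω → Fin m → ℝ) : ℝ≥0∞ :=
  ∫⁻ ω, ENNReal.ofReal
    (c.pathCost (x₀ ω) (fun i => w i ω) (fun i => d i ω) u₀ (fun i => v i ω)) ∂μ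

/-- The information of the controller when it chooses `v_k`: the states `x_0, …, x_k`, and all
acknowledgements up to time `k - 1`, i.e. for all `i < k` and all `j` whether the signal sent at
time `j` has arrived by time `i`. -/
@[reducible] def info (x₀ : Ω → Fin n → ℝ) (w : ℕ → Ω → Fin n → ℝ) (d : ℕ → Ω → ℕ∞) (u₀ : Fin m → ℝ)
    (v : ℕ → Ω → Fin m → ℝ) (k : ℕ) : MeasurableSpace Ω :=
  (⨆ i ∈ Set.Iic k, MeasurableSpace.comap
      (fun ω => c.state (x₀ ω) (fun l => w l ω) (fun l => d l ω) u₀ (fun l => v l ω) i)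
      inferInstance) ⊔
    MeasurableSpace.generateFrom {s | ∃ i j : ℕ, i < k ∧ s = {ω | d j ω + j ≤ i}}

/-- A causal control process: each transmitted control is a measurable function of the information
available when it is sent. -/
def Admissible (x₀ : Ω → Fin n → ℝ) (w : ℕ → Ω → Fin n → ℝ) (d : ℕ → Ω → ℕ∞)
    (u₀ : Fin m → ℝ) (v : ℕ → Ω → Fin m → ℝ) : Prop :=
  ∀ k ≤ c.N, Measurable[c.info x₀ w d u₀ v k] (v k)

/-- The feedback `-A₁₁⁻¹(N-k) A₁₂(N-k, τ_{N-k-1}) ζ_{N-k-1}`, evaluated along one realization of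
the process `v`. -/
def feedback (x₀ : Fin n → ℝ) (w : ℕ → Fin n → ℝ) (d : ℕ → ℕ∞) (u₀ : Fin m → ℝ)
    (v : ℕ → Fin m → ℝ) (k : ℕ) : Fin m → ℝ :=
  -((c.A11 k)⁻¹ *ᵥ
    c.A12zeta k (record u₀ v) (tauPrev d (c.N - k)) (c.state x₀ w d u₀ v (c.N - k)))

end HoldLQ

end

/-! The proof is dynamic programming in which the index `τ` of the newest arrived signal is a Markov
mode. Given the past, signal `j > τ` becomes the newest at time `t` with probability `p(t-j)`, and
`τ` survives with probability `P̄(t-1-τ)`: the conditional probabilities that the signals in between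
are still under way telescope. One step of the chain is therefore the average `avg`, and
`IsNoise.lintegral_tauPrev` proves this from the independence assumptions.

On the space `Ext` of pairs (record of controls, plant state), the noiseless cost-to-go under the
feedback law is a family of symmetric bilinear forms `Val k τ`, and `W k τ` is the same cost with
the control of time `N-k` still free. The algebraic core is that `A₁₁` and `A₁₂` are the blocks of
`W` in that control (`Blocks.W_lift`). A block depends only on the ages of the controls involved and
on whether a control is held (`RL`) or under way (`C`). It is a free part, the expected coupling
through the arrival probabilities `arrive` and `stay` with the weights `S` already computed, minus
the corrections `K_θ`, `K_uu`, `K_r` and `K_ηᵀ A₁₁⁻¹ K_η` caused by later feedback. `Blocks` records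
this, and `Blocks.step` carries it through one average and one completion of the square. The closed
formulas for `M`, `T_c + 2K_e` and `K_ζ` are matched with the free parts by telescoping products.

`A₁₁` is positive definite when `P(k) > 0`: if `d₀` is the least delay of positive probability, no
newer signal can overtake within `d₀` steps, so the control is applied with probability at least
`p(d₀)` and pays its `R`-cost. When `P(k) = 0` the control is a null vector of a positive
semidefinite form, so it drops out of all couplings. In both cases `W = Val + gapᵀ A₁₁ gap`
(`IsWeight.W_eq`).

Finally, centered independent noise contributes only constants. Working backwards through the
horizon, `J` equals `minCost`, which is finite and independent of the control, plus the expected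
costs of the deviations from the feedback law (`IsNoise.J_eq`). The identity holds in `[0, ∞]`, so
the controls need no integrability. Optimality means that every deviation cost vanishes. -/

noncomputable section

namespace HoldLQ

variable {n m : ℕ} (c : HoldLQ n m)

/-! ### Averages over the newest signal, and the matrix form of `A₁₂`. -/

lemma P_natCast (i : ℕ) : c.P i = c.P ((i : ℤ) - 1) + c.p i := by
  unfold P
  rw [show ((i : ℤ) + 1).toNat = i + 1 by omega, show ((i : ℤ) - 1 + 1).toNat = i by omega,
    Finset.sum_range_succ]

lemma Pbar_natCast (i : ℕ) : c.Pbar ((i : ℤ) - 1) = c.Pbar i + c.p i := by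
  unfold Pbar
  rw [c.P_natCast i]; ring

lemma Pbar_neg_one : c.Pbar (-1) = 1 := by simp [Pbar, P]

/-- The average `∑_{j=τ+1}^{t-b} p(t-j) f(j) + P̄(t-1-τ) f(τ)`. -/
def avg {M : Type*} [AddCommGroup M] [Module ℝ M] (t τ : ℤ) (b : ℕ) (f : ℤ → M) : M :=
  ∑ j ∈ Finset.Icc (τ + 1) (t - b), c.p (t - j).toNat • f j + c.Pbar (t - 1 - τ) • f τ

lemma mean_eq_avg (k : ℕ) (τ : ℤ) (b : ℕ) (f : ℤ → Fin m → ℝ) :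
    c.mean k τ b f = c.avg (c.N - k) τ b f := rfl

section avg

variable {M : Type*} [AddCommGroup M] [Module ℝ M]

/-- When the held signal is one step older, the weight `P̄(t-1-τ)` of `τ` splits into `p(t-τ)`, the
new summand at `τ`, and `P̄(t-τ)`, which moves to `τ-1`. -/
lemma avg_pred {t τ : ℤ} {b : ℕ} (f : ℤ → M) (h : τ ≤ t - b) :
    c.avg t (τ - 1) b f = c.avg t τ b f + c.Pbar (t - τ) • (f (τ - 1) - f τ) := by
  unfold avg
  have h1 : Finset.Icc (τ - 1 + 1) (t - b) = insert τ (Finset.Icc (τ + 1) (t - b)) := by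
    ext j; simp only [Finset.mem_Icc, Finset.mem_insert]; omega
  obtain ⟨i, hi⟩ : ∃ i : ℕ, t - τ = i := ⟨(t - τ).toNat, by omega⟩
  have h2 := c.Pbar_natCast i
  rw [h1, Finset.sum_insert (by simp), show t - 1 - (τ - 1) = (i : ℤ) by omega,
    show t - 1 - τ = (i : ℤ) - 1 by omega, hi, h2, Int.toNat_natCast]
  module

/-- Summation by parts. The term `y i` is present when the newest signal is older than `t-i`, which
has weight `P̄(i)`. The term `z i` is present only when the newest signal is the one of age `i`,
with weight `p(i)`, or `P̄(D-1)` for the held signal. -/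
lemma avg_window {t : ℤ} {b : ℕ} (f : ℤ → M) (y z : ℕ → M) (D : ℕ)
    (hf : ∀ s : ℕ, s ≤ D → f (t - s) = ∑ i ∈ Finset.Ico b s, y i + z s) :
    c.avg t (t - D) b f =
      ∑ i ∈ Finset.Ico b D, (c.Pbar i • y i + c.p i • z i) + c.Pbar ((D : ℤ) - 1) • z D := by
  induction D with
  | zero =>
    have := hf 0 le_rfl
    simp only [avg, Finset.Ico_eq_empty_of_le (Nat.zero_le b), Finset.sum_empty, zero_add] at this ⊢
    rw [this, Finset.Icc_eq_empty (by push_cast; omega)]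
    simp
  | succ D ih =>
    by_cases hb : b ≤ D
    · have h1 := ih fun s hs => hf s (by omega)
      have h2 := c.avg_pred (t := t) (τ := t - D) (b := b) f (by omega)
      rw [show t - ((D + 1 : ℕ) : ℤ) = t - D - 1 by push_cast; omega, h2, h1,
        Finset.sum_Ico_succ_top hb, show t - (D : ℤ) - 1 = t - ((D + 1 : ℕ) : ℤ) by push_cast; omega,
        hf (D + 1) le_rfl, hf D (by omega), Finset.sum_Ico_succ_top hb,
        show t - (t - (D : ℤ)) = D by omega, c.Pbar_natCast D,
        show ((D + 1 : ℕ) : ℤ) - 1 = D by push_cast; omega]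
      module
    · have h1 := hf (D + 1) le_rfl
      rw [Finset.Ico_eq_empty (by omega), Finset.sum_empty, zero_add] at h1 ⊢
      unfold avg
      rw [h1, Finset.Icc_eq_empty (by push_cast; omega), Finset.sum_empty, zero_add]
      congr 2; omega

/-- The average of a function that is constant below `t - L` and vanishes above. -/
lemma avg_of_lt {t : ℤ} (f : ℤ → M) (x y : M) {D L : ℕ} (hL : L < D)
    (hx : ∀ s : ℕ, L < s → s ≤ D → f (t - s) = x) (hy : f (t - L) = y)
    (hz : ∀ s : ℕ, s < L → f (t - s) = 0) :
    c.avg t (t - D) 0 f = c.Pbar L • x + c.p L • y := by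
  rw [c.avg_window f (fun i => if i = L then x else 0) (fun i => if i = L then y else 0) D]
  · rw [if_neg (by omega), smul_zero, add_zero, Finset.sum_eq_single L]
    · simp
    · intro i _ hi; simp [hi]
    · simp [hL]
  · intro s hs
    rw [Finset.sum_ite_eq']
    rcases lt_trichotomy s L with h | h | h
    · simp [hz s h, h.ne, h.le]
    · subst h; simp [hy]
    · simp [hx s h hs, h.ne', h]

lemma avg_of_eq {t : ℤ} (f : ℤ → M) (D : ℕ) (hz : ∀ s : ℕ, s < D → f (t - s) = 0) :
    c.avg t (t - D) 0 f = c.Pbar ((D : ℤ) - 1) • f (t - D) := by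
  rw [c.avg_window f (fun _ => 0) (fun i => if i = D then f (t - D) else 0) D]
  · rw [Finset.sum_eq_zero, zero_add, if_pos rfl]
    intro i hi
    simp [(Finset.mem_Ico.1 hi).2.ne]
  · intro s hs
    rcases hs.lt_or_eq with h | h
    · simp [hz s h, h.ne]
    · subst h; simp

lemma avg_const {t : ℤ} (x : M) (D : ℕ) : c.avg t (t - D) 0 (fun _ => x) = x := by
  induction D with
  | zero => simp [avg, Pbar_neg_one]
  | succ D ih =>
    have h2 := c.avg_pred (t := t) (τ := t - D) (b := 0) (fun _ => x) (by simp)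
    rw [show t - ((D + 1 : ℕ) : ℤ) = t - D - 1 by push_cast; omega, h2, ih]
    simp

end avg

/-- A weighted sum of the controls `v_τ, …, v_{T-b}` whose weights depend on the age only, up to
the distinction of the oldest control. -/
def window (XC XR : ℕ → Matrix (Fin m) (Fin m) ℝ) (T : ℤ) (v : ℤ → Fin m → ℝ) (τ : ℤ) (b : ℕ) :
    Fin m → ℝ :=
  ∑ s ∈ Finset.Ico b (T - τ).toNat, XC s *ᵥ v (T - s) + XR (T - τ).toNat *ᵥ v τ

/-- Age `s` at time `N-k` is age `s+1` one step later. This is the origin of the pairs `P̄(b)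
X_C(b+1) + p(b) X_RL(b+1)` and of the factor `P̄(b-1)` in all the sub-functions. -/
lemma mean_window (k : ℕ) (v : ℤ → Fin m → ℝ) (τ : ℤ) (b : ℕ) (f : ℤ → Fin m → ℝ)
    (XC XR : ℕ → Matrix (Fin m) (Fin m) ℝ) (hτ : τ ≤ c.N - k)
    (hf : ∀ j : ℤ, j ≤ c.N - k → f j = window XC XR (c.N - k + 1) v j (b + 1)) :
    c.mean k τ b f = window (fun s => c.Pbar s • XC (s + 1) + c.p s • XR (s + 1))
      (fun s => c.Pbar ((s : ℤ) - 1) • XR (s + 1)) (c.N - k) v τ b := by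
  obtain ⟨D, hD⟩ : ∃ D : ℕ, τ = c.N - k - D := ⟨(c.N - k - τ).toNat, by omega⟩
  subst hD
  rw [mean_eq_avg, c.avg_window f (fun s => XC (s + 1) *ᵥ v (c.N - k - s))
    (fun s => XR (s + 1) *ᵥ v (c.N - k - s)) D]
  · unfold window
    rw [show ((c.N : ℤ) - k - (c.N - k - D)).toNat = D by omega]
    simp only [add_mulVec, smul_mulVec]
  · intro s _
    rw [hf _ (by omega)]
    unfold window
    rw [show ((c.N : ℤ) - k + 1 - (c.N - k - s)).toNat = s + 1 by omega,
      ← Finset.sum_Ico_add' (fun i : ℕ => XC i *ᵥ v (c.N - k + 1 - i)) b s 1]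
    congr 1
    refine Finset.sum_congr rfl fun i _ => ?_
    congr 2; push_cast; omega

lemma mean_window_last (k : ℕ) (v : ℤ → Fin m → ℝ) (τ : ℤ) (b : ℕ) (X : Matrix (Fin m) (Fin m) ℝ)
    (hτ : τ ≤ c.N - k) :
    (c.mean k τ b fun j => X *ᵥ v j) = window (fun s => c.p s • X)
      (fun s => c.Pbar ((s : ℤ) - 1) • X) (c.N - k) v τ b := by
  rw [c.mean_window k v τ b _ (fun _ => 0) (fun _ => X) hτ]
  · simp
  · intro j _; simp [window]

lemma window_add (XC XR YC YR : ℕ → Matrix (Fin m) (Fin m) ℝ) (T : ℤ) (v : ℤ → Fin m → ℝ) (τ : ℤ)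
    (b : ℕ) : window XC XR T v τ b + window YC YR T v τ b =
      window (fun s => XC s + YC s) (fun s => XR s + YR s) T v τ b := by
  simp only [window, add_mulVec, Finset.sum_add_distrib]; abel

lemma window_sub (XC XR YC YR : ℕ → Matrix (Fin m) (Fin m) ℝ) (T : ℤ) (v : ℤ → Fin m → ℝ) (τ : ℤ)
    (b : ℕ) : window XC XR T v τ b - window YC YR T v τ b =
      window (fun s => XC s - YC s) (fun s => XR s - YR s) T v τ b := by
  simp only [window, sub_mulVec, Finset.sum_sub_distrib]; abel

lemma mulVec_window (X : Matrix (Fin m) (Fin m) ℝ) (XC XR : ℕ → Matrix (Fin m) (Fin m) ℝ) (T : ℤ)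
    (v : ℤ → Fin m → ℝ) (τ : ℤ) (b : ℕ) : X *ᵥ window XC XR T v τ b =
      window (fun s => X * XC s) (fun s => X * XR s) T v τ b := by
  simp only [window, mulVec_add, mulVec_sum, mulVec_mulVec]

lemma Kzeta_window (k : ℕ) (g : GainData n m) (v : ℤ → Fin m → ℝ) (τ : ℤ) (b : ℕ)
    (hτ : τ ≤ c.N - k - 1) :
    c.Kzeta k g v τ b = window (c.KzetaC k g) (c.KzetaRL k g) (c.N - k) v τ b := by
  obtain ⟨D, hD⟩ : ∃ D : ℕ, τ = c.N - k - 1 - D := ⟨(c.N - k - 1 - τ).toNat, by omega⟩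
  subst hD
  have h1 : ∀ f : ℤ → Fin m → ℝ, ∑ t ∈ Finset.Icc (b : ℤ) D, f t = ∑ t ∈ Finset.Ico b (D + 1), f t := by
    intro f
    refine (Finset.sum_nbij (fun x : ℕ => (x : ℤ)) ?_ ?_ ?_ ?_).symm
    · intro a ha; simp at ha ⊢; omega
    · intro a _ b _ h; simpa using h
    · intro a ha; simp at ha ⊢
      exact ⟨a.toNat, by omega, by omega⟩
    · intros; rfl
  unfold Kzeta window KzetaC KzetaRL
  rw [show ((c.N : ℤ) - k - (c.N - k - 1 - D)).toNat = D + 1 by omega,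
    show (c.N : ℤ) - k - 1 - (c.N - k - 1 - D) = D by omega]
  simp only [h1, mulVec_add, mulVec_sum, sum_mulVec, mulVec_smul, smul_mulVec, Finset.sum_add_distrib]
  congr 1
  · rw [Finset.sum_comm (s := Finset.Ico b (D + 1))]
    refine Finset.sum_congr rfl fun i _ => ?_
    rw [Finset.sum_comm]
  · simp

/-- The gains in the record of controls are matrices: they are window sums of the sub-functions. -/
structure IsWindow (k : ℕ) (g : GainData n m) : Prop where
  eta : ∀ (v : ℤ → Fin m → ℝ) (τ : ℤ) (b : ℕ), 1 ≤ b → τ ≤ c.N - k → g.eta v τ b = window g.etaC g.etaRL (c.N - k + 1) v τ b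
  uuCd : ∀ (v : ℤ → Fin m → ℝ) (τ : ℤ) (b h : ℕ), 1 ≤ b → τ ≤ c.N - k → g.uuCd v τ b h =
    window (g.uuCdC · h) (g.uuCdRL · h) (c.N - k + 1) v τ b
  rCd : ∀ (v : ℤ → Fin m → ℝ) (τ : ℤ) (b h : ℕ), 1 ≤ b → τ ≤ c.N - k → g.rCd v τ b h =
    window (g.rCdC · h) (g.rCdRL · h) (c.N - k + 1) v τ b

variable {c}

/-- Windows are closed under averages, sums and matrix multiplication, so only the weights have to
be compared. -/
lemma IsWindow.Keta {k : ℕ} {g : GainData n m} (hg : c.IsWindow k g)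
    (v : ℤ → Fin m → ℝ) (τ : ℤ) (b : ℕ) (hτ : τ ≤ c.N - k - 1) :
    c.Keta k g v τ b = window (c.KetaC k g) (c.KetaRL k g) (c.N - k) v τ b := by
  have hτ' : τ ≤ c.N - k := by omega
  unfold HoldLQ.Keta Kgu Kbeta
  rw [c.Kzeta_window k g v τ b hτ, c.mean_window_last k v τ b _ hτ',
    c.mean_window k v τ b _ _ _ hτ' (fun j hj => hg.uuCd v j (b + 1) (1 + 1) (by omega) hj),
    c.mean_window k v τ b _ _ _ hτ' (fun j hj => hg.rCd v j (b + 1) 1 (by omega) hj),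
    c.mean_window k v τ b _ _ _ hτ' (fun j hj => hg.eta v j (b + 1) (by omega) hj),
    mulVec_window, window_add, window_add, window_add, window_sub]
  congr 1
  · funext s
    simp only [KetaC, KguC, KbetaC, Matrix.mul_add, Matrix.mul_smul]
    abel
  · funext s
    simp only [KetaRL, KguRL, KbetaRL, Matrix.mul_smul]

lemma IsWindow.step {k : ℕ} {g : GainData n m} (hg : c.IsWindow k g) :
    c.IsWindow (k + 1) (c.step k g) := by
  have e : (c.N : ℤ) - ((k + 1 : ℕ) : ℤ) + 1 = c.N - k := by push_cast; omega
  constructor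
  · intro v τ b _ hτ
    rw [e]
    exact hg.Keta v τ b (by push_cast at hτ; omega)
  · intro v τ b h _ hτ
    have hτ' : τ ≤ c.N - k := by push_cast at hτ; omega
    rw [e]
    simp only [HoldLQ.step, KuuCd]
    rw [c.mean_window_last k v τ b _ hτ',
      c.mean_window k v τ b _ _ _ hτ' (fun j hj => hg.uuCd v j (b + 1) (h + 1) (by omega) hj),
      window_add]
    congr 1
    funext s
    simp only [KuuCdC]
    abel
  · intro v τ b h _ hτ
    have hτ' : τ ≤ c.N - k := by push_cast at hτ; omega
    rw [e]
    simp only [HoldLQ.step, KrCd, KalphaCd]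
    rw [c.mean_window k v τ b _ _ _ hτ' (fun j hj => hg.rCd v j (b + 1) (h + 1) (by omega) hj),
      c.mean_window k v τ b _ (fun s => (g.etaC (h + 1))ᵀ * g.A11⁻¹ * g.etaC s)
        (fun s => (g.etaC (h + 1))ᵀ * g.A11⁻¹ * g.etaRL s) hτ' (fun j hj => by
          rw [hg.eta v j (b + 1) (by omega) hj, mulVec_window]),
      window_add]
    congr 1
    funext s
    simp only [KrCdC, KalphaCdC]
    abel

variable (c)

lemma isWindow_prev (k : ℕ) : c.IsWindow k (c.prev k) := by
  induction k with
  | zero => constructor <;> intros <;> simp [prev, start, window]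
  | succ k ih => exact ih.step

/-- Up to a term in `x`, `A₁₂ζ` is `K_η(k,τ,1)`, which is a window. It remains to replace ages by
sending times. -/
theorem A12zeta_eq (k : ℕ) (τ : ℤ) (hτ : τ ≤ c.N - k - 1) (v : ℤ → Fin m → ℝ) (x : Fin n → ℝ) :
    c.A12zeta k v τ x =
      ∑ t ∈ Finset.Icc τ (c.N - k - 1), c.A12v k τ t *ᵥ v t + c.A12x k *ᵥ x := by
  have h1 := (c.isWindow_prev k).Keta v τ 1 hτ
  have h2 : c.A12zeta k v τ x = c.Keta k (c.prev k) v τ 1 + c.A12x k *ᵥ x := by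
    simp only [A12zeta, Keta, A12x, sub_mulVec]; abel
  rw [h2, h1]
  congr 1
  obtain ⟨D, hD⟩ : ∃ D : ℕ, τ = c.N - k - 1 - D := ⟨(c.N - k - 1 - τ).toNat, by omega⟩
  subst hD
  have h3 : Finset.Icc ((c.N : ℤ) - k - 1 - D) (c.N - k - 1) =
      insert ((c.N : ℤ) - k - 1 - D) (Finset.Icc ((c.N : ℤ) - k - D) (c.N - k - 1)) := by
    ext j; simp only [Finset.mem_Icc, Finset.mem_insert]; omega
  rw [h3, Finset.sum_insert (by simp), add_comm, window]
  congr 1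
  swap
  · simp [A12v]
  · refine Finset.sum_nbij (fun s : ℕ => (c.N : ℤ) - k - s) ?_ ?_ ?_ ?_
    · intro a ha; simp at ha ⊢; omega
    · intro a _ b _ h; simpa using h
    · intro a ha; simp at ha ⊢
      exact ⟨(c.N - k - a).toNat, by omega, by omega⟩
    · intro a ha
      simp only [Finset.mem_Ico] at ha
      rw [A12v, if_neg (by omega)]
      congr 2; omega

end HoldLQ

end

/-! ### Arrival probabilities and closed forms of the free parts. -/

noncomputable section

namespace HoldLQ

variable {n m : ℕ} (c : HoldLQ n m)

/-- The numbers `p d` are the probabilities of delays. -/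
structure IsProb : Prop where
  nonneg : ∀ d, 0 ≤ c.p d
  P_le_one : ∀ i, c.P i ≤ 1

variable {c} in
lemma IsProb.P_mono (hc : c.IsProb) : Monotone c.P := by
  intro i j hij
  unfold P
  refine Finset.sum_le_sum_of_subset_of_nonneg ?_ fun d _ _ => hc.nonneg d
  intro x hx
  simp only [Finset.mem_range] at hx ⊢
  omega

variable {c} in
lemma IsProb.Pbar_nonneg (hc : c.IsProb) (i : ℤ) : 0 ≤ c.Pbar i := sub_nonneg.2 (hc.P_le_one i)

variable {c} in
lemma IsProb.P_nonneg (hc : c.IsProb) (i : ℤ) : 0 ≤ c.P i :=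
  Finset.sum_nonneg fun d _ => hc.nonneg d

variable {c} in
lemma IsProb.Pbar_eq_zero (hc : c.IsProb) {i j : ℤ} (hij : i ≤ j) (hi : c.Pbar i = 0) :
    c.Pbar j = 0 := by
  have h1 := hc.P_mono hij
  have h2 := hc.P_le_one j
  unfold Pbar at hi ⊢
  linarith

/-- The probability that the signal of age `b`, which has not arrived before now, is the newest one
`r` time units from now. -/
def arrive (b r : ℕ) : ℝ :=
  (c.P (r + b) - c.P (b - 1)) * ∏ s ∈ Finset.Ico b (r + b), c.Pbar s

/-- The probability that the signal of age `b`, which has been the newest one until now, still is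
the newest one `r` time units from now. -/
def stay (b r : ℕ) : ℝ := c.Pbar (b - 1) * ∏ s ∈ Finset.Ico b (r + b), c.Pbar s

lemma arrive_zero (b : ℕ) : c.arrive b 0 = c.p b := by
  have := c.P_natCast b
  simp [arrive, this]

lemma stay_zero (b : ℕ) : c.stay b 0 = c.Pbar (b - 1) := by simp [stay]

/-- First-step analysis: now either the newest signal is older than the one of age `b`, with weight
`P̄(b)`, and that one is still under way; or it is this very signal, with weight `p(b)`, which must
then stay the newest. -/
lemma arrive_succ (b r : ℕ) :
    c.arrive b (r + 1) = c.Pbar b * c.arrive (b + 1) r + c.p b * c.stay (b + 1) r := by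
  have h := c.P_natCast b
  unfold arrive stay
  rw [Finset.prod_eq_prod_Ico_succ_bot (by omega), show r + 1 + b = r + (b + 1) by omega]
  push_cast
  rw [show (b : ℤ) + 1 - 1 = b by omega, show (r : ℤ) + 1 + b = r + (b + 1) by omega, h]
  ring

lemma stay_succ (b r : ℕ) : c.stay b (r + 1) = c.Pbar (b - 1) * c.stay (b + 1) r := by
  unfold stay
  rw [Finset.prod_eq_prod_Ico_succ_bot (by omega), show r + 1 + b = r + (b + 1) by omega]
  push_cast
  rw [show (b : ℤ) + 1 - 1 = b by omega]

section flow

variable {M : Type*} [AddCommGroup M] [Module ℝ M]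

/-- The expected sum of `F`, over the remaining `k` steps, while a signal of age `b` that has not
arrived yet is the newest one. -/
def flowC (F : ℕ → ℕ → M) (k b : ℕ) : M := ∑ q ∈ Finset.range k, c.arrive b q • F q (k - 1 - q)

/-- The expected sum of `F`, over the remaining `k` steps, while the signal of age `b` that has been
the newest one still is. -/
def flowR (F : ℕ → ℕ → M) (k b : ℕ) : M := ∑ q ∈ Finset.range k, c.stay b q • F q (k - 1 - q)

lemma flowC_zero (F : ℕ → ℕ → M) (b : ℕ) : c.flowC F 0 b = 0 := rfl

lemma flowR_zero (F : ℕ → ℕ → M) (b : ℕ) : c.flowR F 0 b = 0 := rfl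

/-- First-step analysis for the accumulated sum. The first argument of `F` is the elapsed time,
hence the shift to `F (q + 1)`; the second is the number of steps that remain. -/
lemma flowC_succ (F : ℕ → ℕ → M) (k b : ℕ) :
    c.flowC F (k + 1) b = c.Pbar b • c.flowC (fun q => F (q + 1)) k (b + 1) +
      c.p b • (F 0 k + c.flowR (fun q => F (q + 1)) k (b + 1)) := by
  unfold flowC flowR
  rw [Finset.sum_range_succ', arrive_zero, smul_add, Finset.smul_sum, Finset.smul_sum]
  simp only [arrive_succ, add_smul, mul_smul, Finset.sum_add_distrib]
  have : ∀ q, k - 1 - q = k - (q + 1) := fun q => by omega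
  simp only [Nat.add_sub_cancel, Nat.sub_zero, this]
  abel

lemma flowR_succ (F : ℕ → ℕ → M) (k b : ℕ) :
    c.flowR F (k + 1) b =
      c.Pbar (b - 1) • (F 0 k + c.flowR (fun q => F (q + 1)) k (b + 1)) := by
  unfold flowR
  rw [Finset.sum_range_succ', stay_zero, smul_add, Finset.smul_sum]
  simp only [stay_succ, mul_smul]
  have : ∀ q, k - 1 - q = k - (q + 1) := fun q => by omega
  simp only [Nat.add_sub_cancel, Nat.sub_zero, this]
  abel

end flow

/-- The matrix `S_{N-k+1}` -/
def Sg (k : ℕ) : Matrix (Fin n) (Fin n) ℝ := (c.prev k).S (c.N - k + 1)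

/-- Step `k` writes only the entry of time `N-k`, so the weights of later times are never
overwritten. -/
lemma prev_S {j k : ℕ} (h : j ≤ k) {i : ℤ} (hi : i = c.N - j + 1) : (c.prev k).S i = c.Sg j := by
  subst hi
  induction k with
  | zero => obtain rfl : j = 0 := by omega
            rfl
  | succ k ih =>
    rcases h.eq_or_lt with rfl | h
    · rfl
    · rw [← ih (by omega)]
      simp only [prev, step]
      rw [Function.update_of_ne (by omega)]

lemma Sg_succ (k : ℕ) : c.Sg (k + 1) = c.Sstep k (c.prev k) := by
  simp only [Sg, prev, step]
  rw [show (c.N : ℤ) - ((k + 1 : ℕ) : ℤ) + 1 = c.N - k by push_cast; omega, Function.update_self]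

/-- The coupling between the present state and an input applied `q` steps from now: by the time
weighted with `Sg k`, the state has been carried along by `A ^ (q + 1)`. -/
def freeX (q k : ℕ) : Matrix (Fin m) (Fin n) ℝ := c.Bᵀ * c.Sg k * c.A ^ (q + 1)

/-! The blocks of the cost-to-go, without the corrections from future controls. -/

def MC : ℕ → ℕ → Matrix (Fin m) (Fin n) ℝ := c.flowC c.freeX

def MR : ℕ → ℕ → Matrix (Fin m) (Fin n) ℝ := c.flowR c.freeX

/-- An older control applied `q` steps from now changes the state by `B` times its value. The newer
signal, of age `h` now, then has age `h + q + 1`, is still under way, and couples to that change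
through `MC`. -/
def freeV (h q k : ℕ) : Matrix (Fin m) (Fin m) ℝ := c.MC k (h + q + 1) * c.B

def VC (k b h : ℕ) : Matrix (Fin m) (Fin m) ℝ := c.flowC (c.freeV h) k b

def VR (k b h : ℕ) : Matrix (Fin m) (Fin m) ℝ := c.flowR (c.freeV h) k b

/-- The factor `2` counts the cross terms between one use of a held signal and its later uses. -/
def freeD (b q k : ℕ) : Matrix (Fin m) (Fin m) ℝ :=
  c.R + c.Bᵀ * c.Sg k * c.B + (2 : ℝ) • (c.MR k (b + q + 1) * c.B)

def DC (k b : ℕ) : Matrix (Fin m) (Fin m) ℝ := c.flowC (c.freeD b) k b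

def DR (k b : ℕ) : Matrix (Fin m) (Fin m) ℝ := c.flowR (c.freeD b) k b

lemma freeX_succ : (fun q => c.freeX (q + 1)) = fun q k => c.freeX q k * c.A := by
  funext q k
  rw [freeX, freeX, pow_succ _ (q + 1)]
  simp only [Matrix.mul_assoc]

lemma flowC_mul_right {l : Type*} [Fintype l] {r s : Type*} [Fintype r] [Fintype s]
    (F : ℕ → ℕ → Matrix r s ℝ) (X : Matrix s l ℝ) (k b : ℕ) :
    c.flowC (fun q k => F q k * X) k b = c.flowC F k b * X := by
  simp only [flowC, Matrix.sum_mul, Matrix.smul_mul]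

lemma flowR_mul_right {l : Type*} [Fintype l] {r s : Type*} [Fintype r] [Fintype s]
    (F : ℕ → ℕ → Matrix r s ℝ) (X : Matrix s l ℝ) (k b : ℕ) :
    c.flowR (fun q k => F q k * X) k b = c.flowR F k b * X := by
  simp only [flowR, Matrix.sum_mul, Matrix.smul_mul]

lemma MC_succ (k b : ℕ) : c.MC (k + 1) b = c.Pbar b • (c.MC k (b + 1) * c.A) +
    c.p b • (c.Bᵀ * c.Sg k * c.A + c.MR k (b + 1) * c.A) := by
  unfold MC MR
  rw [flowC_succ, freeX_succ, flowC_mul_right, flowR_mul_right]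
  simp [freeX]

lemma MR_succ (k b : ℕ) : c.MR (k + 1) b =
    c.Pbar (b - 1) • (c.Bᵀ * c.Sg k * c.A + c.MR k (b + 1) * c.A) := by
  unfold MR
  rw [flowR_succ, freeX_succ, flowR_mul_right]
  simp [freeX]

lemma freeV_succ (h : ℕ) : (fun q => c.freeV h (q + 1)) = c.freeV (h + 1) := by
  funext q k
  simp only [freeV]
  congr 2; omega

lemma VC_succ (k b h : ℕ) : c.VC (k + 1) b h = c.Pbar b • c.VC k (b + 1) (h + 1) +
    c.p b • (c.MC k (h + 1) * c.B + c.VR k (b + 1) (h + 1)) := by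
  unfold VC VR
  rw [flowC_succ, freeV_succ]; rfl

lemma VR_succ (k b h : ℕ) : c.VR (k + 1) b h =
    c.Pbar (b - 1) • (c.MC k (h + 1) * c.B + c.VR k (b + 1) (h + 1)) := by
  unfold VR
  rw [flowR_succ, freeV_succ]; rfl

lemma freeD_succ (b : ℕ) : (fun q => c.freeD b (q + 1)) = c.freeD (b + 1) := by
  funext q k
  simp only [freeD]
  congr 4; omega

lemma DC_succ (k b : ℕ) : c.DC (k + 1) b = c.Pbar b • c.DC k (b + 1) +
    c.p b • (c.R + c.Bᵀ * c.Sg k * c.B + (2 : ℝ) • (c.MR k (b + 1) * c.B) + c.DR k (b + 1)) := by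
  unfold DC DR
  rw [flowC_succ, freeD_succ]; rfl

lemma DR_succ (k b : ℕ) : c.DR (k + 1) b = c.Pbar (b - 1) •
    (c.R + c.Bᵀ * c.Sg k * c.B + (2 : ℝ) • (c.MR k (b + 1) * c.B) + c.DR k (b + 1)) := by
  unfold DR
  rw [flowR_succ, freeD_succ]; rfl

/-! Comparison with the gains -/

lemma sum_Icc_int {M : Type*} [AddCommMonoid M] (f : ℤ → M) (a b : ℤ) (r : ℕ) (h : b = a + r - 1) :
    ∑ i ∈ Finset.Icc a b, f i = ∑ q ∈ Finset.range r, f (a + q) := by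
  refine (Finset.sum_nbij (fun q : ℕ => a + q) ?_ ?_ ?_ ?_).symm
  · intro i hi; simp at hi ⊢; omega
  · intro i _ j _ h; simpa using h
  · intro i hi; simp at hi ⊢
    exact ⟨(i - a).toNat, by omega, by omega⟩
  · intros; rfl

lemma prod_Icc_int {M : Type*} [CommMonoid M] (f : ℤ → M) (a b : ℤ) (r : ℕ) (h : b = a + r - 1) :
    ∏ i ∈ Finset.Icc a b, f i = ∏ q ∈ Finset.range r, f (a + q) := by
  refine (Finset.prod_nbij (fun q : ℕ => a + q) ?_ ?_ ?_ ?_).symm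
  · intro i hi; simp at hi ⊢; omega
  · intro i _ j _ h; simpa using h
  · intro i hi; simp at hi ⊢
    exact ⟨(i - a).toNat, by omega, by omega⟩
  · intros; rfl

lemma pd_natCast (r : ℕ) : c.pd r = c.arrive 0 r := by
  rw [pd, arrive, Int.toNat_natCast, Finset.range_eq_Ico]
  simp [P]

lemma M_prev (k : ℕ) : c.M k (c.prev k) = c.MC (k + 1) 0 := by
  unfold M MC flowC
  rw [sum_Icc_int _ _ _ (k + 1) (by push_cast; omega)]
  refine Finset.sum_congr rfl fun r hr => ?_
  have hr := Finset.mem_range.1 hr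
  rw [c.prev_S (j := k - r) (by omega) (by omega), freeX, add_sub_cancel_left, pd_natCast,
    show ((r : ℤ) + 1).toNat = r + 1 by omega, Nat.add_sub_cancel]

lemma Tc_prev (k b : ℕ) : c.Tc k (c.prev k) b = c.Pd (b + k - 1) • c.R +
    ∑ s ∈ Finset.range (k + 1), c.pd (b - 1 + s) • (c.Bᵀ * c.Sg (k - s) * c.B) := by
  induction k generalizing b with
  | zero =>
    unfold Tc
    rw [c.prev_S le_rfl rfl]
    simp only [prev, start]
    rw [show (((b + 1 : ℕ) : ℤ) - 2) = b + ((0 : ℕ) : ℤ) - 1 by push_cast; omega]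
    simp
  | succ k ih =>
    unfold Tc
    rw [c.prev_S le_rfl rfl, Finset.sum_range_succ']
    simp only [prev, step]
    rw [ih (b + 1)]
    have : ∀ s : ℕ, k + 1 - (s + 1) = k - s := fun s => by omega
    simp only [this]
    push_cast
    rw [show (b : ℤ) + 1 + k - 1 = b + (k + 1) - 1 by omega]
    simp only [show ∀ s : ℕ, (b : ℤ) + 1 - 1 + s = b - 1 + (s + 1) from fun s => by omega]
    rw [add_assoc]
    simp

lemma sum_range_triangle {M : Type*} [AddCommMonoid M] (f : ℕ → ℕ → M) (k : ℕ) :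
    ∑ q ∈ Finset.range (k + 1), ∑ r ∈ Finset.range (k - q), f q r =
      ∑ r ∈ Finset.range k, ∑ q ∈ Finset.range (r + 1), f q (r - q) := by
  have h : ∀ q, ∑ r ∈ Finset.range (k - q), f q r = ∑ r ∈ Finset.Ico q k, f q (r - q) := by
    intro q
    rw [Finset.sum_Ico_eq_sum_range]
    simp
  simp only [h]
  refine Finset.sum_comm' ?_
  intro x y
  simp only [Finset.mem_range, Finset.mem_Ico]
  omega

/-- No signal of age `0, …, r` has arrived, an intersection of independent events. Algebraically,
each `p_d(r+1)` removes the fraction `P(r+1)` of what is left. -/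
lemma Pdbar_natCast (r : ℕ) : c.Pdbar r = ∏ s ∈ Finset.range (r + 1), c.Pbar s := by
  unfold Pdbar Pd
  rw [show ((r : ℤ) + 1).toNat = r + 1 by omega]
  induction r with
  | zero => simp [pd, Pbar]
  | succ r ih =>
    rw [Finset.sum_range_succ, ← sub_sub, ih, Finset.prod_range_succ _ (r + 1)]
    simp only [pd, Int.toNat_natCast, Pbar]
    ring

/-- The signal sent now is the newest after `q` steps and again after `q + r + 1` steps: it has
arrived by age `q`, and none of the `q + r + 1` newer ones has arrived at the later time. This is
the weight in `K_e`. -/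
lemma arrive_zero_mul_stay (q r : ℕ) :
    c.arrive 0 q * c.stay (q + 1) r = c.P q * ∏ s ∈ Finset.range (q + r + 1), c.Pbar s := by
  rw [← pd_natCast, pd, stay, Int.toNat_natCast, Finset.range_eq_Ico, Finset.range_eq_Ico,
    ← Finset.prod_Ico_consecutive _ (Nat.zero_le q) (show q ≤ q + r + 1 by omega),
    Finset.prod_eq_prod_Ico_succ_bot (show q < q + r + 1 by omega)]
  push_cast
  rw [add_sub_cancel_right, show r + (q + 1) = q + r + 1 by omega]
  ring

/-- A sum over the region of summation of `K_e`, `K_ζ`. -/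
lemma sum_Icc_Icc {M : Type*} [AddCommMonoid M] (f : ℤ → ℤ → M) (k : ℕ) :
    ∑ i ∈ Finset.Icc ((c.N : ℤ) - k + 1) c.N, ∑ j ∈ Finset.Icc ((c.N : ℤ) - k + 1) i, f i j =
      ∑ r ∈ Finset.range k, ∑ q ∈ Finset.range (r + 1), f (c.N - k + 1 + r) (c.N - k + 1 + q) := by
  rw [sum_Icc_int _ _ _ k (by omega)]
  refine Finset.sum_congr rfl fun r _ => ?_
  rw [sum_Icc_int _ _ _ (r + 1) (by push_cast; omega)]

lemma Ke_prev (k : ℕ) : c.Ke k (c.prev k) =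
    ∑ q ∈ Finset.range (k + 1), c.arrive 0 q • (c.MR (k - q) (q + 1) * c.B) := by
  unfold Ke MR flowR
  simp only [Matrix.sum_mul, Finset.smul_sum]
  -- The two uses of one signal can be ordered by the first use and the gap, as in the nested flows,
  -- or by the second use and then the first, as in `K_e`.
  rw [sum_range_triangle (fun q r =>
    c.arrive 0 q • ((c.stay (q + 1) r • c.freeX r (k - q - 1 - r)) * c.B)),
    sum_Icc_Icc]
  refine Finset.sum_congr rfl fun r hr => Finset.sum_congr rfl fun q hq => ?_
  have hr := Finset.mem_range.1 hr
  have hq := Finset.mem_range.1 hq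
  rw [c.prev_S (j := k - 1 - r) (by omega) (by omega), add_sub_cancel_left, Pdbar_natCast,
    show (k : ℤ) + (c.N - k + 1 + q) - c.N - 1 = q by omega, freeX,
    show ((c.N : ℤ) - k + 1 + r - (c.N - k + 1 + q) + 1).toNat = r - q + 1 by omega,
    Matrix.smul_mul, smul_smul, arrive_zero_mul_stay, mul_comm, show q + (r - q) + 1 = r + 1 by omega,
    show k - q - 1 - (r - q) = k - 1 - r by omega]

/-- `T_c(k,1)` collects the cost `R + Bᵀ S B` of each single use of a fresh signal, and `2 K_e` the
cross terms between two uses. -/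
lemma Tc_add_Ke (k : ℕ) :
    c.Tc k (c.prev k) 1 + (2 : ℝ) • c.Ke k (c.prev k) = c.DC (k + 1) 0 := by
  rw [Ke_prev, Tc_prev]
  unfold DC flowC freeD Pd
  rw [show (((1 : ℕ) : ℤ) + k - 1 + 1).toNat = k + 1 by omega]
  simp only [smul_add, Finset.sum_add_distrib, Finset.sum_smul, Finset.smul_sum, Nat.cast_one,
    sub_self, zero_add, pd_natCast, Nat.add_sub_cancel]
  congr 1
  refine Finset.sum_congr rfl fun q _ => ?_
  rw [smul_comm]

variable {c} in
-- Each factor `P̄(q+h)/P̄(h-1)` slides the window of `q + 1` consecutive factors up by one place.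
lemma IsProb.zetaLast_mul (hc : c.IsProb) (k q s : ℕ) :
    c.zetaLast k (c.N - k + 1 + q) s * ∏ i ∈ Finset.range (q + 1), c.Pbar i =
      ∏ i ∈ Finset.Ico s (q + s + 1), c.Pbar i := by
  unfold zetaLast
  rw [prod_Icc_int _ _ _ s (by omega)]
  induction s with
  | zero => rw [← Finset.range_eq_Ico]; simp
  | succ s ih =>
    rw [Finset.prod_range_succ, mul_right_comm, ih,
      show (k : ℤ) + (c.N - k + 1 + q) - c.N + (1 + s) - 1 = ((q + s + 1 : ℕ) : ℤ) by push_cast; omega,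
      add_sub_cancel_left, show q + (s + 1) + 1 = q + s + 1 + 1 by omega,
      Finset.prod_Ico_succ_top (show s + 1 ≤ q + s + 1 by omega),
      Finset.prod_eq_prod_Ico_succ_bot (show s < q + s + 1 by omega)]
    -- With the convention `0/0 = 0` the identity survives: `P̄` is nonincreasing, so `P̄(q+s+1)`
    -- vanishes too and both sides are zero.
    by_cases h : c.Pbar s = 0
    · have h1 := hc.Pbar_eq_zero (j := ((q + s + 1 : ℕ) : ℤ)) (by push_cast; omega) h
      rw [h1]; simp
    · field_simp

variable {c} in
-- The weight in `zetaMat` clears the denominators of `zetaLast` and leaves two probabilities: the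
-- held signal of age `b` is still in use `q` steps from now, and the signal sent now, of age `q +
-- 1` one step later and still under way, is the newest `r - q` steps after that.
lemma IsProb.zetaLast_mul_zeta (hc : c.IsProb) (k q r b : ℕ) (hq : q ≤ r) (hb : 1 ≤ b) :
    c.zetaLast k (c.N - k + 1 + q) (b - 1) *
      (c.Pdbar r * (c.P ((r : ℤ) + 1) - c.P q)) = c.stay b q * c.arrive (q + 1) (r - q) := by
  obtain ⟨s, rfl⟩ : ∃ s, b = s + 1 := ⟨b - 1, by omega⟩
  have h := hc.zetaLast_mul k q s
  rw [Pdbar_natCast, Finset.range_eq_Ico,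
    ← Finset.prod_Ico_consecutive _ (Nat.zero_le (q + 1)) (show q + 1 ≤ r + 1 by omega),
    ← Finset.range_eq_Ico, stay, arrive, show r - q + (q + 1) = r + 1 by omega,
    show ((r - q : ℕ) : ℤ) + ((q + 1 : ℕ) : ℤ) = r + 1 by omega]
  push_cast
  rw [add_sub_cancel_right, add_sub_cancel_right, mul_assoc, ← mul_assoc, h,
    Finset.prod_eq_prod_Ico_succ_bot (by omega), show q + (s + 1) = q + s + 1 by omega]
  ring

variable {c} in
lemma IsProb.zetaWeight_mul_zeta (hc : c.IsProb) (k q r b : ℕ) (hq : q ≤ r) (hb : 1 ≤ b) :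
    c.zetaWeight k (c.N - k + 1 + q) b *
      (c.Pdbar r * (c.P ((r : ℤ) + 1) - c.P q)) = c.arrive b q * c.arrive (q + 1) (r - q) := by
  have h := hc.zetaLast_mul_zeta k q r b hq hb
  have h1 : c.zetaWeight k (c.N - k + 1 + q) b =
      (c.P (q + b) - c.P (b - 1)) / c.Pbar (b - 1) * c.zetaLast k (c.N - k + 1 + q) (b - 1) := by
    unfold zetaWeight zetaLast
    rw [prod_Icc_int _ _ _ (b - 1) (by omega), prod_Icc_int _ _ _ (b - 1) (by omega),
      show (k : ℤ) + (c.N - k + 1 + q) - c.N - 1 + b = q + b by omega]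
    congr 1
    refine Finset.prod_congr rfl fun i _ => ?_
    congr 2 <;> omega
  rw [h1, mul_assoc, h, stay, arrive.eq_1 c b q]
  -- If `P̄(b-1) = 0` then `P` already equals `1` at `b - 1`, so the numerator `P(q+b) - P(b-1)`
  -- vanishes and the reading of the quotient is harmless.
  by_cases h0 : c.Pbar (b - 1) = 0
  · have h2 : c.Pbar (q + b) = 0 := hc.Pbar_eq_zero (by omega) h0
    unfold Pbar at h0 h2
    rw [show c.P (q + b) - c.P (b - 1) = 0 by linarith]
    simp
  · field_simp

variable {c} in
lemma IsProb.KzetaC_prev (hc : c.IsProb) (k b : ℕ) (hb : 1 ≤ b) :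
    c.KzetaC k (c.prev k) b = c.VC (k + 1) b 0 := by
  unfold KzetaC VC
  rw [flowC]
  simp only [freeV, MC, flowC, Nat.add_sub_cancel, Matrix.sum_mul, Finset.smul_sum, zero_add]
  rw [sum_range_triangle (fun q r =>
    c.arrive b q • ((c.arrive (q + 1) r • c.freeX r (k - q - 1 - r)) * c.B)),
    sum_Icc_Icc]
  refine Finset.sum_congr rfl fun r hr => Finset.sum_congr rfl fun q hq => ?_
  have hr := Finset.mem_range.1 hr
  have hq := Finset.mem_range.1 hq
  rw [zetaMat, c.prev_S (j := k - 1 - r) (by omega) (by omega), add_sub_cancel_left,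
    show (k : ℤ) + (c.N - k + 1 + q) - c.N - 1 = q by omega,
    show (c.N : ℤ) - k + 1 + r - c.N + k = r + 1 by omega, freeX,
    show ((c.N : ℤ) - k + 1 + r - (c.N - k + 1 + q) + 1).toNat = r - q + 1 by omega,
    Matrix.smul_mul, smul_smul, smul_smul, hc.zetaWeight_mul_zeta k q r b (by omega) hb,
    show k - q - 1 - (r - q) = k - 1 - r by omega]

variable {c} in
lemma IsProb.KzetaRL_prev (hc : c.IsProb) (k b : ℕ) (hb : 1 ≤ b) :
    c.KzetaRL k (c.prev k) b = c.VR (k + 1) b 0 := by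
  unfold KzetaRL VR
  rw [flowR]
  simp only [freeV, MC, flowC, Nat.add_sub_cancel, Matrix.sum_mul, Finset.smul_sum, zero_add]
  rw [sum_range_triangle (fun q r =>
    c.stay b q • ((c.arrive (q + 1) r • c.freeX r (k - q - 1 - r)) * c.B)),
    sum_Icc_Icc]
  refine Finset.sum_congr rfl fun r hr => Finset.sum_congr rfl fun q hq => ?_
  have hr := Finset.mem_range.1 hr
  have hq := Finset.mem_range.1 hq
  rw [zetaMat, c.prev_S (j := k - 1 - r) (by omega) (by omega), add_sub_cancel_left,
    show (k : ℤ) + (c.N - k + 1 + q) - c.N - 1 = q by omega,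
    show (c.N : ℤ) - k + 1 + r - c.N + k = r + 1 by omega, freeX,
    show ((c.N : ℤ) - k + 1 + r - (c.N - k + 1 + q) + 1).toNat = r - q + 1 by omega,
    Matrix.smul_mul, smul_smul, smul_smul, hc.zetaLast_mul_zeta k q r b (by omega) hb,
    show k - q - 1 - (r - q) = k - 1 - r by omega]

end HoldLQ

end

/-! ### The cost-to-go as a bilinear form on records and states. -/

noncomputable section

namespace HoldLQ

variable {n m : ℕ} (c : HoldLQ n m)

/-- A record of controls, together with a state of the plant. -/
abbrev Ext (n m : ℕ) := (ℤ → Fin m → ℝ) × (Fin n → ℝ)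

/-- The record with the only control `a`, at time `l`. -/
def lift (l : ℤ) : (Fin m → ℝ) →ₗ[ℝ] Ext n m :=
  LinearMap.inl ℝ _ _ ∘ₗ LinearMap.single ℝ (fun _ : ℤ => Fin m → ℝ) l

def pt : (Fin n → ℝ) →ₗ[ℝ] Ext n m := LinearMap.inr ℝ _ _

def ctrl (j : ℤ) : Ext n m →ₗ[ℝ] (Fin m → ℝ) := LinearMap.proj j ∘ₗ LinearMap.fst ℝ _ _

/-- The transition of the noiseless plant, when the control of time `j` is the input. -/
def nextState (j : ℤ) : Ext n m →ₗ[ℝ] Ext n m :=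
  (LinearMap.fst ℝ _ _).prod (c.A.mulVecLin ∘ₗ LinearMap.snd ℝ _ _ + c.B.mulVecLin ∘ₗ ctrl j)

/-- The matrix `A₁₂(N-k, τ)` as a linear map. -/
def A12 (k : ℕ) (τ : ℤ) : Ext n m →ₗ[ℝ] (Fin m → ℝ) :=
  ∑ l ∈ Finset.Icc τ (c.N - k - 1), (c.A12v k τ l).mulVecLin ∘ₗ ctrl l +
    (c.A12x k).mulVecLin ∘ₗ LinearMap.snd ℝ _ _

/-- The deviation of the control of time `N-k` from the feedback law. -/
def gap (k : ℕ) (τ : ℤ) : Ext n m →ₗ[ℝ] (Fin m → ℝ) :=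
  ctrl (c.N - k) + (c.A11 k)⁻¹.mulVecLin ∘ₗ c.A12 k τ

/-- The control of time `N-k` is replaced by the feedback law. -/
def closed (k : ℕ) (τ : ℤ) : Ext n m →ₗ[ℝ] Ext n m :=
  LinearMap.id - lift (c.N - k) ∘ₗ c.gap k τ

/-- The expected cost from time `N-k` on, if `V` is the cost-to-go at time `N-k+1`. -/
def bellman (V : ℤ → LinearMap.BilinForm ℝ (Ext n m)) (k : ℕ) (τ : ℤ) :
    LinearMap.BilinForm ℝ (Ext n m) :=
  (Matrix.toBilin' c.Q).compl₁₂ (LinearMap.snd ℝ _ _) (LinearMap.snd ℝ _ _) +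
    c.avg (c.N - k) τ 0 fun j => (Matrix.toBilin' c.R).compl₁₂ (ctrl j) (ctrl j) +
      (V j).compl₁₂ (c.nextState j) (c.nextState j)

/-- The expected cost of the noiseless plant from time `N-k+1` on under the feedback law, as a
symmetric bilinear form. -/
def Val : ℕ → ℤ → LinearMap.BilinForm ℝ (Ext n m)
  | 0 => fun _ => (Matrix.toBilin' c.Sfin).compl₁₂ (LinearMap.snd ℝ _ _) (LinearMap.snd ℝ _ _)
  | k + 1 => fun τ => (c.bellman (Val k) k τ).compl₁₂ (c.closed k τ) (c.closed k τ)

/-- The expected cost from time `N-k` on when the control of time `N-k` is arbitrary and the later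
ones obey the feedback law. -/
def W (k : ℕ) (τ : ℤ) : LinearMap.BilinForm ℝ (Ext n m) := c.bellman (c.Val k) k τ

lemma lift_fst (l j : ℤ) (a : Fin m → ℝ) :
    (lift l a : Ext n m).1 j = if j = l then a else 0 := by
  simp [lift, Pi.single_apply]

lemma lift_snd (l : ℤ) (a : Fin m → ℝ) : (lift l a : Ext n m).2 = 0 := by simp [lift]

lemma pt_fst (x : Fin n → ℝ) (j : ℤ) : (pt x : Ext n m).1 j = 0 := by simp [pt]

lemma pt_snd (x : Fin n → ℝ) : (pt x : Ext n m).2 = x := by simp [pt]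

lemma nextState_apply (j : ℤ) (ζ : Ext n m) :
    c.nextState j ζ = (ζ.1, c.A *ᵥ ζ.2 + c.B *ᵥ ζ.1 j) := rfl

lemma nextState_lift_ne {j l : ℤ} (h : j ≠ l) (a : Fin m → ℝ) :
    c.nextState j (lift l a) = lift l a := by
  ext1
  · rfl
  · simp [nextState_apply, lift_fst, lift_snd, h]

lemma nextState_lift_self (l : ℤ) (a : Fin m → ℝ) :
    c.nextState l (lift l a) = lift l a + pt (c.B *ᵥ a) := by
  ext1
  · simp [nextState_apply, pt]
  · simp [nextState_apply, lift_fst, lift_snd, pt]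

lemma nextState_pt (j : ℤ) (x : Fin n → ℝ) : c.nextState j (pt x) = pt (c.A *ᵥ x) := by
  ext1
  · rfl
  · simp [nextState_apply, pt]

lemma A12_apply (k : ℕ) (τ : ℤ) (ζ : Ext n m) : c.A12 k τ ζ =
    ∑ l ∈ Finset.Icc τ (c.N - k - 1), c.A12v k τ l *ᵥ ζ.1 l + c.A12x k *ᵥ ζ.2 := by
  simp [A12, ctrl]

lemma A12_eq (k : ℕ) {τ : ℤ} (hτ : τ ≤ c.N - k - 1) (ζ : Ext n m) :
    c.A12 k τ ζ = c.A12zeta k ζ.1 τ ζ.2 := by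
  rw [A12_apply, c.A12zeta_eq k τ hτ]

lemma gap_apply (k : ℕ) (τ : ℤ) (ζ : Ext n m) :
    c.gap k τ ζ = ζ.1 (c.N - k) + (c.A11 k)⁻¹ *ᵥ c.A12 k τ ζ := rfl

lemma closed_apply (k : ℕ) (τ : ℤ) (ζ : Ext n m) :
    c.closed k τ ζ = ζ - lift (c.N - k) (c.gap k τ ζ) := rfl

lemma avg_apply (t τ : ℤ) (b : ℕ) (f : ℤ → LinearMap.BilinForm ℝ (Ext n m)) (ζ ζ' : Ext n m) :
    c.avg t τ b f ζ ζ' = c.avg t τ b fun j => f j ζ ζ' := by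
  simp [avg, LinearMap.sum_apply]

lemma W_apply (k : ℕ) (τ : ℤ) (ζ ζ' : Ext n m) : c.W k τ ζ ζ' = ζ.2 ⬝ᵥ c.Q *ᵥ ζ'.2 +
    c.avg (c.N - k) τ 0 fun j => ζ.1 j ⬝ᵥ c.R *ᵥ ζ'.1 j +
      c.Val k j (c.nextState j ζ) (c.nextState j ζ') := by
  rw [W, bellman, LinearMap.add_apply, LinearMap.add_apply, avg_apply]
  simp [Matrix.toBilin'_apply', ctrl]

lemma Val_zero (τ : ℤ) (ζ ζ' : Ext n m) : c.Val 0 τ ζ ζ' = ζ.2 ⬝ᵥ c.Sfin *ᵥ ζ'.2 := by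
  simp [Val, Matrix.toBilin'_apply']

lemma Val_succ (k : ℕ) (τ : ℤ) (ζ ζ' : Ext n m) :
    c.Val (k + 1) τ ζ ζ' = c.W k τ (c.closed k τ ζ) (c.closed k τ ζ') := rfl

lemma avg_congr {M : Type*} [AddCommGroup M] [Module ℝ M] {t τ : ℤ} {b : ℕ} {f g : ℤ → M}
    (hτ : τ ≤ t) (h : ∀ j, τ ≤ j → j ≤ t → f j = g j) : c.avg t τ b f = c.avg t τ b g := by
  unfold avg
  rw [h τ le_rfl hτ]
  congr 1
  refine Finset.sum_congr rfl fun j hj => ?_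
  have hj := Finset.mem_Icc.1 hj
  rw [h j (by omega) (by omega)]

lemma avg_zero {M : Type*} [AddCommGroup M] [Module ℝ M] (t τ : ℤ) (b : ℕ) :
    c.avg t τ b (fun _ => (0 : M)) = 0 := by
  simp [avg]

/-- The induction step for `Val_eq_zero_right`, isolated so that the same argument also covers `W`.
-/
lemma W_eq_zero_right_of_Val (k : ℕ)
    (h : ∀ τ : ℤ, τ ≤ c.N - k → ∀ ζ ζ' : Ext n m,
      (∀ l, τ ≤ l → l ≤ c.N - k → ζ'.1 l = 0) → ζ'.2 = 0 → c.Val k τ ζ ζ' = 0)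
    (τ : ℤ) (hτ : τ ≤ c.N - k) (ζ ζ' : Ext n m)
    (h1 : ∀ l, τ ≤ l → l ≤ c.N - k → ζ'.1 l = 0) (h2 : ζ'.2 = 0) : c.W k τ ζ ζ' = 0 := by
  rw [W_apply, h2, mulVec_zero, dotProduct_zero, zero_add, ← c.avg_zero (M := ℝ) (c.N - k) τ 0]
  refine c.avg_congr hτ fun j hj1 hj2 => ?_
  rw [h1 j hj1 hj2, mulVec_zero, dotProduct_zero, zero_add]
  refine h j hj2 _ _ (fun l hl1 hl2 => h1 l (by omega) hl2) ?_
  rw [nextState_apply, h1 j hj1 hj2, h2]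
  simp

/-- The cost-to-go depends only on the state and on the controls of the times `τ, …, N-k`. -/
lemma Val_eq_zero_right (k : ℕ) (τ : ℤ) (hτ : τ ≤ c.N - k) (ζ ζ' : Ext n m)
    (h1 : ∀ l, τ ≤ l → l ≤ c.N - k → ζ'.1 l = 0) (h2 : ζ'.2 = 0) : c.Val k τ ζ ζ' = 0 := by
  induction k generalizing τ ζ ζ' with
  | zero => simp [Val_zero, h2]
  | succ k ih =>
    push_cast at hτ h1
    have hA : c.A12 k τ ζ' = 0 := by
      rw [A12_apply, h2, Finset.sum_eq_zero]
      · simp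
      · intro l hl
        have hl := Finset.mem_Icc.1 hl
        rw [h1 l hl.1 (by omega), mulVec_zero]
    rw [Val_succ]
    refine c.W_eq_zero_right_of_Val k ih τ (by omega) _ _ (fun l hl1 hl2 => ?_) ?_
    · rw [closed_apply, gap_apply, hA, Prod.fst_sub, Pi.sub_apply, lift_fst]
      split_ifs with h
      · simp [h]
      · simp [h1 l hl1 (by omega)]
    · rw [closed_apply, Prod.snd_sub, lift_snd, h2, sub_zero]

lemma W_eq_zero_right (k : ℕ) (τ : ℤ) (hτ : τ ≤ c.N - k) (ζ ζ' : Ext n m)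
    (h1 : ∀ l, τ ≤ l → l ≤ c.N - k → ζ'.1 l = 0) (h2 : ζ'.2 = 0) : c.W k τ ζ ζ' = 0 :=
  c.W_eq_zero_right_of_Val k (c.Val_eq_zero_right k) τ hτ ζ ζ' h1 h2

/-- The weights are symmetric and positive semidefinite. -/
structure IsWeight : Prop where
  R : c.R.PosDef
  Q : c.Q.PosSemidef
  Sfin : c.Sfin.PosSemidef

lemma dotProduct_mulVec_comm {r : ℕ} {X : Matrix (Fin r) (Fin r) ℝ} (hX : Xᵀ = X)
    (x y : Fin r → ℝ) : x ⬝ᵥ X *ᵥ y = y ⬝ᵥ X *ᵥ x := by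
  rw [dotProduct_mulVec, ← mulVec_transpose, hX, dotProduct_comm]

lemma mulVec_dotProduct {r s : ℕ} (X : Matrix (Fin r) (Fin s) ℝ) (x : Fin s → ℝ) (y : Fin r → ℝ) :
    (X *ᵥ x) ⬝ᵥ y = x ⬝ᵥ Xᵀ *ᵥ y := by
  rw [dotProduct_comm, dotProduct_mulVec, mulVec_transpose, dotProduct_comm]

lemma transpose_eq_of_isHermitian {r : ℕ} {X : Matrix (Fin r) (Fin r) ℝ} (hX : X.IsHermitian) :
    Xᵀ = X := by
  rw [← conjTranspose_eq_transpose_of_trivial]; exact hX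

variable {c}

lemma IsWeight.W_comm_of_Val (hw : c.IsWeight) (k : ℕ)
    (h : ∀ τ ζ ζ', c.Val k τ ζ ζ' = c.Val k τ ζ' ζ) (τ : ℤ) (ζ ζ' : Ext n m) :
    c.W k τ ζ ζ' = c.W k τ ζ' ζ := by
  rw [W_apply, W_apply, dotProduct_mulVec_comm (transpose_eq_of_isHermitian hw.Q.1)]
  simp only [h _ (c.nextState _ ζ),
    dotProduct_mulVec_comm (transpose_eq_of_isHermitian hw.R.1) (ζ.1 _)]

lemma IsWeight.Val_comm (hw : c.IsWeight) (k : ℕ) (τ : ℤ) (ζ ζ' : Ext n m) :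
    c.Val k τ ζ ζ' = c.Val k τ ζ' ζ := by
  induction k generalizing τ ζ ζ' with
  | zero => rw [Val_zero, Val_zero, dotProduct_mulVec_comm (transpose_eq_of_isHermitian hw.Sfin.1)]
  | succ k ih =>
    rw [Val_succ, Val_succ]
    exact hw.W_comm_of_Val k ih τ _ _

lemma IsWeight.W_comm (hw : c.IsWeight) (k : ℕ) (τ : ℤ) (ζ ζ' : Ext n m) :
    c.W k τ ζ ζ' = c.W k τ ζ' ζ := hw.W_comm_of_Val k (hw.Val_comm k) τ ζ ζ'

lemma IsProb.avg_mono (hc : c.IsProb) {t τ : ℤ} {b : ℕ} {f g : ℤ → ℝ}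
    (h : ∀ j, f j ≤ g j) : c.avg t τ b f ≤ c.avg t τ b g := by
  unfold avg
  refine add_le_add (Finset.sum_le_sum fun j _ => ?_) ?_
  · exact mul_le_mul_of_nonneg_left (h j) (hc.nonneg _)
  · exact mul_le_mul_of_nonneg_left (h τ) (hc.Pbar_nonneg _)

lemma IsProb.avg_nonneg (hc : c.IsProb) {t τ : ℤ} {b : ℕ} {f : ℤ → ℝ}
    (h : ∀ j, 0 ≤ f j) : 0 ≤ c.avg t τ b f := by
  refine le_trans (le_of_eq ?_) (hc.avg_mono h)
  simp [avg]

lemma dotProduct_mulVec_nonneg {r : ℕ} {X : Matrix (Fin r) (Fin r) ℝ} (hX : X.PosSemidef)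
    (x : Fin r → ℝ) : 0 ≤ x ⬝ᵥ X *ᵥ x := by
  simpa using hX.dotProduct_mulVec_nonneg x

lemma IsWeight.W_nonneg_of_Val (hw : c.IsWeight) (hc : c.IsProb) (k : ℕ)
    (h : ∀ τ ζ, 0 ≤ c.Val k τ ζ ζ) (τ : ℤ) (ζ : Ext n m) : 0 ≤ c.W k τ ζ ζ := by
  rw [W_apply]
  refine add_nonneg (dotProduct_mulVec_nonneg hw.Q _) (hc.avg_nonneg fun j => add_nonneg ?_ (h _ _))
  exact dotProduct_mulVec_nonneg hw.R.posSemidef _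

lemma IsWeight.Val_nonneg (hw : c.IsWeight) (hc : c.IsProb) (k : ℕ) (τ : ℤ) (ζ : Ext n m) :
    0 ≤ c.Val k τ ζ ζ := by
  induction k generalizing τ ζ with
  | zero => rw [Val_zero]; exact dotProduct_mulVec_nonneg hw.Sfin _
  | succ k ih => rw [Val_succ]; exact hw.W_nonneg_of_Val hc k ih τ _

lemma IsWeight.W_nonneg (hw : c.IsWeight) (hc : c.IsProb) (k : ℕ) (τ : ℤ) (ζ : Ext n m) :
    0 ≤ c.W k τ ζ ζ := hw.W_nonneg_of_Val hc k (hw.Val_nonneg hc k) τ ζ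

lemma IsWeight.Val_eq_zero_left (hw : c.IsWeight) (k : ℕ) (τ : ℤ) (hτ : τ ≤ c.N - k)
    (ζ ζ' : Ext n m) (h1 : ∀ l, τ ≤ l → l ≤ c.N - k → ζ.1 l = 0) (h2 : ζ.2 = 0) :
    c.Val k τ ζ ζ' = 0 := by
  rw [hw.Val_comm]; exact c.Val_eq_zero_right k τ hτ _ _ h1 h2

/-- An outdated control has no influence. -/
lemma IsWeight.Val_lift_left (hw : c.IsWeight) (k : ℕ) {τ l : ℤ} (hτ : τ ≤ c.N - k) (h : l < τ)
    (a : Fin m → ℝ) (ζ : Ext n m) : c.Val k τ (lift l a) ζ = 0 := by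
  refine hw.Val_eq_zero_left k τ hτ _ _ (fun j hj _ => ?_) (lift_snd _ _)
  rw [lift_fst, if_neg (by omega)]

variable (c)

lemma Val_lift_right (k : ℕ) {τ l : ℤ} (hτ : τ ≤ c.N - k) (h : l < τ)
    (a : Fin m → ℝ) (ζ : Ext n m) : c.Val k τ ζ (lift l a) = 0 := by
  refine c.Val_eq_zero_right k τ hτ _ _ (fun j hj _ => ?_) (lift_snd _ _)
  rw [lift_fst, if_neg (by omega)]

/-- The blocks of the cost-to-go, for controls of ages `H < L < D` at time `t`. -/
structure Blocks (k : ℕ) (t : ℤ) (g : GainData n m) : Prop where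
  xx : ∀ (D : ℕ) (x x' : Fin n → ℝ), c.Val k (t - D) (pt x) (pt x') = x ⬝ᵥ c.Sg k *ᵥ x'
  cx : ∀ (L D : ℕ), L < D → ∀ (a : Fin m → ℝ) (x : Fin n → ℝ),
    c.Val k (t - D) (lift (t - L) a) (pt x) = a ⬝ᵥ (c.MC k (L + 1) - g.thetaC (L + 1)) *ᵥ x
  rx : ∀ (D : ℕ) (a : Fin m → ℝ) (x : Fin n → ℝ),
    c.Val k (t - D) (lift (t - D) a) (pt x) = a ⬝ᵥ (c.MR k (D + 1) - g.thetaRL (D + 1)) *ᵥ x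
  cc : ∀ (L D : ℕ), L < D → ∀ (a : Fin m → ℝ),
    c.Val k (t - D) (lift (t - L) a) (lift (t - L) a) =
      a ⬝ᵥ (c.DC k (L + 1) - (2 : ℝ) • g.uuCs (L + 1) - g.rCs (L + 1) -
        (g.etaC (L + 1))ᵀ * g.A11⁻¹ * g.etaC (L + 1)) *ᵥ a
  rr : ∀ (D : ℕ) (a : Fin m → ℝ),
    c.Val k (t - D) (lift (t - D) a) (lift (t - D) a) =
      a ⬝ᵥ (c.DR k (D + 1) - (2 : ℝ) • g.uuRL (D + 1) - g.rRL (D + 1) -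
        (g.etaRL (D + 1))ᵀ * g.A11⁻¹ * g.etaRL (D + 1)) *ᵥ a
  co : ∀ (H L D : ℕ), H < L → L < D → ∀ (a a' : Fin m → ℝ),
    c.Val k (t - D) (lift (t - H) a) (lift (t - L) a') =
      a ⬝ᵥ (c.VC k (L + 1) (H + 1) - g.uuCdC (L + 1) (H + 2) - g.rCdC (L + 1) (H + 1) -
        (g.etaC (H + 1))ᵀ * g.A11⁻¹ * g.etaC (L + 1)) *ᵥ a'
  ro : ∀ (H D : ℕ), H < D → ∀ (a a' : Fin m → ℝ),
    c.Val k (t - D) (lift (t - H) a) (lift (t - D) a') =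
      a ⬝ᵥ (c.VR k (D + 1) (H + 1) - g.uuCdRL (D + 1) (H + 2) - g.rCdRL (D + 1) (H + 1) -
        (g.etaC (H + 1))ᵀ * g.A11⁻¹ * g.etaRL (D + 1)) *ᵥ a'

lemma blocks_zero : c.Blocks 0 c.N (c.prev 0) := by
  constructor <;> intros <;>
    simp [Val_zero, pt_snd, lift_snd, prev, start, Sg, MC, MR, VC, VR, DC, DR, flowC_zero, flowR_zero]

end HoldLQ

end

/-! ### Identification of the gains with the blocks of the cost-to-go. -/

noncomputable section

namespace HoldLQ

variable {n m : ℕ} {c : HoldLQ n m}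

section

variable {k : ℕ} (hb : c.Blocks k (c.N - k) (c.prev k))
include hb

lemma Blocks.W_xx (D : ℕ) (x x' : Fin n → ℝ) : c.W k (c.N - k - D) (pt x) (pt x') =
    x ⬝ᵥ (c.Aᵀ * c.Sg k * c.A + c.Q) *ᵥ x' := by
  rw [W_apply, c.avg_congr (g := fun _ => (c.A *ᵥ x) ⬝ᵥ c.Sg k *ᵥ (c.A *ᵥ x')) (by omega),
    avg_const, pt_snd, pt_snd]
  · simp only [add_mulVec, dotProduct_add, mulVec_dotProduct, mulVec_mulVec, Matrix.mul_assoc]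
    ring
  · intro j _ hj
    obtain ⟨s, rfl⟩ : ∃ s : ℕ, j = c.N - k - s := ⟨(c.N - k - j).toNat, by omega⟩
    rw [nextState_pt, nextState_pt, hb.xx, pt_fst, zero_dotProduct, zero_add]

/-- Three cases for the newest signal. If it is newer than the control of age `L`, that control is
outdated and contributes nothing; if it is this control, the held block applies, together with its
effect `B a` on the state; if it is older, the control stays under way. The weights of the last two
cases are `p(L)` and `P̄(L)`. The other blocks follow the same pattern, with only the second case
when the control is the held one. -/
lemma Blocks.W_cx (hw : c.IsWeight) (L D : ℕ) (h : L < D) (a : Fin m → ℝ) (x : Fin n → ℝ) :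
    c.W k (c.N - k - D) (lift (c.N - k - L) a) (pt x) =
      a ⬝ᵥ (c.MC (k + 1) L - c.KuxC (c.prev k) L) *ᵥ x := by
  rw [W_apply, c.avg_of_lt _ (a ⬝ᵥ (c.MC k (L + 1) - (c.prev k).thetaC (L + 1)) *ᵥ (c.A *ᵥ x)) _ h
    (fun s h1 h2 => ?_) rfl (fun s h1 => ?_)]
  rotate_left
  · rw [nextState_lift_ne _ (by omega), nextState_pt, hb.cx L s h1, pt_fst, mulVec_zero,
      dotProduct_zero, zero_add]
  · rw [nextState_lift_ne _ (by omega), hw.Val_lift_left k (by omega) (by omega), pt_fst,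
      mulVec_zero, dotProduct_zero, zero_add]
  · rw [nextState_lift_self, nextState_pt, map_add, LinearMap.add_apply, hb.rx, hb.xx, pt_fst,
      lift_snd, MC_succ, KuxC]
    simp only [sub_mulVec, add_mulVec, smul_mulVec, dotProduct_sub, dotProduct_add, dotProduct_smul,
      smul_eq_mul, mulVec_dotProduct, mulVec_mulVec, Matrix.sub_mul, Matrix.mul_assoc,
      mulVec_zero, dotProduct_zero, zero_dotProduct]
    ring

lemma Blocks.W_rx (hw : c.IsWeight) (D : ℕ) (a : Fin m → ℝ) (x : Fin n → ℝ) :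
    c.W k (c.N - k - D) (lift (c.N - k - D) a) (pt x) =
      a ⬝ᵥ (c.MR (k + 1) D - c.KuxRL (c.prev k) D) *ᵥ x := by
  rw [W_apply, c.avg_of_eq _ _ (fun s h1 => ?_)]
  rotate_left
  · rw [nextState_lift_ne _ (by omega), hw.Val_lift_left k (by omega) (by omega), pt_fst,
      mulVec_zero, dotProduct_zero, zero_add]
  · rw [nextState_lift_self, nextState_pt, map_add, LinearMap.add_apply, hb.rx, hb.xx, pt_fst,
      lift_snd, MR_succ, KuxRL]
    simp only [sub_mulVec, add_mulVec, smul_mulVec, dotProduct_sub, dotProduct_add, dotProduct_smul,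
      smul_eq_mul, mulVec_dotProduct, mulVec_mulVec, Matrix.sub_mul, Matrix.mul_assoc,
      mulVec_zero, dotProduct_zero, zero_dotProduct]
    ring

lemma Blocks.W_cc (hw : c.IsWeight) (L D : ℕ) (h : L < D) (a : Fin m → ℝ) :
    c.W k (c.N - k - D) (lift (c.N - k - L) a) (lift (c.N - k - L) a) =
      a ⬝ᵥ (c.DC (k + 1) L - (2 : ℝ) • c.KuuCs (c.prev k) L - c.KrCs (c.prev k) L) *ᵥ a := by
  rw [W_apply, c.avg_of_lt _ (a ⬝ᵥ (c.DC k (L + 1) - (2 : ℝ) • (c.prev k).uuCs (L + 1) -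
      (c.prev k).rCs (L + 1) - ((c.prev k).etaC (L + 1))ᵀ * (c.prev k).A11⁻¹ *
        (c.prev k).etaC (L + 1)) *ᵥ a) _ h (fun s h1 h2 => ?_) rfl (fun s h1 => ?_)]
  rotate_left
  · rw [nextState_lift_ne _ (by omega), hb.cc L s h1, lift_fst, if_neg (by omega), mulVec_zero,
      dotProduct_zero, zero_add]
  · rw [nextState_lift_ne _ (by omega), hw.Val_lift_left k (by omega) (by omega), lift_fst,
      if_neg (by omega), mulVec_zero, dotProduct_zero, zero_add]
  · rw [nextState_lift_self, LinearMap.map_add₂, map_add, map_add, hb.rr,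
      hw.Val_comm k _ (pt _) (lift _ _), hb.rx, hb.xx, lift_fst,
      lift_snd, DC_succ, KuuCs, KrCs, KalphaCs, if_pos rfl]
    simp only [sub_mulVec, add_mulVec, smul_mulVec, dotProduct_sub, dotProduct_add, dotProduct_smul,
      smul_eq_mul, mulVec_dotProduct, mulVec_mulVec, Matrix.sub_mul, Matrix.mul_assoc,
      mulVec_zero, dotProduct_zero, smul_add, mul_add, mul_sub]
    ring

lemma Blocks.W_rr (hw : c.IsWeight) (D : ℕ) (a : Fin m → ℝ) :
    c.W k (c.N - k - D) (lift (c.N - k - D) a) (lift (c.N - k - D) a) =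
      a ⬝ᵥ (c.DR (k + 1) D - (2 : ℝ) • c.KuuRL (c.prev k) D - c.KrRL (c.prev k) D) *ᵥ a := by
  rw [W_apply, c.avg_of_eq _ _ (fun s h1 => ?_)]
  rotate_left
  · rw [nextState_lift_ne _ (by omega), hw.Val_lift_left k (by omega) (by omega), lift_fst,
      if_neg (by omega), mulVec_zero, dotProduct_zero, zero_add]
  · rw [nextState_lift_self, LinearMap.map_add₂, map_add, map_add, hb.rr,
      hw.Val_comm k _ (pt _) (lift _ _), hb.rx, hb.xx, lift_fst,
      lift_snd, DR_succ, KuuRL, KrRL, KalphaRL, if_pos rfl]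
    simp only [sub_mulVec, add_mulVec, smul_mulVec, dotProduct_sub, dotProduct_add, dotProduct_smul,
      smul_eq_mul, mulVec_dotProduct, mulVec_mulVec, Matrix.sub_mul, Matrix.mul_assoc,
      mulVec_zero, dotProduct_zero, smul_add, mul_add, mul_sub]
    ring

lemma Blocks.W_co (H L D : ℕ) (h : H < L) (h' : L < D) (a a' : Fin m → ℝ) :
    c.W k (c.N - k - D) (lift (c.N - k - H) a) (lift (c.N - k - L) a') =
      a ⬝ᵥ (c.VC (k + 1) L H - c.KuuCdC (c.prev k) L (H + 1) - c.KrCdC (c.prev k) L H) *ᵥ a' := by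
  rw [W_apply, c.avg_of_lt _ (a ⬝ᵥ (c.VC k (L + 1) (H + 1) - (c.prev k).uuCdC (L + 1) (H + 2) -
      (c.prev k).rCdC (L + 1) (H + 1) - ((c.prev k).etaC (H + 1))ᵀ * (c.prev k).A11⁻¹ *
        (c.prev k).etaC (L + 1)) *ᵥ a') _ h' (fun s h1 h2 => ?_) rfl (fun s h1 => ?_)]
  rotate_left
  · rw [nextState_lift_ne _ (by omega), nextState_lift_ne _ (by omega), hb.co H L s h h1, lift_fst,
      if_neg (by omega), zero_dotProduct, zero_add]
  · rw [nextState_lift_ne (j := c.N - k - s) (l := c.N - k - L) _ (by omega),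
      Val_lift_right c k (by omega) (by omega), lift_fst (c.N - k - L),
      if_neg (by omega), mulVec_zero, dotProduct_zero, zero_add]
  · rw [nextState_lift_self, nextState_lift_ne _ (by omega), map_add, hb.ro H L h, hb.cx H L h,
      lift_fst, lift_snd, if_neg (by omega), VC_succ, KuuCdC, KrCdC, KalphaCdC]
    simp only [sub_mulVec, add_mulVec, smul_mulVec, dotProduct_sub, dotProduct_add, dotProduct_smul,
      smul_eq_mul, mulVec_mulVec, Matrix.sub_mul, Matrix.mul_assoc,
      zero_dotProduct, smul_add, mul_add, mul_sub]
    ring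

lemma Blocks.W_ro (H D : ℕ) (h : H < D) (a a' : Fin m → ℝ) :
    c.W k (c.N - k - D) (lift (c.N - k - H) a) (lift (c.N - k - D) a') =
      a ⬝ᵥ (c.VR (k + 1) D H - c.KuuCdRL (c.prev k) D (H + 1) - c.KrCdRL (c.prev k) D H) *ᵥ a' := by
  rw [W_apply, c.avg_of_eq _ _ (fun s h1 => ?_)]
  rotate_left
  · rw [nextState_lift_ne (j := c.N - k - s) (l := c.N - k - D) _ (by omega),
      Val_lift_right c k (by omega) (by omega), lift_fst (c.N - k - D),
      if_neg (by omega), mulVec_zero, dotProduct_zero, zero_add]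
  · rw [nextState_lift_self, nextState_lift_ne _ (by omega), map_add, hb.ro H D h, hb.cx H D h,
      lift_fst, lift_snd, if_neg (by omega), VR_succ, KuuCdRL, KrCdRL, KalphaCdRL]
    simp only [sub_mulVec, add_mulVec, smul_mulVec, dotProduct_sub, dotProduct_add, dotProduct_smul,
      smul_eq_mul, mulVec_mulVec, Matrix.sub_mul, Matrix.mul_assoc,
      zero_dotProduct, smul_add, mul_add, mul_sub]
    ring

end

lemma A12_pt (k : ℕ) (τ : ℤ) (x : Fin n → ℝ) : c.A12 k τ (pt x) = c.A12x k *ᵥ x := by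
  rw [A12_apply, Finset.sum_eq_zero, zero_add, pt_snd]
  intro l _
  rw [pt_fst, mulVec_zero]

lemma A12_lift (k : ℕ) {τ l : ℤ} (h1 : τ ≤ l) (h2 : l ≤ c.N - k - 1) (a : Fin m → ℝ) :
    c.A12 k τ (lift l a) = c.A12v k τ l *ᵥ a := by
  rw [A12_apply, lift_snd, mulVec_zero, add_zero, Finset.sum_eq_single l]
  · rw [lift_fst, if_pos rfl]
  · intro j _ hj
    rw [lift_fst, if_neg hj, mulVec_zero]
  · intro h
    exact absurd (Finset.mem_Icc.2 ⟨h1, h2⟩) h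

lemma A11_transpose (k : ℕ) : (c.A11 k)ᵀ = c.A11 k := by
  simp only [A11, A11step, transpose_smul, transpose_add, transpose_transpose]
  rw [add_comm]

lemma dotProduct_A11 (k : ℕ) (a : Fin m → ℝ) :
    a ⬝ᵥ c.A11 k *ᵥ a = a ⬝ᵥ c.A11form k (c.prev k) *ᵥ a := by
  have h : a ⬝ᵥ (c.A11form k (c.prev k))ᵀ *ᵥ a = a ⬝ᵥ c.A11form k (c.prev k) *ᵥ a := by
    rw [← mulVec_dotProduct, dotProduct_comm]
  rw [A11, A11step, smul_mulVec, add_mulVec, dotProduct_smul, dotProduct_add, h, smul_eq_mul]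
  ring

/-- The dependence of the expected cost on the control of time `N-k`: `A₁₁` and `A₁₂` are the
blocks of the quadratic form. -/
theorem Blocks.W_lift {k : ℕ} (hb : c.Blocks k (c.N - k) (c.prev k)) (hw : c.IsWeight)
    (hc : c.IsProb) {τ : ℤ} (hτ : τ ≤ c.N - k - 1) (a : Fin m → ℝ) (ζ : Ext n m) :
    c.W k τ (lift (c.N - k) a) ζ = a ⬝ᵥ (c.A12 k τ ζ + c.A11 k *ᵥ ζ.1 (c.N - k)) := by
  obtain ⟨D, rfl⟩ : ∃ D : ℕ, τ = c.N - k - D := ⟨(c.N - k - τ).toNat, by omega⟩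
  have hD : 0 < D := by omega
  have e0 : (c.N : ℤ) - k = c.N - k - (0 : ℕ) := by simp
  -- the blocks
  have hx : ∀ x, c.W k (c.N - k - D) (lift (c.N - k) a) (pt x) = a ⬝ᵥ c.A12x k *ᵥ x := by
    intro x
    conv_lhs => enter [1, 2, 1]; rw [e0]
    rw [hb.W_cx hw 0 D hD, A12x, M_prev]
    simp [KuxC, Kgx]
  -- Age `0` is the control chosen now. At `b = 0` the corrections `K_uuCs` and `K_rCs` assemble
  -- `K_gg` and the term `2 p(0) K_θRL B`. The block is not symmetric, but its quadratic form agrees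
  -- with that of `A₁₁`.
  have hq : ∀ b, c.W k (c.N - k - D) (lift (c.N - k) b) (lift (c.N - k) b) =
      b ⬝ᵥ c.A11 k *ᵥ b := by
    intro b
    have := hb.W_cc hw 0 D hD b
    rw [← e0] at this
    rw [dotProduct_A11, this, A11form, ← Tc_add_Ke, Kgg, KuuCs, KrCs, KalphaCs]
    simp only [Nat.cast_zero, zero_add, sub_mulVec, add_mulVec, neg_mulVec, smul_mulVec,
      dotProduct_sub, dotProduct_add, dotProduct_neg, dotProduct_smul, smul_eq_mul]
    ring
  have hv : ∀ l, (c.N : ℤ) - k - D ≤ l → l ≤ c.N - k - 1 → ∀ b,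
      c.W k (c.N - k - D) (lift (c.N - k) a) (lift l b) =
        a ⬝ᵥ c.A12v k (c.N - k - D) l *ᵥ b := by
    intro l h1 h2 b
    obtain ⟨L, rfl⟩ : ∃ L : ℕ, l = c.N - k - L := ⟨(c.N - k - l).toNat, by omega⟩
    rw [A12v, sub_sub_cancel, sub_sub_cancel, Int.toNat_natCast, Int.toNat_natCast]
    split_ifs with h
    · obtain rfl : L = D := by omega
      have := hb.W_ro 0 L hD a b
      rw [← e0] at this
      rw [this, KetaRL, hc.KzetaRL_prev k L hD, KguRL, KuuCdRL, KrCdRL, KbetaRL, KalphaCdRL]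
      simp only [zero_add, sub_mulVec, add_mulVec, smul_mulVec,
        dotProduct_sub, dotProduct_add, dotProduct_smul, smul_eq_mul]
      ring
    · have := hb.W_co 0 L D (by omega) (by omega) a b
      rw [← e0] at this
      rw [this, KetaC, hc.KzetaC_prev k L (by omega), KguC, KuuCdC, KrCdC, KbetaC, KalphaCdC]
      simp only [zero_add, sub_mulVec, add_mulVec, smul_mulVec, Matrix.mul_add, Matrix.mul_smul,
        dotProduct_sub, dotProduct_add, dotProduct_smul, smul_eq_mul]
      ring
  -- Polarization: `W` and `A₁₁` are both symmetric.
  have hq' : ∀ b, c.W k (c.N - k - D) (lift (c.N - k) a) (lift (c.N - k) b) =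
      a ⬝ᵥ c.A11 k *ᵥ b := by
    intro b
    have h1 := hq (a + b)
    rw [map_add, LinearMap.map_add₂, map_add, map_add, hq a, hq b,
      hw.W_comm k _ (lift _ b), mulVec_add, dotProduct_add, add_dotProduct, add_dotProduct,
      dotProduct_mulVec_comm (A11_transpose k) b a] at h1
    linarith
  -- the decomposition
  have hdec : ζ = (∑ l ∈ Finset.Icc ((c.N : ℤ) - k - D) (c.N - k - 1), lift l (ζ.1 l) +
      lift (c.N - k) (ζ.1 (c.N - k)) + pt ζ.2) + (ζ - (∑ l ∈ Finset.Icc ((c.N : ℤ) - k - D)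
        (c.N - k - 1), lift l (ζ.1 l) + lift (c.N - k) (ζ.1 (c.N - k)) + pt ζ.2)) := by
    abel
  -- The remainder of `ζ` has no state and no control in the times `τ, …, N-k`, so `W` does not see
  -- it.
  have hrest := c.W_eq_zero_right k (c.N - k - D) (by omega) (lift (c.N - k) a)
    (ζ - (∑ l ∈ Finset.Icc ((c.N : ℤ) - k - D) (c.N - k - 1), lift l (ζ.1 l) +
      lift (c.N - k) (ζ.1 (c.N - k)) + pt ζ.2)) (by
        intro j h1 h2
        simp only [Prod.fst_sub, Prod.fst_add, Prod.fst_sum, Pi.sub_apply, Pi.add_apply,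
          Finset.sum_apply, lift_fst, pt_fst, add_zero]
        rw [Finset.sum_ite_eq]
        by_cases hj : j = c.N - k
        · subst hj; simp
        · rw [if_pos (Finset.mem_Icc.2 ⟨h1, by omega⟩), if_neg hj]; simp) (by
        simp [Prod.snd_sum, lift_snd, pt_snd])
  rw [hdec, map_add, hrest, ← hdec, add_zero, map_add, map_add, map_sum, hx, hq', A12_apply,
    dotProduct_add, dotProduct_add, dotProduct_sum]
  rw [Finset.sum_congr rfl fun l hl =>
    hv l (Finset.mem_Icc.1 hl).1 (Finset.mem_Icc.1 hl).2 (ζ.1 l)]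
  ring

/-- A singular matrix has inverse `0` by convention, so invertibility is not needed. The block
recursion thus passes through steps where `A₁₁` may be singular. -/
lemma inv_mul_mul_inv (X : Matrix (Fin m) (Fin m) ℝ) : X⁻¹ * X * X⁻¹ = X⁻¹ := by
  by_cases h : IsUnit X.det
  · rw [nonsing_inv_mul _ h, Matrix.one_mul]
  · rw [nonsing_inv_apply_not_isUnit _ h]; simp

lemma A11_inv_transpose (k : ℕ) : ((c.A11 k)⁻¹)ᵀ = (c.A11 k)⁻¹ := by
  rw [transpose_nonsing_inv, A11_transpose]

/-- The cost-to-go under the feedback law, by completion of the square. -/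
lemma Blocks.Val_succ_eq {k : ℕ} (hb : c.Blocks k (c.N - k) (c.prev k)) (hw : c.IsWeight)
    (hc : c.IsProb) {τ : ℤ} (hτ : τ ≤ c.N - k - 1) (ζ ζ' : Ext n m) (h : ζ.1 (c.N - k) = 0)
    (h' : ζ'.1 (c.N - k) = 0) : c.Val (k + 1) τ ζ ζ' =
      c.W k τ ζ ζ' - c.A12 k τ ζ ⬝ᵥ (c.A11 k)⁻¹ *ᵥ c.A12 k τ ζ' := by
  rw [Val_succ, closed_apply, closed_apply, gap_apply, gap_apply, h, h', zero_add, zero_add,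
    LinearMap.map_sub₂, map_sub, map_sub, hw.W_comm k _ ζ (lift _ _), hb.W_lift hw hc hτ,
    hb.W_lift hw hc hτ, hb.W_lift hw hc hτ, h, h', lift_fst, if_pos rfl, mulVec_zero, add_zero,
    add_zero]
  -- `A₁₂` reads only the controls sent before time `N-k`.
  have h0 : c.A12 k τ (lift (c.N - k) ((c.A11 k)⁻¹ *ᵥ c.A12 k τ ζ')) = 0 := by
    rw [A12_apply, lift_snd, mulVec_zero, add_zero]
    refine Finset.sum_eq_zero fun l hl => ?_
    have := Finset.mem_Icc.1 hl
    rw [lift_fst, if_neg (by omega), mulVec_zero]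
  rw [h0, zero_add]
  simp only [mulVec_dotProduct, A11_inv_transpose, mulVec_mulVec]
  rw [← Matrix.mul_assoc, inv_mul_mul_inv,
    dotProduct_mulVec_comm (A11_inv_transpose k) (c.A12 k τ ζ')]
  ring

lemma dotProduct_sub_mulVec_dotProduct {r s l : ℕ} (X : Matrix (Fin r) (Fin s) ℝ)
    (E : Matrix (Fin l) (Fin r) ℝ) (Y : Matrix (Fin l) (Fin l) ℝ) (F : Matrix (Fin l) (Fin s) ℝ)
    (a : Fin r → ℝ) (x : Fin s → ℝ) :
    a ⬝ᵥ X *ᵥ x - (E *ᵥ a) ⬝ᵥ (Y *ᵥ (F *ᵥ x)) = a ⬝ᵥ (X - Eᵀ * Y * F) *ᵥ x := by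
  rw [sub_mulVec, dotProduct_sub, mulVec_dotProduct, mulVec_mulVec, mulVec_mulVec, Matrix.mul_assoc]

/-- Closing the loop subtracts `A₁₂ζ ⬝ A₁₁⁻¹ A₁₂ζ'` from `W`, and `A₁₂` acts on single controls
through `K_ηC` and `K_ηRL`. In the blocks with the state the subtracted term is part of `K_θ` and
`S`; in the blocks of two controls it is the explicit `K_ηᵀ A₁₁⁻¹ K_η` in `Blocks`. -/
lemma Blocks.step {k : ℕ} (hb : c.Blocks k (c.N - k) (c.prev k)) (hw : c.IsWeight)
    (hc : c.IsProb) : c.Blocks (k + 1) (c.N - (k + 1 : ℕ)) (c.prev (k + 1)) := by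
  -- Age `L` at time `N-k-1` is age `L + 1` at time `N-k`.
  have e : ∀ L : ℕ, (c.N : ℤ) - ((k + 1 : ℕ) : ℤ) - L = c.N - k - ((L + 1 : ℕ) : ℤ) := fun L => by
    push_cast; omega
  have hl : ∀ (L : ℕ) a, (lift (c.N - k - ((L + 1 : ℕ) : ℤ)) a : Ext n m).1 (c.N - k) = 0 :=
    fun L a => by rw [lift_fst, if_neg (by push_cast; omega)]
  have hA : ∀ (L D : ℕ) a, L < D → c.A12 k (c.N - k - ((D + 1 : ℕ) : ℤ))
      (lift (c.N - k - ((L + 1 : ℕ) : ℤ)) a) = (c.prev (k + 1)).etaC (L + 1) *ᵥ a := by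
    intro L D a h
    rw [A12_lift _ (by push_cast; omega) (by push_cast; omega), A12v,
      if_neg (by push_cast; omega), sub_sub_cancel]
    rfl
  have hA' : ∀ (D : ℕ) a, c.A12 k (c.N - k - ((D + 1 : ℕ) : ℤ))
      (lift (c.N - k - ((D + 1 : ℕ) : ℤ)) a) = (c.prev (k + 1)).etaRL (D + 1) *ᵥ a := by
    intro D a
    rw [A12_lift _ le_rfl (by push_cast; omega), A12v, if_pos rfl, sub_sub_cancel]
    rfl
  have h11 : c.A11 k = (c.prev (k + 1)).A11 := rfl
  constructor
  · intro D x x'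
    rw [e, hb.Val_succ_eq hw hc (by push_cast; omega) _ _ (pt_fst _ _) (pt_fst _ _), hb.W_xx,
      A12_pt, A12_pt, Sg_succ, Sstep, prev_S c le_rfl rfl]
    rw [dotProduct_sub_mulVec_dotProduct, A12x, A11]
    congr 2
    abel
  · intro L D h a x
    rw [e, e, hb.Val_succ_eq hw hc (by push_cast; omega) _ _ (hl _ _) (pt_fst _ _),
      hb.W_cx hw (L + 1) (D + 1) (by omega), A12_pt, hA L D a h]
    rw [dotProduct_sub_mulVec_dotProduct]
    simp only [prev, HoldLQ.step, KthetaC, A12x, A11, neg_add_eq_sub]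
    congr 2
    abel
  · intro D a x
    rw [e, hb.Val_succ_eq hw hc (by push_cast; omega) _ _ (hl _ _) (pt_fst _ _),
      hb.W_rx hw (D + 1), A12_pt, hA' D a]
    rw [dotProduct_sub_mulVec_dotProduct]
    simp only [prev, HoldLQ.step, KthetaRL, A12x, A11, neg_add_eq_sub]
    congr 2
    abel
  · intro L D h a
    rw [e, e, hb.Val_succ_eq hw hc (by push_cast; omega) _ _ (hl _ _) (hl _ _),
      hb.W_cc hw (L + 1) (D + 1) (by omega), hA L D a h, h11,
      dotProduct_sub_mulVec_dotProduct]
    rfl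
  · intro D a
    rw [e, hb.Val_succ_eq hw hc (by push_cast; omega) _ _ (hl _ _) (hl _ _),
      hb.W_rr hw (D + 1), hA' D a, h11,
      dotProduct_sub_mulVec_dotProduct]
    rfl
  · intro H L D h h' a a'
    rw [e, e, e, hb.Val_succ_eq hw hc (by push_cast; omega) _ _ (hl _ _) (hl _ _),
      hb.W_co (H + 1) (L + 1) (D + 1) (by omega) (by omega), hA H D a (by omega), hA L D a' h', h11,
      dotProduct_sub_mulVec_dotProduct]
    rfl
  · intro H D h a a'
    rw [e, e, hb.Val_succ_eq hw hc (by push_cast; omega) _ _ (hl _ _) (hl _ _),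
      hb.W_ro (H + 1) (D + 1) (by omega), hA H D a (by omega), hA' D a', h11,
      dotProduct_sub_mulVec_dotProduct]
    rfl

lemma IsWeight.blocks (hw : c.IsWeight) (hc : c.IsProb) (k : ℕ) :
    c.Blocks k (c.N - k) (c.prev k) := by
  induction k with
  | zero => simpa using c.blocks_zero
  | succ k ih => exact ih.step hw hc

end HoldLQ

end

/-! ### Positive definiteness of `A₁₁` and completion of the square. -/

noncomputable section

namespace HoldLQ

variable {n m : ℕ} {c : HoldLQ n m}

lemma closed_fst_ne (k : ℕ) (τ : ℤ) (ζ : Ext n m) {l : ℤ} (h : l ≠ c.N - k) :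
    (c.closed k τ ζ).1 l = ζ.1 l := by
  rw [closed_apply, Prod.fst_sub, Pi.sub_apply, lift_fst, if_neg h, sub_zero]

lemma IsProb.p_eq_zero (hc : c.IsProb) {i : ℤ} (hi : c.P i ≤ 0) {d : ℕ} (hd : (d : ℤ) ≤ i) :
    c.p d = 0 := by
  have h1 : c.p d ≤ c.P i :=
    Finset.single_le_sum (f := c.p) (fun j _ => hc.nonneg j) (Finset.mem_range.2 (by omega))
  exact le_antisymm (h1.trans hi) (hc.nonneg d)

/-- A control that is the newest one with probability at least `p d₀` at time `l + d₀`
contributes to the cost. -/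
lemma IsWeight.le_W_of_Val (hw : c.IsWeight) (hc : c.IsProb) {d₀ : ℕ} (hd : ∀ d < d₀, c.p d = 0)
    {k : ℕ} {l : ℤ} (h1 : l ≤ c.N - k) (h2 : c.N - k ≤ l + d₀)
    (h : c.N - k < l + d₀ → ∀ τ < l, ∀ ζ : Ext n m,
      c.p d₀ * (ζ.1 l ⬝ᵥ c.R *ᵥ ζ.1 l) ≤ c.Val k τ ζ ζ)
    (τ : ℤ) (hτ : τ < l) (ζ : Ext n m) :
    c.p d₀ * (ζ.1 l ⬝ᵥ c.R *ᵥ ζ.1 l) ≤ c.W k τ ζ ζ := by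
  have hR : ∀ j, 0 ≤ ζ.1 j ⬝ᵥ c.R *ᵥ ζ.1 j := fun j => dotProduct_mulVec_nonneg hw.R.posSemidef _
  obtain ⟨L, rfl⟩ : ∃ L : ℕ, l = c.N - k - L := ⟨(c.N - k - l).toNat, by omega⟩
  obtain ⟨D, rfl⟩ : ∃ D : ℕ, τ = c.N - k - D := ⟨(c.N - k - τ).toNat, by omega⟩
  rw [W_apply]
  refine le_add_of_nonneg_of_le (dotProduct_mulVec_nonneg hw.Q _) ?_
  set r := ζ.1 (c.N - k - L) ⬝ᵥ c.R *ᵥ ζ.1 (c.N - k - L) with hr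
  rcases h2.eq_or_lt with h3 | h3
  -- The control has reached age `d₀`: it becomes the newest signal with weight `p(d₀)`, and only
  -- its `R`-cost is kept.
  · obtain rfl : L = d₀ := by omega
    have h4 := c.avg_of_lt (t := c.N - k) (fun j => if j = c.N - k - L then r else 0) 0 r
      (D := D) (L := L) (by omega) (fun s _ _ => if_neg (by omega)) (if_pos rfl)
      (fun s _ => if_neg (by omega))
    rw [smul_zero, zero_add, smul_eq_mul] at h4
    rw [← h4]
    refine hc.avg_mono fun j => ?_
    split_ifs with hj
    · subst hj
      exact le_add_of_nonneg_right (hw.Val_nonneg hc _ _ _)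
    · exact add_nonneg (hR j) (hw.Val_nonneg hc _ _ _)
  -- Before age `d₀` nothing of this age or younger can arrive. So the newest signal is older with
  -- weight `P̄(L) = 1`, and the bound is inherited from the next step.
  · have h4 := c.avg_of_lt (t := c.N - k) (fun j => if j < c.N - k - L then c.p d₀ * r else 0)
      (c.p d₀ * r) 0 (D := D) (L := L) (by omega) (fun s _ _ => if_pos (by omega))
      (if_neg (by omega)) (fun s _ => if_neg (by omega))
    have h5 : c.Pbar L = 1 := by
      rw [Pbar, P, Finset.sum_eq_zero, sub_zero]
      intro d hd'
      exact hd d (by have := Finset.mem_range.1 hd'; omega)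
    rw [smul_zero, add_zero, h5, one_smul] at h4
    rw [← h4]
    refine hc.avg_mono fun j => ?_
    split_ifs with hj
    · exact le_add_of_nonneg_of_le (hR j) (h h3 j hj (c.nextState j ζ))
    · exact add_nonneg (hR j) (hw.Val_nonneg hc _ _ _)

lemma IsWeight.le_Val (hw : c.IsWeight) (hc : c.IsProb) {d₀ : ℕ} (hd : ∀ d < d₀, c.p d = 0)
    (k : ℕ) {l : ℤ} (h1 : l ≤ c.N - k) (h2 : c.N - k < l + d₀) (h3 : l + d₀ ≤ c.N)
    (τ : ℤ) (hτ : τ < l) (ζ : Ext n m) :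
    c.p d₀ * (ζ.1 l ⬝ᵥ c.R *ᵥ ζ.1 l) ≤ c.Val k τ ζ ζ := by
  induction k generalizing τ ζ with
  | zero => push_cast at h2; omega
  | succ k ih =>
    push_cast at h1 h2
    rw [Val_succ, ← c.closed_fst_ne k τ ζ (l := l) (by omega)]
    exact hw.le_W_of_Val hc hd (by omega) (by omega) (fun h => ih (by omega) h) τ hτ _

lemma IsWeight.dotProduct_A11 (hw : c.IsWeight) (hc : c.IsProb) (k : ℕ) (a : Fin m → ℝ) {τ : ℤ}
    (hτ : τ ≤ c.N - k - 1) :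
    a ⬝ᵥ c.A11 k *ᵥ a = c.W k τ (lift (c.N - k) a) (lift (c.N - k) a) := by
  rw [(hw.blocks hc k).W_lift hw hc hτ, lift_fst, if_pos rfl]
  rw [A12_apply, lift_snd, Finset.sum_eq_zero, mulVec_zero, zero_add, zero_add]
  intro l hl
  have := Finset.mem_Icc.1 hl
  rw [lift_fst, if_neg (by omega), mulVec_zero]

lemma A11_isHermitian (k : ℕ) : (c.A11 k).IsHermitian := by
  rw [IsHermitian, conjTranspose_eq_transpose_of_trivial, A11_transpose]

lemma IsWeight.A11_posSemidef (hw : c.IsWeight) (hc : c.IsProb) (k : ℕ) :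
    (c.A11 k).PosSemidef := by
  refine .of_dotProduct_mulVec_nonneg (A11_isHermitian k) fun a => ?_
  rw [star_trivial, hw.dotProduct_A11 hc k a le_rfl]
  exact hw.W_nonneg hc k _ _

theorem IsWeight.A11_posDef (hw : c.IsWeight) (hc : c.IsProb) (k : ℕ) (hk : 0 < c.P k) :
    (c.A11 k).PosDef := by
  classical
  have hex : ∃ d, 0 < c.p d ∧ d ≤ k := by
    by_contra! h
    refine hk.ne' (Finset.sum_eq_zero fun d hd => ?_)
    have hd := Finset.mem_range.1 hd
    by_contra h0
    exact absurd (h d ((hc.nonneg d).lt_of_ne' h0)) (by omega)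
  -- The least delay of positive probability serves as `d₀`; it is at most `k`, so the arrival falls
  -- within the horizon.
  obtain ⟨h1, h2⟩ := Nat.find_spec hex
  have h3 : ∀ d < Nat.find hex, c.p d = 0 := fun d hd => by
    by_contra h0
    exact Nat.find_min hex hd ⟨(hc.nonneg d).lt_of_ne' h0, by omega⟩
  refine .of_dotProduct_mulVec_pos (A11_isHermitian k) fun a ha => ?_
  have h4 := hw.R.dotProduct_mulVec_pos ha
  rw [star_trivial] at h4 ⊢
  rw [hw.dotProduct_A11 hc k a le_rfl]
  refine (mul_pos h1 h4).trans_le ?_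
  have h5 := hw.le_W_of_Val hc h3 (k := k) (l := c.N - k) le_rfl (by omega)
    (fun h => hw.le_Val hc h3 k le_rfl h (by omega)) (c.N - k - 1) (by omega) (lift (c.N - k) a)
  rwa [lift_fst, if_pos rfl] at h5

/-- A control that cannot arrive within the horizon has no influence. -/
lemma IsWeight.W_lift_self_of_Val (hw : c.IsWeight) (hc : c.IsProb) (k : ℕ) {l : ℤ}
    (hl : c.P (c.N - l) = 0) (h1 : l ≤ c.N - k) (a : Fin m → ℝ)
    (h : ∀ τ < l, c.Val k τ (lift l a) (lift l a) = 0) (τ : ℤ) (hτ : τ < l) :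
    c.W k τ (lift l a) (lift l a) = 0 := by
  obtain ⟨L, rfl⟩ : ∃ L : ℕ, l = c.N - k - L := ⟨(c.N - k - l).toNat, by omega⟩
  obtain ⟨D, rfl⟩ : ∃ D : ℕ, τ = c.N - k - D := ⟨(c.N - k - τ).toNat, by omega⟩
  rw [W_apply, lift_snd, zero_dotProduct, zero_add,
    c.avg_of_lt _ 0 _ (L := L) (by omega) (fun s h1 _ => ?_) rfl (fun s h1 => ?_),
    hc.p_eq_zero hl.le (by omega), zero_smul, smul_zero, add_zero]
  · rw [lift_fst, if_neg (by omega), zero_dotProduct, zero_add, nextState_lift_ne _ (by omega),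
      h _ (by omega)]
  · rw [lift_fst, if_neg (by omega), zero_dotProduct, zero_add, nextState_lift_ne _ (by omega),
      hw.Val_lift_left k (by omega) (by omega)]

/-- The later feedback only lowers the cost: `Val` is `W`, which vanishes by induction, minus a
nonnegative term, and it is itself nonnegative. -/
lemma IsWeight.Val_lift_self (hw : c.IsWeight) (hc : c.IsProb) (k : ℕ) {l : ℤ}
    (hl : c.P (c.N - l) = 0) (h1 : l ≤ c.N - k) (a : Fin m → ℝ) (τ : ℤ) (hτ : τ < l) :
    c.Val k τ (lift l a) (lift l a) = 0 := by
  induction k generalizing τ with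
  | zero => rw [Val_zero, lift_snd, zero_dotProduct]
  | succ k ih =>
    push_cast at h1
    refine le_antisymm ?_ (hw.Val_nonneg hc _ _ _)
    have h2 : (lift l a : Ext n m).1 (c.N - k) = 0 := by rw [lift_fst, if_neg (by omega)]
    rw [(hw.blocks hc k).Val_succ_eq hw hc (by omega) _ _ h2 h2,
      hw.W_lift_self_of_Val hc k hl (by omega) a (ih (by omega)) τ hτ, zero_sub, neg_nonpos]
    exact dotProduct_mulVec_nonneg (hw.A11_posSemidef hc k).inv _

/-- Cauchy–Schwarz: a null vector of a positive semidefinite form is orthogonal to everything. -/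
lemma IsWeight.W_lift_eq_zero (hw : c.IsWeight) (hc : c.IsProb) {k : ℕ} (hk : c.P k = 0) {τ : ℤ}
    (hτ : τ ≤ c.N - k - 1) (a : Fin m → ℝ) (ζ : Ext n m) : c.W k τ (lift (c.N - k) a) ζ = 0 := by
  have hl : c.P (c.N - (c.N - k)) = 0 := by rwa [sub_sub_cancel]
  have h0 := hw.W_lift_self_of_Val hc k hl le_rfl a (hw.Val_lift_self hc k hl le_rfl a) τ (by omega)
  have h1 := LinearMap.BilinForm.apply_sq_le_of_symm (c.W k τ) (hw.W_nonneg hc k τ)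
    ⟨fun x y => by simpa using hw.W_comm k τ x y⟩ (lift (c.N - k) a) ζ
  rw [h0, zero_mul] at h1
  exact pow_eq_zero_iff two_ne_zero |>.1 (le_antisymm h1 (sq_nonneg _))

lemma A12_closed (k : ℕ) (τ : ℤ) (ζ : Ext n m) : c.A12 k τ (c.closed k τ ζ) = c.A12 k τ ζ := by
  rw [A12_apply, A12_apply]
  congr 1
  · refine Finset.sum_congr rfl fun l hl => ?_
    have := Finset.mem_Icc.1 hl
    rw [closed_fst_ne k τ ζ (by omega)]
  · rw [closed_apply, Prod.snd_sub, lift_snd, sub_zero]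

/-- Completion of the square. -/
theorem IsWeight.W_eq (hw : c.IsWeight) (hc : c.IsProb) (k : ℕ) {τ : ℤ}
    (hτ : τ ≤ c.N - k - 1) (ζ : Ext n m) : c.W k τ ζ ζ =
      c.Val (k + 1) τ ζ ζ + c.gap k τ ζ ⬝ᵥ c.A11 k *ᵥ c.gap k τ ζ := by
  -- The cross term vanishes: for `P(k) = 0` because the control is a null vector, otherwise because
  -- the feedback solves `A₁₂ζ + A₁₁ v = 0`.
  have h1 : c.W k τ (lift (c.N - k) (c.gap k τ ζ)) (c.closed k τ ζ) = 0 := by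
    rcases (hc.P_nonneg k).eq_or_lt with h | h
    · exact hw.W_lift_eq_zero hc h.symm hτ _ _
    · have h2 : (c.closed k τ ζ).1 (c.N - k) = -((c.A11 k)⁻¹ *ᵥ c.A12 k τ ζ) := by
        rw [closed_apply, Prod.fst_sub, Pi.sub_apply, lift_fst, if_pos rfl, gap_apply]
        abel
      rw [(hw.blocks hc k).W_lift hw hc hτ, A12_closed, h2, mulVec_neg, mulVec_mulVec,
        mul_nonsing_inv _ ((Matrix.isUnit_iff_isUnit_det _).1 (hw.A11_posDef hc k h).isUnit),
        one_mulVec, add_neg_cancel, dotProduct_zero]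
  have h3 : ζ = c.closed k τ ζ + lift (c.N - k) (c.gap k τ ζ) := by
    rw [closed_apply, sub_add_cancel]
  rw [hw.dotProduct_A11 hc k _ hτ, Val_succ]
  conv_lhs => rw [h3]
  rw [LinearMap.map_add₂, map_add, map_add, h1, hw.W_comm k τ (c.closed k τ ζ) (lift _ _), h1]
  ring

lemma IsWeight.gap_eq_zero_of_P (hw : c.IsWeight) (hc : c.IsProb) {k : ℕ} (hk : c.P k = 0)
    (a : Fin m → ℝ) : a ⬝ᵥ c.A11 k *ᵥ a = 0 := by
  rw [hw.dotProduct_A11 hc k a le_rfl, hw.W_lift_eq_zero hc hk le_rfl]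

end HoldLQ

end

/-! ### The newest arrived signal and its conditional law. -/

noncomputable section

namespace HoldLQ

variable {n m : ℕ} {c : HoldLQ n m}

/-- This turns a statement on the newest signal into an intersection of events, one for each delay,
to which independence applies. -/
lemma newest_lt_iff (d : ℕ → ℕ∞) (k i l : ℕ) :
    newest d k i < l ↔ ∀ j, l ≤ j → j < i → ¬ (d j + j < k) := by
  induction i with
  | zero =>
    simp only [newest]
    exact ⟨fun _ j _ h => absurd h (Nat.not_lt_zero j), fun _ => by omega⟩
  | succ i ih =>
    rw [newest]
    split_ifs with h
    · constructor
      · intro h1 j h2 h3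
        omega
      · intro h1
        by_contra h2
        exact h1 i (by omega) (by omega) h
    · rw [ih]
      constructor
      · intro h1 j h2 h3
        rcases Nat.lt_succ_iff_lt_or_eq.1 h3 with h4 | rfl
        · exact h1 j h2 h4
        · exact h
      · intro h1 j h2 h3
        exact h1 j h2 (by omega)

lemma neg_one_le_newest (d : ℕ → ℕ∞) (k i : ℕ) : -1 ≤ newest d k i := by
  induction i with
  | zero => exact le_rfl
  | succ i ih => rw [newest]; split_ifs <;> omega

lemma neg_one_le_tauPrev (d : ℕ → ℕ∞) (t : ℕ) : -1 ≤ tauPrev d t := neg_one_le_newest d t t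

lemma tauPrev_lt (d : ℕ → ℕ∞) (t : ℕ) : tauPrev d t < t :=
  (newest_lt_iff d t t t).2 fun _ h1 h2 => absurd h2 (by omega)

variable {Ω : Type*} {d : ℕ → Ω → ℕ∞}

/-- The σ-algebras of the initial state, the delays and the noises. -/
@[reducible] def fam (x₀ : Ω → Fin n → ℝ) (w : ℕ → Ω → Fin n → ℝ) (d : ℕ → Ω → ℕ∞) :
    Option (ℕ × Bool) → MeasurableSpace Ω
  | none => MeasurableSpace.comap x₀ inferInstance
  | some (i, true) => MeasurableSpace.comap (d i) inferInstance
  | some (i, false) => MeasurableSpace.comap (w i) inferInstance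

/-- The acknowledgements before time `t`. -/
@[reducible] def acks (d : ℕ → Ω → ℕ∞) (t : ℕ) : MeasurableSpace Ω :=
  MeasurableSpace.generateFrom {s | ∃ i j : ℕ, i < t ∧ s = {ω | d j ω + j ≤ i}}

/-- The initial state, the noises and the acknowledgements before time `t`. -/
@[reducible] def past (x₀ : Ω → Fin n → ℝ) (w : ℕ → Ω → Fin n → ℝ) (d : ℕ → Ω → ℕ∞) (t : ℕ) :
    MeasurableSpace Ω :=
  (⨆ a ∈ {a | a = none ∨ ∃ i < t, a = some (i, false)}, fam x₀ w d a) ⊔ acks d t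

/-- No signal of the times `l, l+1, …` has arrived before time `t`. -/
def noArrival (d : ℕ → Ω → ℕ∞) (l t : ℕ) : Set Ω :=
  {ω | ∀ j, l ≤ j → j < t → ¬ (d j ω + j < t)}

lemma mem_noArrival {l t : ℕ} {ω : Ω} :
    ω ∈ noArrival d l t ↔ tauPrev (fun i => d i ω) t < l := (newest_lt_iff _ t t l).symm

lemma noArrival_eq (l t : ℕ) : noArrival d l t =
    ⋂ j ∈ Finset.Ico l t, (d j) ⁻¹' {x | ¬ (x + j < t)} := by
  ext ω
  simp [noArrival]

lemma measurableSet_noArrival (x₀ : Ω → Fin n → ℝ) (w : ℕ → Ω → Fin n → ℝ) (l t : ℕ) :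
    MeasurableSet[⨆ a ∈ {a | ∃ j ≥ l, a = some (j, true)}, fam x₀ w d a] (noArrival d l t) := by
  rw [noArrival_eq]
  refine Finset.measurableSet_biInter _ fun j hj => ?_
  refine le_iSup₂_of_le (f := fun a _ => fam x₀ w d a) (some (j, true))
    ⟨j, (Finset.mem_Ico.1 hj).1, rfl⟩ le_rfl _ ?_
  exact ⟨_, MeasurableSet.of_discrete, rfl⟩

/-- On the event that no signal of the times `l, l+1, …` has arrived, the past carries no
information on their delays. -/
lemma past_trace (x₀ : Ω → Fin n → ℝ) (w : ℕ → Ω → Fin n → ℝ) {l t : ℕ} {H : Set Ω}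
    (hH : MeasurableSet[past x₀ w d t] H) :
    ∃ H', MeasurableSet[⨆ a ∈ {a | ∃ j ≥ l, a = some (j, true)}ᶜ, fam x₀ w d a] H' ∧
      H ∩ noArrival d l t = H' ∩ noArrival d l t := by
  set m₁ : MeasurableSpace Ω := ⨆ a ∈ {a | ∃ j ≥ l, a = some (j, true)}ᶜ, fam x₀ w d a with hm₁
  have h1 : past x₀ w d t ≤ MeasurableSpace.map (Subtype.val : noArrival d l t → Ω)
      (MeasurableSpace.comap Subtype.val m₁) := by
    refine sup_le ?_ ?_
    · refine le_trans ?_ MeasurableSpace.le_map_comap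
      refine iSup₂_le fun a ha => ?_
      refine le_iSup₂_of_le (f := fun a _ => fam x₀ w d a) a ?_ le_rfl
      rintro ⟨j, _, rfl⟩
      rcases ha with ha | ⟨i, _, ha⟩ <;> simp at ha
    · refine MeasurableSpace.generateFrom_le ?_
      rintro _ ⟨i, j, hi, rfl⟩
      by_cases hj : j < l
      · refine MeasurableSpace.le_map_comap _ ?_
        refine le_iSup₂_of_le (f := fun a _ => fam x₀ w d a) (some (j, true)) ?_ le_rfl _ ?_
        · rintro ⟨j', h2, h3⟩
          simp only [Option.some.injEq, Prod.mk.injEq, and_true] at h3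
          omega
        · exact ⟨{x | x + j ≤ i}, MeasurableSet.of_discrete, rfl⟩
      · have h2 : (Subtype.val : noArrival d l t → Ω) ⁻¹' {ω | d j ω + j ≤ i} = ∅ := by
          refine Set.eq_empty_of_forall_notMem fun ω h3 => ?_
          have h3 : d j ω + j ≤ i := h3
          have h4 : (i : ℕ∞) < t := by exact_mod_cast hi
          have h5 : (j : ℕ∞) < t := (le_add_self.trans h3).trans_lt h4
          exact ω.2 j (by omega) (by exact_mod_cast h5) (h3.trans_lt h4)
        change MeasurableSet[MeasurableSpace.comap Subtype.val m₁]
          ((Subtype.val : noArrival d l t → Ω) ⁻¹' {ω | d j ω + j ≤ i})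
        rw [h2]
        exact MeasurableSet.empty
  obtain ⟨H', h2, h3⟩ := h1 _ hH
  refine ⟨H', h2, ?_⟩
  have := (Subtype.preimage_val_eq_preimage_val_iff _ _ _).1 h3
  rw [Set.inter_comm, ← this, Set.inter_comm]

lemma noArrival_anti (l t : ℕ) : noArrival d l (t + 1) ⊆ noArrival d l t := by
  intro ω hω j h1 h2 h3
  exact hω j h1 (by omega) (h3.trans_le (by exact_mod_cast Nat.le_succ t))

variable [mΩ : MeasurableSpace Ω]

/-- The assumptions on the initial state, the noise and the delays. -/
structure IsNoise (c : HoldLQ n m) (μ : Measure Ω) (x₀ : Ω → Fin n → ℝ) (w : ℕ → Ω → Fin n → ℝ)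
    (d : ℕ → Ω → ℕ∞) : Prop where
  x₀_meas : Measurable x₀
  w_meas : ∀ i, Measurable (w i)
  d_meas : ∀ i, Measurable (d i)
  x₀_memLp : MemLp x₀ 2 μ
  w_memLp : ∀ i, MemLp (w i) 2 μ
  w_mean : ∀ i, ∫ ω, w i ω ∂μ = 0
  d_law : ∀ i j : ℕ, μ.real {ω | d i ω = j} = c.p j
  indep_pair : iIndepFun (fun i ω => (d i ω, w i ω)) μ
  indep_dw : ∀ i, IndepFun (d i) (w i) μ
  indep_x₀ : IndepFun x₀ (fun ω i => (d i ω, w i ω)) μ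

variable {μ : Measure Ω} {x₀ : Ω → Fin n → ℝ} {w : ℕ → Ω → Fin n → ℝ}

lemma IsNoise.fam_le (h : c.IsNoise μ x₀ w d) (a : Option (ℕ × Bool)) : fam x₀ w d a ≤ mΩ := by
  rcases a with _ | ⟨i, _ | _⟩
  · exact h.x₀_meas.comap_le
  · exact (h.w_meas i).comap_le
  · exact (h.d_meas i).comap_le

variable [IsProbabilityMeasure μ]

/-- The assumptions are layered: `x₀` against all pairs, the pairs among each other, and the two
entries of each pair. A product event factors layer by layer. -/
lemma IsNoise.iIndep_fam (h : c.IsNoise μ x₀ w d) : iIndep (fam x₀ w d) μ := by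
  classical
  rw [iIndep_iff]
  intro s f hf
  let g : Option (ℕ × Bool) → Set Ω := fun a => if a ∈ s then f a else Set.univ
  have hg : ∀ a, MeasurableSet[fam x₀ w d a] (g a) := by
    intro a
    by_cases ha : a ∈ s
    · simp only [g, if_pos ha]; exact hf a ha
    · simp only [g, if_neg ha]; exact MeasurableSet.univ
  -- Padding with the whole space makes the index set a full rectangle `{x₀} ∪ T × {delay, noise}`,
  -- so that the layers can be split off.
  let T : Finset ℕ := s.eraseNone.image Prod.fst
  have hsub : s ⊆ Finset.insertNone (T ×ˢ (Finset.univ : Finset Bool)) := by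
    intro a ha
    rcases a with _ | ⟨i, b⟩
    · simp
    · simp only [Finset.some_mem_insertNone, Finset.mem_product, Finset.mem_univ, and_true, T,
        Finset.mem_image, Finset.mem_eraseNone]
      exact ⟨(i, b), ha, rfl⟩
  obtain ⟨X, hX, hX'⟩ := hg none
  choose D hD hD' using fun i => hg (some (i, true))
  choose V hV hV' using fun i => hg (some (i, false))
  have h1 : ⋂ a ∈ s, f a = x₀ ⁻¹' X ∩ (fun ω i => (d i ω, w i ω)) ⁻¹'
      (⋂ i ∈ T, (fun y : ℕ → ℕ∞ × (Fin n → ℝ) => y i) ⁻¹' (D i ×ˢ V i)) := by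
    have h2 : ⋂ a ∈ s, f a = ⋂ a ∈ Finset.insertNone (T ×ˢ (Finset.univ : Finset Bool)), g a := by
      ext ω
      simp only [Set.mem_iInter]
      constructor
      · intro h3 a _
        by_cases ha : a ∈ s
        · simp only [g, if_pos ha]; exact h3 a ha
        · simp only [g, if_neg ha]; exact Set.mem_univ _
      · intro h3 a ha
        have := h3 a (hsub ha)
        simpa only [g, if_pos ha] using this
    rw [h2]
    ext ω
    simp only [Set.mem_iInter, Set.mem_inter_iff, Option.forall, Finset.none_mem_insertNone,
      true_imp_iff, Finset.some_mem_insertNone, Finset.mem_product, Finset.mem_univ, and_true,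
      Prod.forall, Bool.forall_bool, Set.mem_preimage, Set.mem_prod, ← hX', ← hD', ← hV']
    refine and_congr Iff.rfl (forall_congr' fun i => ?_)
    tauto
  have h3 : ∏ a ∈ s, μ (f a) =
      ∏ a ∈ Finset.insertNone (T ×ˢ (Finset.univ : Finset Bool)), μ (g a) := by
    rw [← Finset.prod_subset hsub]
    · refine Finset.prod_congr rfl fun a ha => ?_
      simp only [g, if_pos ha]
    · intro a _ ha
      simp only [g, if_neg ha, measure_univ]
  rw [h1, h3, h.indep_x₀.measure_inter_preimage_eq_mul _ _ hX (by
    refine Finset.measurableSet_biInter T fun i _ => ?_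
    exact measurable_pi_apply i ((hD i).prod (hV i))), Finset.prod_insertNone, Finset.prod_product]
  have h4 := h.indep_pair.meas_biInter (S := T) (s := fun i => (fun ω => (d i ω, w i ω)) ⁻¹'
    (D i ×ˢ V i)) (fun i _ => ⟨D i ×ˢ V i, (hD i).prod (hV i), rfl⟩)
  rw [hX', Set.preimage_iInter₂]
  refine congrArg _ (h4.trans (Finset.prod_congr rfl fun i _ => ?_))
  rw [Fintype.prod_bool, ← hD', ← hV', ← (h.indep_dw i).measure_inter_preimage_eq_mul _ _ (hD i) (hV i)]
  rfl

lemma enat_add_lt_iff (x : ℕ∞) (j t : ℕ) : x + j < t ↔ ∃ e ∈ Finset.range (t - j), x = (e : ℕ) := by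
  induction x using ENat.recTopCoe with
  | top => simp
  | coe a =>
    norm_cast
    simp only [Finset.mem_range]
    constructor
    · intro h; exact ⟨a, by omega, rfl⟩
    · rintro ⟨e, h1, h2⟩; omega

lemma IsNoise.measureReal_add_lt (h : c.IsNoise μ x₀ w d) {j t : ℕ} (hj : j < t) :
    μ.real {ω | d j ω + j < t} = c.P (t - 1 - j) := by
  have h1 : {ω | d j ω + j < t} = ⋃ e ∈ Finset.range (t - j), {ω | d j ω = (e : ℕ)} := by
    ext ω
    simp only [Set.mem_ofPred_eq, enat_add_lt_iff, Set.mem_iUnion, exists_prop]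
  rw [h1, measureReal_biUnion_finset, P]
  · rw [show ((t : ℤ) - 1 - j + 1).toNat = t - j by omega]
    exact Finset.sum_congr rfl fun e _ => h.d_law j e
  · intro a _ b _ hab
    refine Set.disjoint_left.2 fun ω h1 h2 => hab ?_
    have := h1.symm.trans h2
    exact_mod_cast this
  · intro e _
    exact h.d_meas j (measurableSet_singleton _)

lemma IsNoise.isProb (h : c.IsNoise μ x₀ w d) : c.IsProb where
  nonneg e := by rw [← h.d_law 0 e]; exact measureReal_nonneg
  P_le_one i := by
    by_cases hi : i < 0
    · rw [P, show (i + 1).toNat = 0 by omega]; simp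
    · have h1 := h.measureReal_add_lt (j := 0) (t := i.toNat + 1) (by omega)
      rw [show (((i.toNat + 1 : ℕ) : ℤ) - 1 - ((0 : ℕ) : ℤ)) = i by push_cast; omega] at h1
      rw [← h1]
      exact measureReal_le_one

lemma IsNoise.measureReal_noArrival (h : c.IsNoise μ x₀ w d) (l t : ℕ) :
    μ.real (noArrival d l t) = ∏ j ∈ Finset.Ico l t, c.Pbar (t - 1 - j) := by
  have h1 : iIndepFun d μ := h.indep_pair.comp (fun _ => Prod.fst) fun _ => measurable_fst
  rw [noArrival_eq, measureReal_def, h1.meas_biInter (fun j _ => ⟨_, MeasurableSet.of_discrete, rfl⟩),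
    ENNReal.toReal_prod]
  refine Finset.prod_congr rfl fun j hj => ?_
  rw [Pbar, ← h.measureReal_add_lt (Finset.mem_Ico.1 hj).2, ← probReal_compl_eq_one_sub]
  · rfl
  · exact h.d_meas j (MeasurableSet.of_discrete (s := {x : ℕ∞ | x + (j : ℕ∞) < (t : ℕ∞)}))

lemma IsNoise.indep_later (h : c.IsNoise μ x₀ w d) (l : ℕ) :
    Indep (⨆ a ∈ {a | ∃ j ≥ l, a = some (j, true)}ᶜ, fam x₀ w d a)
      (⨆ a ∈ {a | ∃ j ≥ l, a = some (j, true)}, fam x₀ w d a) μ :=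
  indep_iSup_of_disjoint h.fam_le h.iIndep_fam disjoint_compl_left

/-- The law of the newest arrived signal, given the past. -/
lemma IsNoise.measureReal_inter_noArrival (h : c.IsNoise μ x₀ w d) {l t : ℕ} (hl : l ≤ t + 1)
    {H : Set Ω} (hH : MeasurableSet[past x₀ w d t] H) :
    μ.real (H ∩ noArrival d l (t + 1)) = c.Pbar (t - l) * μ.real (H ∩ noArrival d l t) := by
  obtain ⟨H', h1, h2⟩ := past_trace x₀ w (l := l) hH
  have h3 : H ∩ noArrival d l (t + 1) = H' ∩ noArrival d l (t + 1) := by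
    rw [← Set.inter_eq_self_of_subset_right (noArrival_anti (d := d) l t), ← Set.inter_assoc, h2,
      Set.inter_assoc]
  have h4 : ∀ t', μ.real (H' ∩ noArrival d l t') = μ.real H' * μ.real (noArrival d l t') := by
    intro t'
    simp only [measureReal_def]
    rw [(Indep_iff _ _ _).1 (h.indep_later l) _ _ h1 (measurableSet_noArrival x₀ w l t'),
      ENNReal.toReal_mul]
  rw [h3, h2, h4, h4, h.measureReal_noArrival, h.measureReal_noArrival]
  -- Increasing all ages by one reproduces every factor except the one of the oldest signal `l`. For
  -- `l = t + 1` there is no signal, and the factor is `P̄(-1) = 1`.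
  have h5 : ∏ j ∈ Finset.Ico l (t + 1), c.Pbar (((t + 1 : ℕ) : ℤ) - 1 - j) =
      c.Pbar (t - l) * ∏ j ∈ Finset.Ico l t, c.Pbar ((t : ℤ) - 1 - j) := by
    rcases hl.lt_or_eq with h6 | rfl
    · rw [Finset.prod_eq_prod_Ico_succ_bot h6, ← Finset.prod_Ico_add']
      push_cast
      congr 1
      · congr 1; omega
      · refine Finset.prod_congr rfl fun j _ => ?_
        congr 1; omega
    · rw [Finset.Ico_self, Finset.Ico_eq_empty (by omega)]
      push_cast
      rw [show (t : ℤ) - (t + 1) = -1 by omega, Pbar_neg_one]; simp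
  rw [h5]; ring

end HoldLQ

end

/-! ### The Markov transition of the newest signal. -/

noncomputable section

namespace HoldLQ

variable {n m : ℕ} {c : HoldLQ n m} {Ω : Type*}

lemma measurableSet_acks (d : ℕ → Ω → ℕ∞) {j t : ℕ} :
    MeasurableSet[acks d t] {ω | d j ω + j < t} := by
  rcases t with _ | t
  · simp
  · have : {ω | d j ω + j < (t + 1 : ℕ)} = {ω | d j ω + j ≤ t} := by
      ext ω
      simp only [Set.mem_ofPred_eq]
      push_cast
      exact ENat.lt_add_one_iff (ENat.natCast_ne_top t)
    rw [this]
    exact MeasurableSpace.measurableSet_generateFrom ⟨t, j, Nat.lt_succ_self t, rfl⟩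

lemma measurable_tauPrev (d : ℕ → Ω → ℕ∞) (t : ℕ) :
    Measurable[acks d t] fun ω => tauPrev (fun i => d i ω) t := by
  have : ∀ i, Measurable[acks d t] fun ω => newest (fun i => d i ω) t i := by
    intro i
    induction i with
    | zero => exact @measurable_const _ _ _ (acks d t) _
    | succ i ih =>
      simp only [newest]
      exact Measurable.ite (measurableSet_acks d) (@measurable_const _ _ _ (acks d t) _) ih
  exact this t

lemma acks_le_past (x₀ : Ω → Fin n → ℝ) (w : ℕ → Ω → Fin n → ℝ) (d : ℕ → Ω → ℕ∞) (t : ℕ) :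
    acks d t ≤ past x₀ w d t := le_sup_right

/-- The random index takes finitely many values, so measurability is needed only for each fixed
index. It is used for `v_τ` and for the forms indexed by `τ`. -/
lemma measurable_index {m' : MeasurableSpace Ω} {β : Type*} [MeasurableSpace β] {T : Ω → ℤ}
    (hT : Measurable[m'] T) {a b : ℤ} (ha : ∀ ω, a ≤ T ω) (hb : ∀ ω, T ω ≤ b) {g : ℤ → Ω → β}
    (hg : ∀ j, a ≤ j → j ≤ b → Measurable[m'] (g j)) : Measurable[m'] fun ω => g (T ω) ω := by
  intro s hs
  have : (fun ω => g (T ω) ω) ⁻¹' s = ⋃ j ∈ Finset.Icc a b, T ⁻¹' {j} ∩ g j ⁻¹' s := by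
    ext ω
    simp only [Set.mem_preimage, Set.mem_iUnion, Set.mem_inter_iff, Set.mem_singleton_iff,
      Finset.mem_Icc, exists_prop]
    constructor
    · intro h; exact ⟨T ω, ⟨ha ω, hb ω⟩, rfl, h⟩
    · rintro ⟨j, _, rfl, h⟩; exact h
  rw [this]
  refine Finset.measurableSet_biUnion _ fun j hj => ?_
  have hj := Finset.mem_Icc.1 hj
  exact (hT (measurableSet_singleton j)).inter (hg j hj.1 hj.2 hs)

variable [mΩ : MeasurableSpace Ω] {μ : Measure Ω} [IsProbabilityMeasure μ] {x₀ : Ω → Fin n → ℝ}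
  {w : ℕ → Ω → Fin n → ℝ} {d : ℕ → Ω → ℕ∞}

lemma IsNoise.past_le (h : c.IsNoise μ x₀ w d) (t : ℕ) : past x₀ w d t ≤ mΩ := by
  refine sup_le (iSup₂_le fun a _ => h.fam_le a) (MeasurableSpace.generateFrom_le ?_)
  rintro _ ⟨i, j, _, rfl⟩
  exact h.d_meas j (MeasurableSet.of_discrete (s := {x : ℕ∞ | x + (j : ℕ∞) ≤ (i : ℕ∞)}))

lemma IsNoise.measurable_tauPrev (h : c.IsNoise μ x₀ w d) (t : ℕ) :
    Measurable fun ω => tauPrev (fun i => d i ω) t :=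
  (HoldLQ.measurable_tauPrev d t).mono ((acks_le_past x₀ w d t).trans (h.past_le t)) le_rfl

/-- The signal in use at time `t` is the one of time `j`. -/
lemma IsNoise.measureReal_tauPrev (h : c.IsNoise μ x₀ w d) {t : ℕ} {j : ℤ} (hj : -1 ≤ j)
    (hjt : j ≤ t) {H : Set Ω} (hH : MeasurableSet[past x₀ w d t] H) :
    μ.real (H ∩ {ω | tauPrev (fun i => d i ω) (t + 1) = j}) =
      c.p (t - j).toNat * μ.real (H ∩ {ω | tauPrev (fun i => d i ω) t < j}) +
        c.Pbar (t - 1 - j) * μ.real (H ∩ {ω | tauPrev (fun i => d i ω) t = j}) := by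
  have hset : ∀ (l s : ℕ), noArrival d l s = {ω | tauPrev (fun i => d i ω) s < l} := fun l s => by
    ext ω; exact mem_noArrival
  have hHm := h.past_le t _ hH
  -- With `j = l - 1`, the event that the newest signal is `j` is the difference of the events `< l`
  -- and `< l - 1`, whose laws are known.
  obtain ⟨l, rfl⟩ : ∃ l : ℕ, j = l - 1 := ⟨(j + 1).toNat, by omega⟩
  have h1 := h.measureReal_inter_noArrival (l := l) (by omega) hH
  rw [hset, hset] at h1
  have hsplit : ∀ s, μ.real (H ∩ {ω | tauPrev (fun i => d i ω) s < (l : ℤ)}) =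
      μ.real (H ∩ {ω | tauPrev (fun i => d i ω) s < (l : ℤ) - 1}) +
        μ.real (H ∩ {ω | tauPrev (fun i => d i ω) s = (l : ℤ) - 1}) := by
    intro s
    rw [← measureReal_union]
    · congr 1
      ext ω
      simp only [Set.mem_inter_iff, Set.mem_ofPred_eq, Set.mem_union, ← and_or_left]
      refine and_congr Iff.rfl ?_
      omega
    · refine Set.disjoint_left.2 fun ω h2 h3 => ?_
      have h2 := h2.2
      have h3 := h3.2
      simp only [Set.mem_ofPred_eq] at h2 h3
      omega
    · exact hHm.inter (h.measurable_tauPrev s (measurableSet_singleton _))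
  rw [hsplit, hsplit] at h1
  -- For `l = 0` the index is `-1`, the initial input: nothing is older, and the first term
  -- disappears.
  rcases l with _ | l
  · have h2 : ∀ s, H ∩ {ω | tauPrev (fun i => d i ω) s < ((0 : ℕ) : ℤ) - 1} = ∅ := by
      intro s
      refine Set.eq_empty_of_forall_notMem fun ω h3 => ?_
      have h4 := h3.2
      have h5 := neg_one_le_tauPrev (fun i => d i ω) s
      simp only [Set.mem_ofPred_eq] at h4
      push_cast at h4
      omega
    rw [h2, h2, measureReal_empty, zero_add, zero_add] at h1
    rw [h1, h2, measureReal_empty, mul_zero, zero_add]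
    congr 2
    push_cast; omega
  · have h2 := h.measureReal_inter_noArrival (l := l) (by omega) hH
    rw [hset, hset] at h2
    push_cast at h1 hjt ⊢
    simp only [add_sub_cancel_right] at h1 ⊢
    obtain ⟨e, he⟩ : ∃ e : ℕ, (t : ℤ) - l = e := ⟨((t : ℤ) - l).toNat, by omega⟩
    have h3 := c.Pbar_natCast e
    rw [he] at h2 ⊢
    rw [show (t : ℤ) - (l + 1) = e - 1 by omega] at h1
    rw [show (t : ℤ) - 1 - l = e - 1 by omega, Int.toNat_natCast]
    rw [h2, h3] at h1
    rw [h3]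
    linarith

/-- The identity for events says that two measures coincide on the σ-algebra `past`; hence so do the
integrals of functions measurable with respect to it. -/
lemma IsNoise.setLIntegral_tauPrev (h : c.IsNoise μ x₀ w d) {t : ℕ} {j : ℤ} (hj : -1 ≤ j)
    (hjt : j ≤ t) {f : Ω → ℝ≥0∞} (hf : Measurable[past x₀ w d t] f) :
    ∫⁻ ω in {ω | tauPrev (fun i => d i ω) (t + 1) = j}, f ω ∂μ =
      ENNReal.ofReal (c.p (t - j).toNat) *
          ∫⁻ ω in {ω | tauPrev (fun i => d i ω) t < j}, f ω ∂μ +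
        ENNReal.ofReal (c.Pbar (t - 1 - j)) *
          ∫⁻ ω in {ω | tauPrev (fun i => d i ω) t = j}, f ω ∂μ := by
  have hm := h.past_le t
  have hp := h.isProb
  have key : (μ.restrict {ω | tauPrev (fun i => d i ω) (t + 1) = j}).trim hm =
      (ENNReal.ofReal (c.p (t - j).toNat) • μ.restrict {ω | tauPrev (fun i => d i ω) t < j} +
        ENNReal.ofReal (c.Pbar (t - 1 - j)) •
          μ.restrict {ω | tauPrev (fun i => d i ω) t = j}).trim hm := by
    refine @Measure.ext _ (past x₀ w d t) _ _ fun H hH => ?_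
    have h1 := h.measureReal_tauPrev hj hjt hH
    rw [trim_measurableSet_eq hm hH, trim_measurableSet_eq hm hH, Measure.add_apply,
      Measure.smul_apply, Measure.smul_apply, Measure.restrict_apply (hm _ hH),
      Measure.restrict_apply (hm _ hH), Measure.restrict_apply (hm _ hH), smul_eq_mul, smul_eq_mul]
    have e : ∀ s, μ s = ENNReal.ofReal (μ.real s) := fun s => (ofReal_measureReal (μ := μ) (s := s)).symm
    simp only [e]
    rw [h1, ENNReal.ofReal_add (mul_nonneg (hp.nonneg _) measureReal_nonneg)
      (mul_nonneg (hp.Pbar_nonneg _) measureReal_nonneg), ENNReal.ofReal_mul (hp.nonneg _),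
      ENNReal.ofReal_mul (hp.Pbar_nonneg _)]
  rw [← lintegral_trim hm hf, key, lintegral_trim hm hf, lintegral_add_measure,
    lintegral_smul_measure, lintegral_smul_measure]
  rfl

lemma lintegral_index (μ : Measure Ω) {T : Ω → ℤ} (hT : Measurable T) {a b : ℤ}
    (ha : ∀ ω, a ≤ T ω) (hb : ∀ ω, T ω ≤ b) (f : Ω → ℝ≥0∞) :
    ∫⁻ ω, f ω ∂μ = ∑ j ∈ Finset.Icc a b, ∫⁻ ω in {ω | T ω = j}, f ω ∂μ := by
  rw [← lintegral_biUnion_finset]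
  · have : ⋃ j ∈ Finset.Icc a b, {ω | T ω = j} = Set.univ := by
      refine Set.eq_univ_of_forall fun ω => ?_
      simp only [Set.mem_iUnion]
      exact ⟨T ω, Finset.mem_Icc.2 ⟨ha ω, hb ω⟩, rfl⟩
    rw [this, setLIntegral_univ]
  · intro i _ j _ hij
    exact Set.disjoint_left.2 fun ω h1 h2 => hij (h1.symm.trans h2)
  · exact fun j _ => hT (measurableSet_singleton j)

/-- The transition of the Markov chain of the newest arrived signals. -/
theorem IsNoise.lintegral_tauPrev (h : c.IsNoise μ x₀ w d) {t : ℕ} {g : ℤ → Ω → ℝ}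
    (hg : ∀ j : ℤ, -1 ≤ j → j ≤ t → Measurable[past x₀ w d t] (g j)) (hg0 : ∀ j ω, 0 ≤ g j ω) :
    ∫⁻ ω, ENNReal.ofReal (g (tauPrev (fun i => d i ω) (t + 1)) ω) ∂μ =
      ∫⁻ ω, ENNReal.ofReal (c.avg t (tauPrev (fun i => d i ω) t) 0 fun j => g j ω) ∂μ := by
  have hp := h.isProb
  have hgm : ∀ j : ℤ, -1 ≤ j → j ≤ t → Measurable (g j) := fun j h1 h2 =>
    (hg j h1 h2).mono (h.past_le t) le_rfl
  have hT := h.measurable_tauPrev t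
  set T : Ω → ℤ := fun ω => tauPrev (fun i => d i ω) t with hTdef
  have h1 : ∀ j ∈ Finset.Icc (-1 : ℤ) t,
      ∫⁻ ω in {ω | tauPrev (fun i => d i ω) (t + 1) = j},
        ENNReal.ofReal (g (tauPrev (fun i => d i ω) (t + 1)) ω) ∂μ =
      ∫⁻ ω, ({ω | T ω < j}.indicator (fun ω => ENNReal.ofReal (c.p (t - j).toNat * g j ω)) ω +
        {ω | T ω = j}.indicator (fun ω => ENNReal.ofReal (c.Pbar (t - 1 - j) * g j ω)) ω) ∂μ := by
    intro j hj
    have hj := Finset.mem_Icc.1 hj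
    have hs1 : MeasurableSet {ω | T ω < j} := hT measurableSet_Iio
    have hs2 : MeasurableSet {ω | T ω = j} := hT (measurableSet_singleton j)
    have hs : MeasurableSet {ω | tauPrev (fun i => d i ω) (t + 1) = j} :=
      h.measurable_tauPrev (t + 1) (measurableSet_singleton j)
    have h2 : ∫⁻ ω in {ω | tauPrev (fun i => d i ω) (t + 1) = j},
        ENNReal.ofReal (g (tauPrev (fun i => d i ω) (t + 1)) ω) ∂μ =
        ∫⁻ ω in {ω | tauPrev (fun i => d i ω) (t + 1) = j}, ENNReal.ofReal (g j ω) ∂μ := by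
      refine setLIntegral_congr_fun hs fun ω hω => ?_
      have hω : tauPrev (fun i => d i ω) (t + 1) = j := hω
      simp only [hω]
    rw [h2,
      h.setLIntegral_tauPrev hj.1 hj.2 ((hg j hj.1 hj.2).ennreal_ofReal), lintegral_add_left,
      lintegral_indicator hs1, lintegral_indicator hs2]
    · simp only [ENNReal.ofReal_mul (hp.nonneg _), ENNReal.ofReal_mul (hp.Pbar_nonneg _)]
      rw [lintegral_const_mul _ (hgm j hj.1 hj.2).ennreal_ofReal,
        lintegral_const_mul _ (hgm j hj.1 hj.2).ennreal_ofReal]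
    · exact Measurable.indicator ((hgm j hj.1 hj.2).const_mul _).ennreal_ofReal hs1
  rw [lintegral_index μ (h.measurable_tauPrev (t + 1)) (a := -1) (b := t)
    (fun ω => neg_one_le_tauPrev _ _) (fun ω => by
      have := tauPrev_lt (fun i => d i ω) (t + 1); push_cast at this; omega),
    Finset.sum_congr rfl h1, ← lintegral_finsetSum]
  · refine lintegral_congr fun ω => ?_
    have h2 := neg_one_le_tauPrev (fun i => d i ω) t
    have h3 := tauPrev_lt (fun i => d i ω) t
    change -1 ≤ T ω at h2
    change T ω < t at h3
    rw [Finset.sum_add_distrib, avg, ENNReal.ofReal_add, ENNReal.ofReal_sum_of_nonneg]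
    · congr 1
      · rw [show (t : ℤ) - (0 : ℕ) = t by simp]
        refine (Finset.sum_subset (s₁ := Finset.Icc (T ω + 1) t) (Finset.Icc_subset_Icc_left (by omega)) ?_).symm.trans ?_
        · intro j hj hj'
          rw [Set.indicator_of_notMem]
          simp only [Finset.mem_Icc] at hj hj'
          simp only [Set.mem_ofPred_eq]
          omega
        · refine Finset.sum_congr rfl fun j hj => ?_
          rw [Set.indicator_of_mem]
          · rfl
          · have hj : tauPrev (fun i => d i ω) t + 1 ≤ j := (Finset.mem_Icc.1 hj).1
            change T ω + 1 ≤ j at hj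
            simp only [Set.mem_ofPred_eq]
            omega
      · rw [Finset.sum_eq_single (T ω)]
        · rw [Set.indicator_of_mem]
          · rfl
          · rfl
        · intro j _ hj
          rw [Set.indicator_of_notMem]
          exact fun h => hj h.symm
        · intro hj
          exact absurd (Finset.mem_Icc.2 ⟨h2, h3.le⟩) hj
    · intro j _; exact mul_nonneg (hp.nonneg _) (hg0 _ _)
    · exact Finset.sum_nonneg fun j _ => mul_nonneg (hp.nonneg _) (hg0 _ _)
    · exact mul_nonneg (hp.Pbar_nonneg _) (hg0 _ _)
  · intro j hj
    have hj := Finset.mem_Icc.1 hj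
    have hs1 : MeasurableSet {ω | T ω < j} := hT measurableSet_Iio
    have hs2 : MeasurableSet {ω | T ω = j} := hT (measurableSet_singleton j)
    exact (Measurable.indicator ((hgm j hj.1 hj.2).const_mul _).ennreal_ofReal hs1).add
      (Measurable.indicator ((hgm j hj.1 hj.2).const_mul _).ennreal_ofReal hs2)

end HoldLQ

end

/-! ### Measurability of the forms and integration over the noise. -/

noncomputable section

namespace HoldLQ

variable {α : Type*} {mα : MeasurableSpace α}

lemma measurable_bilin {E : Type*} [NormedAddCommGroup E] [NormedSpace ℝ E]
    [FiniteDimensional ℝ E] [MeasurableSpace E] [OpensMeasurableSpace E]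
    (V : LinearMap.BilinForm ℝ E) {f g : α → E} (hf : Measurable f) (hg : Measurable g) :
    Measurable fun a => V (f a) (g a) := by
  let b := Module.finBasis ℝ E
  have h1 : ∀ i, Measurable (b.coord i) := fun i =>
    (LinearMap.continuous_of_finiteDimensional (b.coord i)).measurable
  have h2 : ∀ x y, V x y = ∑ i, ∑ j, b.coord i x * (b.coord j y * V (b i) (b j)) := by
    intro x y
    conv_lhs => rw [← b.sum_repr x, ← b.sum_repr y]
    simp only [map_sum, LinearMap.sum_apply, map_smul, LinearMap.smul_apply, smul_eq_mul,
      Finset.mul_sum, b.coord_apply]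
    rw [Finset.sum_comm]
    exact Finset.sum_congr rfl fun i _ => Finset.sum_congr rfl fun j _ => mul_left_comm _ _ _
  rw [funext fun a => h2 (f a) (g a)]
  refine Finset.measurable_sum _ fun i _ => Finset.measurable_sum _ fun j _ => ?_
  exact ((h1 i).comp hf).mul (((h1 j).comp hg).mul_const _)

lemma measurable_dotProduct {r : ℕ} {f g : α → Fin r → ℝ} (hf : Measurable f) (hg : Measurable g) :
    Measurable fun a => f a ⬝ᵥ g a :=
  Finset.measurable_sum _ fun i _ =>
    ((measurable_pi_apply i).comp hf).mul ((measurable_pi_apply i).comp hg)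

lemma measurable_mulVec {r s : ℕ} (X : Matrix (Fin r) (Fin s) ℝ) {f : α → Fin s → ℝ}
    (hf : Measurable f) : Measurable fun a => X *ᵥ f a :=
  measurable_pi_lambda _ fun _ => measurable_dotProduct measurable_const hf

lemma measurable_quad {r : ℕ} (X : Matrix (Fin r) (Fin r) ℝ) {f : α → Fin r → ℝ}
    (hf : Measurable f) : Measurable fun a => f a ⬝ᵥ X *ᵥ f a :=
  measurable_dotProduct hf (measurable_mulVec X hf)

variable {n m : ℕ} {c : HoldLQ n m}

/-- Only the controls of the times in `s` and the state are kept. -/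
def extend (s : Finset ℤ) : (s → Fin m → ℝ) × (Fin n → ℝ) →ₗ[ℝ] Ext n m :=
  LinearMap.prodMap
    (LinearMap.pi fun l => if h : l ∈ s then LinearMap.proj (⟨l, h⟩ : s) else 0) LinearMap.id

lemma extend_fst (s : Finset ℤ) (y : (s → Fin m → ℝ) × (Fin n → ℝ)) {l : ℤ} (h : l ∈ s) :
    (extend s y).1 l = y.1 ⟨l, h⟩ := by
  simp [extend, h]

lemma IsWeight.Val_congr (hw : c.IsWeight) (k : ℕ) {τ : ℤ} (hτ : τ ≤ c.N - k)
    {ζ ζ' η η' : Ext n m} (h : ∀ l, τ ≤ l → l ≤ c.N - k → ζ.1 l = η.1 l) (h2 : ζ.2 = η.2)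
    (h' : ∀ l, τ ≤ l → l ≤ c.N - k → ζ'.1 l = η'.1 l) (h2' : ζ'.2 = η'.2) :
    c.Val k τ ζ ζ' = c.Val k τ η η' := by
  have e1 := hw.Val_eq_zero_left k τ hτ (ζ - η) ζ'
    (fun l h1 h3 => by simp [h l h1 h3]) (by simp [h2])
  have e2 := c.Val_eq_zero_right k τ hτ η (ζ' - η')
    (fun l h1 h3 => by simp [h' l h1 h3]) (by simp [h2'])
  rw [LinearMap.map_sub₂, sub_eq_zero] at e1
  rw [map_sub, sub_eq_zero] at e2
  exact e1.trans e2

/-- `Ext` is infinite dimensional, but `Val k τ` factors through the state and the finitely many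
controls of the times `τ, …, N-k`, where a bilinear form is measurable. -/
lemma IsWeight.measurable_Val (hw : c.IsWeight) (k : ℕ) {τ : ℤ} (hτ : τ ≤ c.N - k)
    {f g : α → Ext n m}
    (hf : ∀ l, τ ≤ l → l ≤ c.N - k → Measurable fun a => (f a).1 l)
    (hf2 : Measurable fun a => (f a).2)
    (hg : ∀ l, τ ≤ l → l ≤ c.N - k → Measurable fun a => (g a).1 l)
    (hg2 : Measurable fun a => (g a).2) :
    Measurable fun a => c.Val k τ (f a) (g a) := by
  let s := Finset.Icc τ (c.N - k)
  let r : Ext n m → (s → Fin m → ℝ) × (Fin n → ℝ) := fun ζ => (fun l => ζ.1 l, ζ.2)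
  have h1 : ∀ ζ : Ext n m, ∀ l, τ ≤ l → l ≤ c.N - k → ζ.1 l = (extend s (r ζ)).1 l := by
    intro ζ l h1 h2
    rw [extend_fst s _ (Finset.mem_Icc.2 ⟨h1, h2⟩)]
  have h2 : (fun a => c.Val k τ (f a) (g a)) = fun a =>
      (c.Val k τ).compl₁₂ (extend s) (extend s) (r (f a)) (r (g a)) := by
    ext a
    rw [LinearMap.compl₁₂_apply]
    exact hw.Val_congr k hτ (h1 _) rfl (h1 _) rfl
  rw [h2]
  refine measurable_bilin _ (Measurable.prodMk ?_ hf2) (Measurable.prodMk ?_ hg2)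
  · refine measurable_pi_lambda _ fun l => ?_
    have := Finset.mem_Icc.1 l.2
    exact hf l this.1 this.2
  · refine measurable_pi_lambda _ fun l => ?_
    have := Finset.mem_Icc.1 l.2
    exact hg l this.1 this.2

variable (c) in
lemma measurable_gap (k : ℕ) {τ : ℤ} {f : α → Ext n m}
    (hf : ∀ l, τ ≤ l → l ≤ c.N - k - 1 → Measurable fun a => (f a).1 l)
    (hf1 : Measurable fun a => (f a).1 (c.N - k))
    (hf2 : Measurable fun a => (f a).2) : Measurable fun a => c.gap k τ (f a) := by
  simp only [gap_apply, A12_apply]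
  refine hf1.add (measurable_mulVec _ (Measurable.add ?_ (measurable_mulVec _ hf2)))
  refine Finset.measurable_sum _ fun l hl => ?_
  have hl := Finset.mem_Icc.1 hl
  exact measurable_mulVec _ (hf l hl.1 hl.2)

variable {Ω : Type*} [mΩ : MeasurableSpace Ω] {μ : Measure Ω}

lemma integrable_dotProduct_mulVec {r : ℕ} (X : Matrix (Fin r) (Fin r) ℝ) {f : Ω → Fin r → ℝ}
    (hf : MemLp f 2 μ) : Integrable (fun ω => f ω ⬝ᵥ X *ᵥ f ω) μ := by
  simp only [dotProduct, mulVec, Finset.mul_sum]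
  refine integrable_finsetSum _ fun i _ => integrable_finsetSum _ fun j _ => ?_
  have := ((hf.eval i).integrable_mul (hf.eval j)).const_mul (X i j)
  refine this.congr (ae_of_all _ fun ω => ?_)
  simp only [Pi.mul_apply]; ring

variable [IsProbabilityMeasure μ]

lemma integrable_const_dotProduct {r : ℕ} (y : Fin r → ℝ) {f : Ω → Fin r → ℝ}
    (hf : MemLp f 2 μ) : Integrable (fun ω => y ⬝ᵥ f ω) μ := by
  simp only [dotProduct]
  exact integrable_finsetSum _ fun i _ => ((hf.eval i).integrable (by norm_num)).const_mul (y i)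

lemma integral_const_dotProduct {r : ℕ} (y : Fin r → ℝ) {f : Ω → Fin r → ℝ}
    (hf : MemLp f 2 μ) : ∫ ω, y ⬝ᵥ f ω ∂μ = y ⬝ᵥ ∫ ω, f ω ∂μ := by
  have h1 : ∀ i, Integrable (fun ω => f ω i) μ := fun i => (hf.eval i).integrable (by norm_num)
  simp only [dotProduct]
  rw [integral_finsetSum _ fun i _ => (h1 i).const_mul (y i)]
  refine Finset.sum_congr rfl fun i _ => ?_
  rw [integral_const_mul, eval_integral h1]

/-- The expectation over an independent centered noise. -/
lemma lintegral_noise {r : ℕ} {a : Ω → ℝ} {b e : Ω → Fin r → ℝ} (X : Matrix (Fin r) (Fin r) ℝ)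
    (ha : Measurable a) (hb : Measurable b) (he : Measurable e) (he2 : MemLp e 2 μ)
    (he0 : ∫ ω, e ω ∂μ = 0) (hind : IndepFun (fun ω => (a ω, b ω)) e μ)
    (hpos : ∀ ω y, 0 ≤ a ω + b ω ⬝ᵥ y + y ⬝ᵥ X *ᵥ y) :
    ∫⁻ ω, ENNReal.ofReal (a ω + b ω ⬝ᵥ e ω + e ω ⬝ᵥ X *ᵥ e ω) ∂μ =
      ∫⁻ ω, ENNReal.ofReal (a ω + ∫ ω', e ω' ⬝ᵥ X *ᵥ e ω' ∂μ) ∂μ := by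
  have hab := ha.prodMk hb
  let F : (ℝ × (Fin r → ℝ)) × (Fin r → ℝ) → ℝ≥0∞ := fun y =>
    ENNReal.ofReal (y.1.1 + y.1.2 ⬝ᵥ y.2 + y.2 ⬝ᵥ X *ᵥ y.2)
  have hF : Measurable F :=
    (((measurable_fst.comp measurable_fst).add
      (measurable_dotProduct (measurable_snd.comp measurable_fst) measurable_snd)).add
        (measurable_quad X measurable_snd)).ennreal_ofReal
  have h1 : ∫⁻ ω, ENNReal.ofReal (a ω + b ω ⬝ᵥ e ω + e ω ⬝ᵥ X *ᵥ e ω) ∂μ =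
      ∫⁻ y, F y ∂(μ.map fun ω => ((a ω, b ω), e ω)) := by
    rw [lintegral_map hF (hab.prodMk he)]
  -- Tonelli on the product law, with the noise as inner variable: `a` and `b` need not be
  -- integrable, since they are frozen in the inner integral.
  rw [h1, (indepFun_iff_map_prod_eq_prod_map_map hab.aemeasurable he.aemeasurable).1 hind,
    lintegral_prod _ hF.aemeasurable, lintegral_map hF.lintegral_prod_right' hab]
  refine lintegral_congr fun ω => ?_
  rw [lintegral_map (f := fun y => F ((a ω, b ω), y)) (hF.comp measurable_prodMk_left) he]
  simp only [F]
  have i1 := integrable_const_dotProduct (b ω) he2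
  have i2 := integrable_dotProduct_mulVec X he2
  have i3 : Integrable (fun ω' => a ω + b ω ⬝ᵥ e ω') μ := (integrable_const _).add i1
  have i4 : Integrable (fun ω' => a ω + b ω ⬝ᵥ e ω' + e ω' ⬝ᵥ X *ᵥ e ω') μ := i3.add i2
  rw [← ofReal_integral_eq_lintegral_ofReal i4 (ae_of_all _ fun ω' => hpos ω (e ω'))]
  congr 1
  rw [integral_add i3 i2, integral_add (integrable_const _) i1,
    integral_const_dotProduct _ he2, he0]
  simp

end HoldLQ

end

/-! ### Trajectories, deviation costs and adaptedness. -/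

noncomputable section

namespace HoldLQ

variable {n m : ℕ} {c : HoldLQ n m}

lemma dotProduct_apply_single {r : ℕ} (f : (Fin r → ℝ) →ₗ[ℝ] ℝ) (y : Fin r → ℝ) :
    f y = (fun i => f (Pi.single i 1)) ⬝ᵥ y := by
  conv_lhs => rw [pi_eq_sum_univ' y]
  simp only [map_sum, map_smul, smul_eq_mul, dotProduct, mul_comm]

/-- The slope of the cost-to-go with respect to the state. -/
def slope (c : HoldLQ n m) (k : ℕ) (τ : ℤ) (ζ : Ext n m) : Fin n → ℝ :=
  fun i => 2 * c.Val k τ ζ (pt (Pi.single i 1))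

lemma IsWeight.Val_pt (hw : c.IsWeight) (hc : c.IsProb) (k : ℕ) {τ : ℤ} (hτ : τ ≤ c.N - k)
    (y : Fin n → ℝ) : c.Val k τ (pt y) (pt y) = y ⬝ᵥ c.Sg k *ᵥ y := by
  have := (hw.blocks hc k).xx (c.N - k - τ).toNat y y
  rwa [Int.toNat_of_nonneg (by omega), sub_sub_cancel] at this

lemma IsWeight.Val_add_pt (hw : c.IsWeight) (hc : c.IsProb) (k : ℕ) {τ : ℤ} (hτ : τ ≤ c.N - k)
    (ζ : Ext n m) (y : Fin n → ℝ) : c.Val k τ (ζ + pt y) (ζ + pt y) =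
      c.Val k τ ζ ζ + c.slope k τ ζ ⬝ᵥ y + y ⬝ᵥ c.Sg k *ᵥ y := by
  have h1 : c.slope k τ ζ ⬝ᵥ y = 2 * c.Val k τ ζ (pt y) := by
    have := dotProduct_apply_single ((c.Val k τ ζ) ∘ₗ pt) y
    simp only [LinearMap.comp_apply] at this
    rw [this, ← smul_eq_mul, ← smul_dotProduct]
    rfl
  rw [LinearMap.map_add₂, map_add, map_add, hw.Val_pt hc k hτ, h1, hw.Val_comm k τ (pt y) ζ]
  ring

variable {Ω : Type*}

/-- The sending time of the newest signal that has arrived before time `t`. -/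
def tau (d : ℕ → Ω → ℕ∞) (t : ℕ) (ω : Ω) : ℤ := tauPrev (fun i => d i ω) t

lemma neg_one_le_tau (d : ℕ → Ω → ℕ∞) (t : ℕ) (ω : Ω) : -1 ≤ tau d t ω := neg_one_le_tauPrev _ _

lemma tau_lt (d : ℕ → Ω → ℕ∞) (t : ℕ) (ω : Ω) : tau d t ω < t := tauPrev_lt _ _

/-- The record of the controls, and the state of time `t`. -/
def traj (c : HoldLQ n m) (x₀ : Ω → Fin n → ℝ) (w : ℕ → Ω → Fin n → ℝ) (d : ℕ → Ω → ℕ∞)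
    (u₀ : Fin m → ℝ) (v : ℕ → Ω → Fin m → ℝ) (t : ℕ) (ω : Ω) : Ext n m :=
  (record u₀ (fun i => v i ω),
    c.state (x₀ ω) (fun l => w l ω) (fun l => d l ω) u₀ (fun l => v l ω) t)

/-- The cost before time `t`. -/
def pastCost (c : HoldLQ n m) (x₀ : Ω → Fin n → ℝ) (w : ℕ → Ω → Fin n → ℝ) (d : ℕ → Ω → ℕ∞)
    (u₀ : Fin m → ℝ) (v : ℕ → Ω → Fin m → ℝ) (t : ℕ) (ω : Ω) : ℝ :=
  ∑ i ∈ Finset.range t, (record u₀ (fun l => v l ω) (tau d (i + 1) ω) ⬝ᵥ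
      c.R *ᵥ record u₀ (fun l => v l ω) (tau d (i + 1) ω) +
    (c.traj x₀ w d u₀ v i ω).2 ⬝ᵥ c.Q *ᵥ (c.traj x₀ w d u₀ v i ω).2)

variable {x₀ : Ω → Fin n → ℝ} {w : ℕ → Ω → Fin n → ℝ} {d : ℕ → Ω → ℕ∞} {u₀ : Fin m → ℝ}
  {v : ℕ → Ω → Fin m → ℝ}

lemma traj_fst (t : ℕ) (ω : Ω) (j : ℤ) :
    (c.traj x₀ w d u₀ v t ω).1 j = record u₀ (fun i => v i ω) j := rfl

lemma traj_succ (t : ℕ) (ω : Ω) : c.traj x₀ w d u₀ v (t + 1) ω =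
    c.nextState (tau d (t + 1) ω) (c.traj x₀ w d u₀ v t ω) + pt (w t ω) := by
  ext1
  · simp [traj, nextState_apply, pt]
  · simp only [traj, nextState_apply, pt, Prod.snd_add, LinearMap.inr_apply, state]
    rfl

lemma IsWeight.pastCost_nonneg (hw : c.IsWeight) (t : ℕ) (ω : Ω) :
    0 ≤ c.pastCost x₀ w d u₀ v t ω :=
  Finset.sum_nonneg fun _ _ => add_nonneg (dotProduct_mulVec_nonneg hw.R.posSemidef _)
    (dotProduct_mulVec_nonneg hw.Q _)

lemma pastCost_succ (t : ℕ) (ω : Ω) : c.pastCost x₀ w d u₀ v (t + 1) ω =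
    c.pastCost x₀ w d u₀ v t ω + (record u₀ (fun l => v l ω) (tau d (t + 1) ω) ⬝ᵥ
        c.R *ᵥ record u₀ (fun l => v l ω) (tau d (t + 1) ω) +
      (c.traj x₀ w d u₀ v t ω).2 ⬝ᵥ c.Q *ᵥ (c.traj x₀ w d u₀ v t ω).2) :=
  Finset.sum_range_succ _ _

lemma pathCost_eq (ω : Ω) :
    c.pathCost (x₀ ω) (fun i => w i ω) (fun i => d i ω) u₀ (fun i => v i ω) =
      c.pastCost x₀ w d u₀ v (c.N + 1) ω +
        c.Val 0 (tau d (c.N + 1) ω) (c.traj x₀ w d u₀ v (c.N + 1) ω)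
          (c.traj x₀ w d u₀ v (c.N + 1) ω) := by
  rw [Val_zero, pastCost, Finset.sum_add_distrib]
  rfl

/-- The gap is the deviation from the feedback law. -/
lemma gap_traj {k : ℕ} (hk : k ≤ c.N) (ω : Ω) :
    c.gap k (tau d (c.N - k) ω) (c.traj x₀ w d u₀ v (c.N - k) ω) = v (c.N - k) ω -
      c.feedback (x₀ ω) (fun i => w i ω) (fun i => d i ω) u₀ (fun i => v i ω) k := by
  have h1 := tau_lt d (c.N - k) ω
  have e : (c.N : ℤ) - k = (c.N - k : ℕ) := by omega
  rw [gap_apply, c.A12_eq k (by omega), feedback, sub_neg_eq_add, traj_fst, e]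
  congr 1

/-- The cost of the deviation from the feedback law at time `t = N-k`. -/
def gapCost (c : HoldLQ n m) (x₀ : Ω → Fin n → ℝ) (w : ℕ → Ω → Fin n → ℝ) (d : ℕ → Ω → ℕ∞)
    (u₀ : Fin m → ℝ) (v : ℕ → Ω → Fin m → ℝ) (k t : ℕ) (ω : Ω) : ℝ :=
  c.gap k (tau d t ω) (c.traj x₀ w d u₀ v t ω) ⬝ᵥ
    c.A11 k *ᵥ c.gap k (tau d t ω) (c.traj x₀ w d u₀ v t ω)

lemma IsWeight.gapCost_eq_zero_iff (hw : c.IsWeight) (hc : c.IsProb) {k : ℕ} (hk : k ≤ c.N)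
    (hP : 0 < c.P k) (ω : Ω) : c.gapCost x₀ w d u₀ v k (c.N - k) ω = 0 ↔ v (c.N - k) ω =
      c.feedback (x₀ ω) (fun i => w i ω) (fun i => d i ω) u₀ (fun i => v i ω) k := by
  have hA := hw.A11_posDef hc k hP
  rw [gapCost, gap_traj hk, ← sub_eq_zero (a := v (c.N - k) ω)]
  constructor
  · intro h
    by_contra h1
    have := hA.dotProduct_mulVec_pos h1
    rw [star_trivial, h] at this
    exact lt_irrefl _ this
  · intro h
    rw [h, zero_dotProduct]

/-! ### Measurability -/

/-- The initial state, and the noises, arrivals and controls before time `t`, are known. -/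
structure Adapted (mα : MeasurableSpace Ω) (x₀ : Ω → Fin n → ℝ) (w : ℕ → Ω → Fin n → ℝ)
    (d : ℕ → Ω → ℕ∞) (v : ℕ → Ω → Fin m → ℝ) (t : ℕ) : Prop where
  x₀ : Measurable x₀
  w : ∀ i < t, Measurable (w i)
  tau : ∀ i ≤ t, Measurable (tau d i)
  v : ∀ i < t, Measurable (v i)

lemma Adapted.mono {mα : MeasurableSpace Ω} {t s : ℕ} (h : Adapted mα x₀ w d v t) (hs : s ≤ t) :
    Adapted mα x₀ w d v s :=
  ⟨h.x₀, fun i hi => h.w i (hi.trans_le hs), fun i hi => h.tau i (hi.trans hs),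
    fun i hi => h.v i (hi.trans_le hs)⟩

lemma Adapted.of_le {m₁ m₂ : MeasurableSpace Ω} {t : ℕ} (h : Adapted m₁ x₀ w d v t)
    (hm : m₁ ≤ m₂) : Adapted m₂ x₀ w d v t :=
  ⟨h.x₀.mono hm le_rfl, fun i hi => (h.w i hi).mono hm le_rfl,
    fun i hi => (h.tau i hi).mono hm le_rfl, fun i hi => (h.v i hi).mono hm le_rfl⟩

lemma measurable_record {mα : MeasurableSpace Ω} {t : ℕ} (hv : ∀ i < t, Measurable (v i))
    {j : ℤ} (hj : j < t) : Measurable fun ω => record u₀ (fun i => v i ω) j := by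
  unfold record
  split_ifs with h
  · exact measurable_const
  · exact hv _ (by omega)

lemma measurable_input {mα : MeasurableSpace Ω} {t : ℕ} (hv : ∀ i < t + 1, Measurable (v i))
    (hT : Measurable (HoldLQ.tau d (t + 1))) :
    Measurable fun ω => record u₀ (fun l => v l ω) (HoldLQ.tau d (t + 1) ω) :=
  measurable_index (g := fun j ω => record u₀ (fun l => v l ω) j) hT
    (neg_one_le_tau d (t + 1)) (b := t) (fun ω => by
      have := tau_lt d (t + 1) ω; push_cast at this; omega)
    fun j _ hj => measurable_record hv (by push_cast; omega)

lemma Adapted.input {mα : MeasurableSpace Ω} {t : ℕ} (h : Adapted mα x₀ w d v t) {i : ℕ}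
    (hi : i < t) : Measurable fun ω => record u₀ (fun l => v l ω) (HoldLQ.tau d (i + 1) ω) :=
  measurable_input (fun l hl => h.v l (by omega)) (h.tau (i + 1) hi)

lemma Adapted.state {mα : MeasurableSpace Ω} {t : ℕ} (h : Adapted mα x₀ w d v t) :
    Measurable fun ω => (c.traj x₀ w d u₀ v t ω).2 := by
  induction t with
  | zero => exact h.x₀
  | succ t ih =>
    have h1 := ih (h.mono (Nat.le_succ t))
    have h2 := h.input (u₀ := u₀) (Nat.lt_succ_self t)
    exact ((measurable_mulVec c.A h1).add (measurable_mulVec c.B h2)).add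
      (h.w t (Nat.lt_succ_self t))

lemma Adapted.pastCost {mα : MeasurableSpace Ω} {t : ℕ} (h : Adapted mα x₀ w d v t) :
    Measurable (c.pastCost x₀ w d u₀ v t) := by
  refine Finset.measurable_sum _ fun i hi => ?_
  have hi := Finset.mem_range.1 hi
  exact (measurable_quad _ (h.input hi)).add (measurable_quad _ (h.mono hi.le).state)

lemma IsWeight.measurable_slope (hw : c.IsWeight) {mα : MeasurableSpace Ω} (k : ℕ) {τ : ℤ}
    (hτ : τ ≤ c.N - k) {f : Ω → Ext n m}
    (hf : ∀ l, τ ≤ l → l ≤ c.N - k → Measurable fun a => (f a).1 l)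
    (hf2 : Measurable fun a => (f a).2) : Measurable fun a => c.slope k τ (f a) :=
  measurable_pi_lambda _ fun _ => (hw.measurable_Val k hτ hf hf2 (fun _ _ _ => measurable_const)
    measurable_const).const_mul _

lemma acks_mono (d : ℕ → Ω → ℕ∞) {s t : ℕ} (hs : s ≤ t) : acks d s ≤ acks d t := by
  refine MeasurableSpace.generateFrom_mono ?_
  rintro _ ⟨i, j, hi, rfl⟩
  exact ⟨i, j, hi.trans_le hs, rfl⟩

lemma past_mono (x₀ : Ω → Fin n → ℝ) (w : ℕ → Ω → Fin n → ℝ) (d : ℕ → Ω → ℕ∞) {s t : ℕ}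
    (hs : s ≤ t) : past x₀ w d s ≤ past x₀ w d t := by
  refine sup_le_sup (biSup_mono ?_) (acks_mono d hs)
  rintro a (ha | ⟨i, hi, ha⟩)
  · exact Or.inl ha
  · exact Or.inr ⟨i, hi.trans_le hs, ha⟩

lemma adapted_past {t : ℕ} (hv : ∀ i < t, Measurable[past x₀ w d i] (v i)) :
    Adapted (past x₀ w d t) x₀ w d v t where
  x₀ := by
    refine measurable_iff_comap_le.2 (le_sup_of_le_left ?_)
    exact le_iSup₂_of_le (f := fun a _ => fam x₀ w d a) none (Or.inl rfl) le_rfl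
  w i hi := by
    refine measurable_iff_comap_le.2 (le_sup_of_le_left ?_)
    exact le_iSup₂_of_le (f := fun a _ => fam x₀ w d a) (some (i, false))
      (Or.inr ⟨i, hi, rfl⟩) le_rfl
  tau i hi := (measurable_tauPrev d i).mono
    ((acks_mono d hi).trans (acks_le_past x₀ w d t)) le_rfl
  v i hi := (hv i hi).mono (past_mono x₀ w d hi.le) le_rfl

/-- The controller's information contains states that depend on the control itself. By induction on
time these are functions of the initial state, the noises and the acknowledgements, so the
information lies in `past`, which is the same for all controls. -/
lemma Admissible.measurable_past (hv : c.Admissible x₀ w d u₀ v) {t : ℕ} (ht : t ≤ c.N) :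
    Measurable[past x₀ w d t] (v t) := by
  induction t using Nat.strong_induction_on with
  | _ t ih =>
    have h1 : ∀ i < t, Measurable[past x₀ w d i] (v i) := fun i hi => ih i hi (hi.le.trans ht)
    refine (hv t ht).mono (sup_le (iSup₂_le fun i hi => ?_) (acks_le_past x₀ w d t)) le_rfl
    exact Measurable.comap_le ((adapted_past h1).mono hi).state

lemma Admissible.adapted_past (hv : c.Admissible x₀ w d u₀ v) {t : ℕ} (ht : t ≤ c.N + 1) :
    Adapted (past x₀ w d t) x₀ w d v t :=
  HoldLQ.adapted_past fun _ hi => hv.measurable_past (by omega)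

/-- Everything but the noise of time `t`. -/
@[reducible] def others (x₀ : Ω → Fin n → ℝ) (w : ℕ → Ω → Fin n → ℝ) (d : ℕ → Ω → ℕ∞) (t : ℕ) :
    MeasurableSpace Ω :=
  ⨆ a ∈ {a | a ≠ some (t, false)}, fam x₀ w d a

lemma acks_le_others (x₀ : Ω → Fin n → ℝ) (w : ℕ → Ω → Fin n → ℝ) (d : ℕ → Ω → ℕ∞) (s t : ℕ) :
    acks d s ≤ others x₀ w d t := by
  refine MeasurableSpace.generateFrom_le ?_
  rintro _ ⟨i, j, _, rfl⟩
  refine le_iSup₂_of_le (f := fun a _ => fam x₀ w d a) (some (j, true)) ?_ le_rfl _ ?_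
  · simp
  · exact ⟨{x : ℕ∞ | x + (j : ℕ∞) ≤ (i : ℕ∞)}, MeasurableSet.of_discrete, rfl⟩

lemma past_le_others (x₀ : Ω → Fin n → ℝ) (w : ℕ → Ω → Fin n → ℝ) (d : ℕ → Ω → ℕ∞) (t : ℕ) :
    past x₀ w d t ≤ others x₀ w d t := by
  refine sup_le (biSup_mono ?_) (acks_le_others x₀ w d t t)
  rintro a (rfl | ⟨i, hi, rfl⟩)
  · simp
  · simpa using hi.ne

variable [mΩ : MeasurableSpace Ω] {μ : Measure Ω} [IsProbabilityMeasure μ]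

lemma IsNoise.others_le (h : c.IsNoise μ x₀ w d) (t : ℕ) : others x₀ w d t ≤ mΩ :=
  iSup₂_le fun a _ => h.fam_le a

lemma IsNoise.indepFun_others (h : c.IsNoise μ x₀ w d) {t : ℕ} {β : Type*} [MeasurableSpace β]
    {f : Ω → β} (hf : Measurable[others x₀ w d t] f) : IndepFun f (w t) μ := by
  rw [IndepFun_iff_Indep]
  have h1 : Indep (others x₀ w d t) (⨆ a ∈ {some (t, false)}, fam x₀ w d a) μ :=
    indep_iSup_of_disjoint (T := {some (t, false)}) h.fam_le h.iIndep_fam (by simp)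
  refine indep_of_indep_of_le_left (indep_of_indep_of_le_right h1 ?_) hf.comap_le
  exact le_iSup₂_of_le (f := fun a _ => fam x₀ w d a) (some (t, false)) rfl le_rfl

end HoldLQ

end

/-! ### The cost as minimal cost plus deviation costs. -/

noncomputable section

namespace HoldLQ

variable {n m : ℕ} {c : HoldLQ n m} {Ω : Type*} [mΩ : MeasurableSpace Ω] {μ : Measure Ω}
  [IsProbabilityMeasure μ] {x₀ : Ω → Fin n → ℝ} {w : ℕ → Ω → Fin n → ℝ} {d : ℕ → Ω → ℕ∞}
  {u₀ : Fin m → ℝ} {v : ℕ → Ω → Fin m → ℝ}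

/-- The expected cost of the noise of time `t = N-k`. -/
def noiseCost (c : HoldLQ n m) (μ : Measure Ω) (w : ℕ → Ω → Fin n → ℝ) (k t : ℕ) : ℝ :=
  ∫ ω, w t ω ⬝ᵥ c.Sg k *ᵥ w t ω ∂μ

lemma IsWeight.noiseCost_nonneg (hw : c.IsWeight) (hc : c.IsProb) (μ : Measure Ω)
    (w : ℕ → Ω → Fin n → ℝ) (k t : ℕ) : 0 ≤ c.noiseCost μ w k t :=
  integral_nonneg fun ω => by
    rw [← hw.Val_pt hc k le_rfl]
    exact hw.Val_nonneg hc k _ _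

variable (c) in
lemma avg_const_add {t τ : ℤ} (K : ℝ) (hτ : τ ≤ t) (f : ℤ → ℝ) :
    c.avg t τ 0 (fun j => K + f j) = K + c.avg t τ 0 f := by
  have h := c.avg_const (t := t) K (t - τ).toNat
  rw [Int.toNat_of_nonneg (by omega), sub_sub_cancel] at h
  conv_rhs => rw [← h]
  simp only [avg, smul_add, Finset.sum_add_distrib]
  abel

/-- The noise of time `t = N-k` is integrated out. -/
lemma IsNoise.lintegral_succ (h : c.IsNoise μ x₀ w d) (hw : c.IsWeight)
    (hv : c.Admissible x₀ w d u₀ v) {k t : ℕ} (hk : t + k = c.N) {κ : ℝ} (hκ : 0 ≤ κ) :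
    ∫⁻ ω, ENNReal.ofReal (c.pastCost x₀ w d u₀ v (t + 1) ω +
        c.Val k (tau d (t + 1) ω) (c.traj x₀ w d u₀ v (t + 1) ω)
          (c.traj x₀ w d u₀ v (t + 1) ω) + κ) ∂μ =
      ∫⁻ ω, ENNReal.ofReal (c.pastCost x₀ w d u₀ v (t + 1) ω +
        c.Val k (tau d (t + 1) ω) (c.nextState (tau d (t + 1) ω) (c.traj x₀ w d u₀ v t ω))
          (c.nextState (tau d (t + 1) ω) (c.traj x₀ w d u₀ v t ω)) +
            (κ + c.noiseCost μ w k t)) ∂μ := by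
  have hc := h.isProb
  have hkt : (c.N : ℤ) - k = t := by omega
  have hτ : ∀ ω, tau d (t + 1) ω ≤ c.N - k := fun ω => by
    have := tau_lt d (t + 1) ω; push_cast at this; omega
  let y : Ω → Ext n m := fun ω => c.nextState (tau d (t + 1) ω) (c.traj x₀ w d u₀ v t ω)
  let a : Ω → ℝ := fun ω => c.pastCost x₀ w d u₀ v (t + 1) ω +
    c.Val k (tau d (t + 1) ω) (y ω) (y ω) + κ
  let b : Ω → Fin n → ℝ := fun ω => c.slope k (tau d (t + 1) ω) (y ω)
  have hexp : ∀ ω e, c.pastCost x₀ w d u₀ v (t + 1) ω +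
      c.Val k (tau d (t + 1) ω) (y ω + pt e) (y ω + pt e) + κ =
        a ω + b ω ⬝ᵥ e + e ⬝ᵥ c.Sg k *ᵥ e := fun ω e => by
    rw [hw.Val_add_pt hc k (hτ ω)]; ring
  have hle := past_le_others x₀ w d t
  have hA : Adapted (others x₀ w d t) x₀ w d v t := (hv.adapted_past (by omega)).of_le hle
  have hvt : ∀ i < t + 1, Measurable[others x₀ w d t] (v i) := fun i hi =>
    (hv.measurable_past (by omega)).mono ((past_mono x₀ w d (by omega)).trans hle) le_rfl
  -- The input of time `t` depends on arrivals at time `t`, which are not in `past`. The σ-algebra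
  -- `others` contains all delays and omits only the noise of time `t`.
  have hT : Measurable[others x₀ w d t] (tau d (t + 1)) :=
    (HoldLQ.measurable_tauPrev d (t + 1)).mono (acks_le_others x₀ w d (t + 1) t) le_rfl
  have hy : Measurable[others x₀ w d t] fun ω => (y ω).2 :=
    (measurable_mulVec c.A hA.state).add (measurable_mulVec c.B (measurable_input hvt hT))
  have hcost : Measurable[others x₀ w d t] (c.pastCost x₀ w d u₀ v (t + 1)) := by
    change Measurable[others x₀ w d t] fun ω => c.pastCost x₀ w d u₀ v (t + 1) ω
    simp only [pastCost_succ]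
    exact hA.pastCost.add ((measurable_quad _ (measurable_input hvt hT)).add
      (measurable_quad _ hA.state))
  have hrec : ∀ l : ℤ, l ≤ c.N - k → Measurable[others x₀ w d t] fun ω => (y ω).1 l :=
    fun l hl => measurable_record hvt (by push_cast; omega)
  have hTt : ∀ ω, tau d (t + 1) ω ≤ t := fun ω => hkt ▸ hτ ω
  have hb : Measurable[others x₀ w d t] b := by
    refine measurable_index (g := fun j ω => c.slope k j (y ω)) hT (neg_one_le_tau d (t + 1)) hTt
      fun j _ hj => ?_
    exact hw.measurable_slope k (by omega) (fun l _ hl => hrec l hl) hy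
  have ha : Measurable[others x₀ w d t] a := by
    refine (hcost.add ?_).add measurable_const
    refine measurable_index (g := fun j ω => c.Val k j (y ω) (y ω)) hT (neg_one_le_tau d (t + 1))
      hTt fun j _ hj => ?_
    exact hw.measurable_Val k (by omega) (fun l _ hl => hrec l hl) hy (fun l _ hl => hrec l hl) hy
  have hm := h.others_le t
  have key := lintegral_noise (c.Sg k) (ha.mono hm le_rfl) (hb.mono hm le_rfl) (h.w_meas t)
    (h.w_memLp t) (h.w_mean t) (h.indepFun_others (ha.prodMk hb)) (fun ω e => by
      rw [← hexp]
      exact add_nonneg (add_nonneg (hw.pastCost_nonneg _ _) (hw.Val_nonneg hc _ _ _)) hκ)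
  calc _ = ∫⁻ ω, ENNReal.ofReal (a ω + b ω ⬝ᵥ w t ω + w t ω ⬝ᵥ c.Sg k *ᵥ w t ω) ∂μ := by
        refine lintegral_congr fun ω => ?_
        rw [← hexp, traj_succ]
    _ = _ := by
        rw [key]
        refine lintegral_congr fun ω => ?_
        rw [← add_assoc]
        rfl

/-- The expected cost, when the last input and the noise have been averaged. -/
lemma IsNoise.lintegral_step (h : c.IsNoise μ x₀ w d) (hw : c.IsWeight)
    (hv : c.Admissible x₀ w d u₀ v) {k t : ℕ} (hk : t + k = c.N) {κ : ℝ} (hκ : 0 ≤ κ) :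
    ∫⁻ ω, ENNReal.ofReal (c.pastCost x₀ w d u₀ v (t + 1) ω +
        c.Val k (tau d (t + 1) ω) (c.traj x₀ w d u₀ v (t + 1) ω)
          (c.traj x₀ w d u₀ v (t + 1) ω) + κ) ∂μ =
      ∫⁻ ω, ENNReal.ofReal (c.pastCost x₀ w d u₀ v t ω +
        c.Val (k + 1) (tau d t ω) (c.traj x₀ w d u₀ v t ω) (c.traj x₀ w d u₀ v t ω) +
          (κ + c.noiseCost μ w k t)) ∂μ +
        ∫⁻ ω, ENNReal.ofReal (c.gapCost x₀ w d u₀ v k t ω) ∂μ := by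
  have hc := h.isProb
  have hkt : (c.N : ℤ) - k = t := by omega
  have hA := hv.adapted_past (t := t) (by omega)
  have hvt : ∀ i < t + 1, Measurable[past x₀ w d t] (v i) := fun i hi =>
    (hv.measurable_past (by omega)).mono (past_mono x₀ w d (by omega)) le_rfl
  have hrec : ∀ l : ℤ, l ≤ t → Measurable[past x₀ w d t] fun ω =>
      (c.traj x₀ w d u₀ v t ω).1 l := fun l hl => measurable_record hvt (by push_cast; omega)
  have hκ' : 0 ≤ κ + c.noiseCost μ w k t := add_nonneg hκ (hw.noiseCost_nonneg hc μ w k t)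
  let C : Ω → ℝ := fun ω => c.pastCost x₀ w d u₀ v t ω + (κ + c.noiseCost μ w k t)
  have hC : ∀ ω, 0 ≤ C ω := fun ω => add_nonneg (hw.pastCost_nonneg _ _) hκ'
  let g : ℤ → Ω → ℝ := fun j ω => C ω +
    ((c.traj x₀ w d u₀ v t ω).2 ⬝ᵥ c.Q *ᵥ (c.traj x₀ w d u₀ v t ω).2 +
      ((c.traj x₀ w d u₀ v t ω).1 j ⬝ᵥ c.R *ᵥ (c.traj x₀ w d u₀ v t ω).1 j +
      c.Val k j (c.nextState j (c.traj x₀ w d u₀ v t ω))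
        (c.nextState j (c.traj x₀ w d u₀ v t ω))))
  have hg : ∀ j : ℤ, -1 ≤ j → j ≤ t → Measurable[past x₀ w d t] (g j) := by
    intro j _ hj
    refine (hA.pastCost.add measurable_const).add ((measurable_quad _ hA.state).add
      ((measurable_quad _ (hrec j hj)).add ?_))
    have h1 : Measurable[past x₀ w d t] fun ω =>
        (c.nextState j (c.traj x₀ w d u₀ v t ω)).2 :=
      (measurable_mulVec c.A hA.state).add (measurable_mulVec c.B (hrec j hj))
    exact hw.measurable_Val k (by omega) (fun l _ hl => hrec l (by omega)) h1
      (fun l _ hl => hrec l (by omega)) h1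
  have hg0 : ∀ j ω, 0 ≤ g j ω := fun j ω => add_nonneg (hC ω) (add_nonneg
    (dotProduct_mulVec_nonneg hw.Q _) (add_nonneg (dotProduct_mulVec_nonneg hw.R.posSemidef _)
      (hw.Val_nonneg hc _ _ _)))
  -- Once the terms independent of the newest signal are taken out, the average is `W`, and
  -- completing the square splits off the deviation cost.
  have hW : ∀ ω, c.avg t (tau d t ω) 0 (fun j => g j ω) =
      (c.pastCost x₀ w d u₀ v t ω + c.Val (k + 1) (tau d t ω) (c.traj x₀ w d u₀ v t ω)
        (c.traj x₀ w d u₀ v t ω) + (κ + c.noiseCost μ w k t)) + c.gapCost x₀ w d u₀ v k t ω := by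
    intro ω
    have h1 := tau_lt d t ω
    have h2 := hw.W_eq hc k (τ := tau d t ω) (by omega) (c.traj x₀ w d u₀ v t ω)
    rw [W_apply, hkt] at h2
    rw [c.avg_const_add _ h1.le, c.avg_const_add _ h1.le, ← add_assoc, add_assoc (C ω), h2]
    simp only [C, gapCost]
    ring
  rw [h.lintegral_succ hw hv hk hκ]
  calc _ = ∫⁻ ω, ENNReal.ofReal (g (tau d (t + 1) ω) ω) ∂μ := by
        refine lintegral_congr fun ω => ?_
        rw [pastCost_succ]
        congr 1
        simp only [g, C, traj_fst]
        ring
    _ = _ := by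
        refine (h.lintegral_tauPrev hg hg0).trans ?_
        change ∫⁻ ω, ENNReal.ofReal (c.avg t (tau d t ω) 0 fun j => g j ω) ∂μ = _
        simp only [hW]
        rw [← lintegral_add_left]
        · refine lintegral_congr fun ω => ENNReal.ofReal_add (add_nonneg (add_nonneg
            (hw.pastCost_nonneg _ _) (hw.Val_nonneg hc _ _ _)) hκ') ?_
          exact dotProduct_mulVec_nonneg (hw.A11_posSemidef hc k) _
        · refine Measurable.ennreal_ofReal (Measurable.mono ?_ (h.past_le t) le_rfl)
          refine (hA.pastCost.add ?_).add measurable_const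
          refine measurable_index (g := fun j ω => c.Val (k + 1) j (c.traj x₀ w d u₀ v t ω)
            (c.traj x₀ w d u₀ v t ω)) (hA.tau t le_rfl) (neg_one_le_tau d t) (b := t - 1)
            (fun ω => by have := tau_lt d t ω; omega) fun j _ hj => ?_
          exact hw.measurable_Val (k + 1) (by push_cast; omega)
            (fun l _ hl => hrec l (by push_cast at hl; omega)) hA.state
            (fun l _ hl => hrec l (by push_cast at hl; omega)) hA.state

/-- The expected cost, as the sum of the cost of the noises and initial data and the costs of the
deviations from the feedback law. -/
lemma IsNoise.J_eq_sum (h : c.IsNoise μ x₀ w d) (hw : c.IsWeight)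
    (hv : c.Admissible x₀ w d u₀ v) {k : ℕ} (hk : k ≤ c.N + 1) :
    c.J μ x₀ w d u₀ v = ∫⁻ ω, ENNReal.ofReal (c.pastCost x₀ w d u₀ v (c.N + 1 - k) ω +
        c.Val k (tau d (c.N + 1 - k) ω) (c.traj x₀ w d u₀ v (c.N + 1 - k) ω)
          (c.traj x₀ w d u₀ v (c.N + 1 - k) ω) +
          ∑ j ∈ Finset.range k, c.noiseCost μ w j (c.N - j)) ∂μ +
      ∑ j ∈ Finset.range k, ∫⁻ ω, ENNReal.ofReal (c.gapCost x₀ w d u₀ v j (c.N - j) ω) ∂μ := by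
  induction k with
  | zero =>
    simp only [Finset.range_zero, Finset.sum_empty, add_zero, Nat.sub_zero, J, pathCost_eq]
  | succ k ih =>
    have hk' : k ≤ c.N := by omega
    rw [ih (by omega), show c.N + 1 - k = c.N - k + 1 by omega,
      -- Here `κ` carries the noise costs already split off.
      h.lintegral_step hw hv (k := k) (by omega)
        (Finset.sum_nonneg fun j _ => hw.noiseCost_nonneg h.isProb μ w j _),
      Finset.sum_range_succ, Finset.sum_range_succ, show c.N + 1 - (k + 1) = c.N - k by omega,
      add_assoc, add_comm (∫⁻ ω, ENNReal.ofReal (c.gapCost x₀ w d u₀ v k (c.N - k) ω) ∂μ)]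

/-- The minimal cost. -/
def minCost (c : HoldLQ n m) (μ : Measure Ω) (x₀ : Ω → Fin n → ℝ) (w : ℕ → Ω → Fin n → ℝ)
    (u₀ : Fin m → ℝ) : ℝ≥0∞ :=
  ∫⁻ ω, ENNReal.ofReal (c.Val (c.N + 1) (-1) (lift (-1) u₀ + pt (x₀ ω)) (lift (-1) u₀ + pt (x₀ ω)) +
    ∑ j ∈ Finset.range (c.N + 1), c.noiseCost μ w j (c.N - j)) ∂μ

/-- The value is a quadratic polynomial in the square integrable `x₀`. -/
lemma IsNoise.minCost_lt_top (h : c.IsNoise μ x₀ w d) (hw : c.IsWeight) :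
    c.minCost μ x₀ w u₀ < ∞ := by
  refine Integrable.lintegral_lt_top (Integrable.add ?_ (integrable_const _))
  have h1 : ∀ ω, c.Val (c.N + 1) (-1) (lift (-1) u₀ + pt (x₀ ω)) (lift (-1) u₀ + pt (x₀ ω)) =
      c.Val (c.N + 1) (-1) (lift (-1) u₀) (lift (-1) u₀) +
        c.slope (c.N + 1) (-1) (lift (-1) u₀) ⬝ᵥ x₀ ω + x₀ ω ⬝ᵥ c.Sg (c.N + 1) *ᵥ x₀ ω :=
    fun ω => hw.Val_add_pt h.isProb (c.N + 1) (by push_cast; omega) _ _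
  simp only [h1]
  exact ((integrable_const _).add (integrable_const_dotProduct _ h.x₀_memLp)).add
    (integrable_dotProduct_mulVec _ h.x₀_memLp)

/-- The expected cost is the minimal cost plus the costs of the deviations from the feedback law. -/
theorem IsNoise.J_eq (h : c.IsNoise μ x₀ w d) (hw : c.IsWeight)
    (hv : c.Admissible x₀ w d u₀ v) : c.J μ x₀ w d u₀ v = c.minCost μ x₀ w u₀ +
      ∑ j ∈ Finset.range (c.N + 1),
        ∫⁻ ω, ENNReal.ofReal (c.gapCost x₀ w d u₀ v j (c.N - j) ω) ∂μ := by
  rw [h.J_eq_sum hw hv le_rfl, minCost]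
  congr 1
  refine lintegral_congr fun ω => ?_
  rw [Nat.sub_self]
  have h1 : tau d 0 ω = -1 := rfl
  have h2 : c.pastCost x₀ w d u₀ v 0 ω = 0 := rfl
  rw [h1, h2, zero_add]
  -- At the initial time the relevant indices shrink to `-1`, so only the initially held input and
  -- `x₀` enter; this is why the minimal cost does not depend on the control.
  have h3 : ∀ l : ℤ, -1 ≤ l → l ≤ c.N - (c.N + 1 : ℕ) →
      (c.traj x₀ w d u₀ v 0 ω).1 l = (lift (-1) u₀ + pt (x₀ ω) : Ext n m).1 l := by
    intro l hl hl'
    obtain rfl : l = -1 := by push_cast at hl'; omega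
    simp [traj_fst, record, lift_fst, pt_fst]
  have h4 : (c.traj x₀ w d u₀ v 0 ω).2 = (lift (-1) u₀ + pt (x₀ ω) : Ext n m).2 := by
    simp only [Prod.snd_add, lift_snd, pt_snd, zero_add]
    rfl
  rw [hw.Val_congr (c.N + 1) (by push_cast; omega) h3 h4 h3 h4]

/-- If `P(k) > 0`, the deviation cost is a positive definite form of the deviation and is zero
exactly where the law holds; if `P(k) = 0`, it is identically zero. -/
lemma IsNoise.lintegral_gapCost_eq_zero_iff (h : c.IsNoise μ x₀ w d) (hw : c.IsWeight)
    (hv : c.Admissible x₀ w d u₀ v) {k : ℕ} (hk : k ≤ c.N) :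
    ∫⁻ ω, ENNReal.ofReal (c.gapCost x₀ w d u₀ v k (c.N - k) ω) ∂μ = 0 ↔
      (0 < c.P k → ∀ᵐ ω ∂μ, v (c.N - k) ω =
        c.feedback (x₀ ω) (fun i => w i ω) (fun i => d i ω) u₀ (fun i => v i ω) k) := by
  have hc := h.isProb
  by_cases hP : 0 < c.P k
  · set t := c.N - k with ht
    have hkt : (c.N : ℤ) - k = t := by omega
    have hA := hv.adapted_past (t := t) (by omega)
    have hvt : ∀ i < t + 1, Measurable[past x₀ w d t] (v i) := fun i hi =>
      (hv.measurable_past (by omega)).mono (past_mono x₀ w d (by omega)) le_rfl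
    have hgap : Measurable[past x₀ w d t] fun ω => c.gap k (tau d t ω) (c.traj x₀ w d u₀ v t ω) := by
      refine measurable_index (g := fun j ω => c.gap k j (c.traj x₀ w d u₀ v t ω))
        (hA.tau t le_rfl) (neg_one_le_tau d t) (b := t)
        (fun ω => (tau_lt d t ω).le) fun j _ hj => ?_
      exact c.measurable_gap k (fun l _ hl => measurable_record hvt (by push_cast; omega))
        (measurable_record hvt (by push_cast; omega)) hA.state
    have hm : Measurable fun ω => ENNReal.ofReal (c.gapCost x₀ w d u₀ v k t ω) :=
      ((measurable_quad (c.A11 k) hgap).mono (h.past_le t) le_rfl).ennreal_ofReal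
    rw [lintegral_eq_zero_iff hm]
    simp only [hP, true_imp_iff]
    refine Filter.eventually_congr (ae_of_all _ fun ω => ?_)
    rw [ht, ← hw.gapCost_eq_zero_iff hc hk hP, Pi.zero_apply, ENNReal.ofReal_eq_zero]
    exact ⟨fun h1 => le_antisymm h1 (dotProduct_mulVec_nonneg (hw.A11_posSemidef hc k) _),
      le_of_eq⟩
  · have h0 : c.P k = 0 := le_antisymm (not_lt.1 hP) (hc.P_nonneg _)
    simp only [hP, false_imp_iff, iff_true]
    simp only [gapCost, hw.gap_eq_zero_of_P hc h0]
    simp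

end HoldLQ

end

/-! ### Existence and causality of the closed loop. -/

noncomputable section

namespace HoldLQ

variable {n m : ℕ} {c : HoldLQ n m}

section path

variable {x₀ : Fin n → ℝ} {w : ℕ → Fin n → ℝ} {d : ℕ → ℕ∞} {u₀ : Fin m → ℝ}
  {v v' : ℕ → Fin m → ℝ}

lemma record_congr {t : ℕ} (h : ∀ i < t, v i = v' i) {j : ℤ} (hj : j < t) :
    record u₀ v j = record u₀ v' j := by
  unfold record
  split_ifs
  · rfl
  · exact h _ (by omega)

lemma state_congr {t : ℕ} (h : ∀ i < t, v i = v' i) :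
    c.state x₀ w d u₀ v t = c.state x₀ w d u₀ v' t := by
  induction t with
  | zero => rfl
  | succ t ih =>
    rw [state, state, ih fun i hi => h i (by omega), input, input,
      record_congr h (tauPrev_lt d (t + 1))]

/-- The feedback uses only earlier controls, so the implicit law can be solved forward in time. -/
lemma feedback_congr {k : ℕ} (hk : k ≤ c.N) (h : ∀ i < c.N - k, v i = v' i) :
    c.feedback x₀ w d u₀ v k = c.feedback x₀ w d u₀ v' k := by
  have h1 := tauPrev_lt d (c.N - k)
  rw [feedback, feedback, c.A12zeta_eq k _ (by omega), c.A12zeta_eq k _ (by omega), state_congr h]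
  congr 3
  refine Finset.sum_congr rfl fun l hl => ?_
  have hl := Finset.mem_Icc.1 hl
  rw [record_congr h (by omega)]

variable (c x₀ w d u₀) in
/-- The controls of the feedback law, up to time `t`. -/
def loop : ℕ → ℕ → Fin m → ℝ
  | 0 => 0
  | t + 1 => Function.update (loop t) t (c.feedback x₀ w d u₀ (loop t) (c.N - t))

variable (c x₀ w d u₀) in
/-- The controls of the feedback law. -/
def law (t : ℕ) : Fin m → ℝ := c.loop x₀ w d u₀ (t + 1) t

lemma loop_eq_law {t i : ℕ} (h : i < t) : c.loop x₀ w d u₀ t i = c.law x₀ w d u₀ i := by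
  induction t with
  | zero => omega
  | succ t ih =>
    rcases Nat.lt_succ_iff_lt_or_eq.1 h with h1 | rfl
    · rw [loop, Function.update_of_ne h1.ne, ih h1]
    · rfl

lemma law_eq {k : ℕ} (hk : k ≤ c.N) :
    c.law x₀ w d u₀ (c.N - k) = c.feedback x₀ w d u₀ (c.law x₀ w d u₀) k := by
  rw [law, loop, Function.update_self, Nat.sub_sub_self hk]
  exact feedback_congr hk fun i hi => loop_eq_law hi

end path

variable {Ω : Type*} {x₀ : Ω → Fin n → ℝ} {w : ℕ → Ω → Fin n → ℝ} {d : ℕ → Ω → ℕ∞}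
  {u₀ : Fin m → ℝ} {v : ℕ → Ω → Fin m → ℝ}

variable (c x₀ w d u₀ v) in
lemma info_mono {s t : ℕ} (hs : s ≤ t) : c.info x₀ w d u₀ v s ≤ c.info x₀ w d u₀ v t :=
  sup_le_sup (biSup_mono fun _ hi => le_trans hi hs) (acks_mono d hs)

/-- The feedback law defines a causal control. -/
lemma admissible_of_feedback (hv : ∀ k ≤ c.N, ∀ ω, v (c.N - k) ω =
    c.feedback (x₀ ω) (fun i => w i ω) (fun i => d i ω) u₀ (fun i => v i ω) k) :
    c.Admissible x₀ w d u₀ v := by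
  intro t ht
  induction t using Nat.strong_induction_on with
  | _ t ih =>
    obtain ⟨k, hk, rfl⟩ : ∃ k ≤ c.N, t = c.N - k := ⟨c.N - t, by omega, by omega⟩
    have hkt : (c.N : ℤ) - k = (c.N - k : ℕ) := by omega
    have hvi : ∀ i < c.N - k, Measurable[c.info x₀ w d u₀ v (c.N - k)] (v i) := fun i hi =>
      (ih i hi (by omega)).mono (c.info_mono x₀ w d u₀ v hi.le) le_rfl
    have hx : Measurable[c.info x₀ w d u₀ v (c.N - k)] fun ω =>
        (c.traj x₀ w d u₀ v (c.N - k) ω).2 :=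
      measurable_iff_comap_le.2 (le_sup_of_le_left (le_iSup₂_of_le (c.N - k) (Set.mem_Iic.2 le_rfl) le_rfl))
    have h1 : v (c.N - k) = fun ω => -((c.A11 k)⁻¹ *ᵥ
        c.A12 k (tau d (c.N - k) ω) (c.traj x₀ w d u₀ v (c.N - k) ω)) := by
      ext1 ω
      have h2 := tau_lt d (c.N - k) ω
      rw [c.A12_eq k (by omega), hv k hk ω]
      rfl
    rw [h1]
    refine (measurable_mulVec _ (measurable_index
      (g := fun j ω => c.A12 k j (c.traj x₀ w d u₀ v (c.N - k) ω))
      ((measurable_tauPrev d (c.N - k)).mono le_sup_right le_rfl) (neg_one_le_tau d (c.N - k))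
      (b := (c.N - k : ℕ)) (fun ω => (tau_lt d (c.N - k) ω).le) fun j _ _ => ?_)).neg
    simp only [A12_apply]
    refine Measurable.add (Finset.measurable_sum _ fun l hl => ?_) (measurable_mulVec _ hx)
    have hl := Finset.mem_Icc.1 hl
    exact measurable_mulVec _ (measurable_record hvi (by omega))

end HoldLQ

end

/-! ### The main theorem. -/

theorem mainTheorem1 {n m : ℕ} (c : HoldLQ n m)
    (hR : c.R.PosDef) (hQ : c.Q.PosSemidef) (hS : c.Sfin.PosSemidef)
    {Ω : Type*} [MeasurableSpace Ω] (μ : Measure Ω) [IsProbabilityMeasure μ]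
    (x₀ : Ω → Fin n → ℝ) (w : ℕ → Ω → Fin n → ℝ) (d : ℕ → Ω → ℕ∞) (u₀ : Fin m → ℝ)
    (hx₀ : Measurable x₀) (hw : ∀ i, Measurable (w i)) (hd : ∀ i, Measurable (d i))
    (hx₀2 : MemLp x₀ 2 μ) (hw2 : ∀ i, MemLp (w i) 2 μ) (hw0 : ∀ i, ∫ ω, w i ω ∂μ = 0)
    (hp : ∀ i j : ℕ, μ.real {ω | d i ω = j} = c.p j)
    (hind : iIndepFun (fun i ω => (d i ω, w i ω)) μ)
    (hdw : ∀ i, IndepFun (d i) (w i) μ)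
    (hind₀ : IndepFun x₀ (fun ω i => (d i ω, w i ω)) μ) :
    -- `A₁₂(N-k, τ)` is a matrix acting on `ζ_{N-k-1} = (v_{N-k-1}, …, v_τ, x_{N-k})`
    (∀ k ≤ c.N, ∀ τ : ℤ, -1 ≤ τ → τ ≤ c.N - k - 1 → ∀ (v : ℤ → Fin m → ℝ) (x : Fin n → ℝ),
      c.A12zeta k v τ x =
        ∑ t ∈ Finset.Icc τ (c.N - k - 1), c.A12v k τ t *ᵥ v t + c.A12x k *ᵥ x) ∧
    -- `A₁₁(N-k)` is positive definite when a signal sent at time `N-k` can arrive in time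
    (∀ k ≤ c.N, 0 < c.P k → (c.A11 k).PosDef) ∧
    -- the feedback law can be realized, with a finite cost
    (∃ v : ℕ → Ω → Fin m → ℝ, c.Admissible x₀ w d u₀ v ∧ c.J μ x₀ w d u₀ v < ∞ ∧
      ∀ k ≤ c.N, ∀ ω, v (c.N - k) ω =
        c.feedback (x₀ ω) (fun i => w i ω) (fun i => d i ω) u₀ (fun i => v i ω) k) ∧
    -- a causal control minimizes the cost if and only if it is given by the feedback law
    (∀ v : ℕ → Ω → Fin m → ℝ, c.Admissible x₀ w d u₀ v →
      ((∀ v' : ℕ → Ω → Fin m → ℝ, c.Admissible x₀ w d u₀ v' →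
          c.J μ x₀ w d u₀ v ≤ c.J μ x₀ w d u₀ v') ↔
        ∀ k ≤ c.N, 0 < c.P k → ∀ᵐ ω ∂μ, v (c.N - k) ω =
          c.feedback (x₀ ω) (fun i => w i ω) (fun i => d i ω) u₀ (fun i => v i ω) k)) := by
  have h : c.IsNoise μ x₀ w d := ⟨hx₀, hw, hd, hx₀2, hw2, hw0, hp, hind, hdw, hind₀⟩
  have hW : c.IsWeight := ⟨hR, hQ, hS⟩
  let V : ℕ → Ω → Fin m → ℝ := fun t ω =>
    c.law (x₀ ω) (fun i => w i ω) (fun i => d i ω) u₀ t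
  have hVf : ∀ k ≤ c.N, ∀ ω, V (c.N - k) ω =
      c.feedback (x₀ ω) (fun i => w i ω) (fun i => d i ω) u₀ (fun i => V i ω) k :=
    fun k hk ω => HoldLQ.law_eq hk
  have hV : c.Admissible x₀ w d u₀ V := HoldLQ.admissible_of_feedback hVf
  have hJ : c.J μ x₀ w d u₀ V = c.minCost μ x₀ w u₀ := by
    rw [h.J_eq hW hV, Finset.sum_eq_zero, add_zero]
    intro k hk
    have hk : k ≤ c.N := Nat.lt_succ_iff.1 (Finset.mem_range.1 hk)
    exact (h.lintegral_gapCost_eq_zero_iff hW hV hk).2 fun _ => ae_of_all _ (hVf k hk)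
  have hfin := h.minCost_lt_top hW (u₀ := u₀)
  refine ⟨fun k _ τ _ hτ v x => c.A12zeta_eq k τ hτ v x,
    fun k _ hk => hW.A11_posDef h.isProb k hk, ⟨V, hV, hJ ▸ hfin, hVf⟩, fun v hv => ?_⟩
  have hiff : (∀ v' : ℕ → Ω → Fin m → ℝ, c.Admissible x₀ w d u₀ v' →
      c.J μ x₀ w d u₀ v ≤ c.J μ x₀ w d u₀ v') ↔ ∑ j ∈ Finset.range (c.N + 1),
        ∫⁻ ω, ENNReal.ofReal (c.gapCost x₀ w d u₀ v j (c.N - j) ω) ∂μ = 0 := by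
    constructor
    · intro hmin
      have h1 := hmin V hV
      rw [hJ, h.J_eq hW hv] at h1
      -- Comparison with the feedback control, whose cost is the minimal one; finiteness of that
      -- cost permits cancellation in `[0, ∞]`.
      exact nonpos_iff_eq_zero.1
        ((ENNReal.add_le_add_iff_left hfin.ne).1 (h1.trans_eq (add_zero _).symm))
    · intro h0 v' hv'
      rw [h.J_eq hW hv, h.J_eq hW hv', h0, add_zero]
      exact le_self_add
  rw [hiff, Finset.sum_eq_zero_iff]
  simp only [Finset.mem_range, Nat.lt_succ_iff]
  exact forall₂_congr fun k hk => h.lintegral_gapCost_eq_zero_iff hW hv hk
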